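/- Let $0<p\le 1/2$, $\lambda\ge 0$, $0\le q\le 1$. For every $d>0$ let $a=a(d)$, $b=b(d)$, $c=c(d)$ be real numbers with $$pa+(1-p)b=pb+(1-p)c=1,\qquad d(1-b)^2=\lambda .$$ For $d>0$ such that $a,b,c\ge 0$ and for $n$ large, consider the stochastic block model on $\{1,\dots,n\}$: the labels $X_1,\dots,X_n\in\{1,2\}$ are independent with $\mathbb P(X_i=1)=p$; given the labels, each pair $\{i,j\}$ is an edge of the graph $G$ independently with probability $M_{X_iX_j}$, where $M=\frac dn\begin{pmatrix}a&b\\ b&c\end{pmatrix}$; moreover each vertex is included in a random set $E$ of revealed vertices independently with probability $q$, independently of everything else. For a vertex $i$ and $r\in\mathbb N$ let $[G]_{i,r}$ be the subgraph of $G$ induced by the vertices at distance at most $r$ from $i$, rooted at $i$, and let $E_{i,r}$ be the set of vertices of $E$ at distance exactly $r$ from $i$. Put $$\xi_{i,r}=\log\frac{\mathbb P\big(X_i=1\mid [G]_{i,r},E_{i,r},(X_s)_{s\in E_{i,r}}\big)}{\mathbb P\big(X_i=2\mid [G]_{i,r},E_{i,r},(X_s)_{s\in E_{i,r}}\big)}\in[-\infty,+\infty],$$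 and let $T^{loc}_r$ be the local test with $T^{loc}_{r,i}=1$ if $\xi_{i,r}\ge\log\frac{p}{1-p}$ and $T^{loc}_{r,i}=2$ otherwise. For a test $T=(T_1,\dots,T_n)$ let $$P_{succ}(T)=\frac1n\sum_{i=1}^n\Big(\mathbb P(T_i=1\mid X_i=1)+\mathbb P(T_i=2\mid X_i=2)-1\Big).$$ Define, for $\mu\ge 0$ and $Z\sim\mathcal N(0,1)$, $$G(\mu)=\frac{\lambda}{(1-p)^2}\,\mathbb E\Big[\frac{1}{p+(1-p)\exp(\sqrt\mu Z-\mu/2)}-1\Big],\qquad \mu_1=\frac{q\lambda}{p(1-p)},\quad \mu_{k+1}=G(\mu_k).$$ Proposition. The sequence $(\mu_k)$ converges to a real number $\mu_\infty$, the successive limits below all exist (the limit in $n$ for every $r\in\mathbb N$ and every $d>0$ with $a,b,c\ge0$, which includes all large $d$; the limit in $d$, over real $d\to\infty$, for every $r$), and $$\lim_{r\to\infty}\lim_{d\to\infty}\lim_{n\to\infty}P_{succ}(T^{loc}_r)=2\,\mathbb P\big(\mathcal N(\mu_\infty/2,\mu_\infty)>0\big)-1,$$ where for $\mu_\infty=0$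 the probability on the right is read as its limit value $1/2$ (so that the right-hand side is $0$); equivalently $\mathbb P(\mathcal N(\mu/2,\mu)>0)$ stands for $\mathbb P(Z>-\sqrt\mu/2)$. -/

import Mathlib

open MeasureTheory ProbabilityTheory Filter Topology

noncomputable section

/-! Class `1` of the mathematics is coded by `0 : Fin 2` and class `2` by `1 : Fin 2`. -/

/-- An outcome of the stochastic block model with side information: the labels of the `n` vertices,
the graph, and the set of vertices whose label is revealed. -/
structure SBM.Sample (n : ℕ) where
  label : Fin n → Fin 2
  graph : SimpleGraph (Fin n)
  revealed : Set (Fin n)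

instance SBM.instMeasurableSpaceSample (n : ℕ) : MeasurableSpace (SBM.Sample n) := ⊤

/-- The law of a label: class 1 has probability `p`, class 2 has probability `1 - p`. -/
def SBM.prior (p : ℝ) : Fin 2 → ℝ := ![p, 1 - p]

/-- The connectivity matrix `(d / n) * (a, b; b, c)`. -/
def SBM.connectivity (a b c d : ℝ) (n : ℕ) : Matrix (Fin 2) (Fin 2) ℝ :=
  (d / n) • !![a, b; b, c]

open Classical in
/-- The probability of an outcome: the labels are independent with law `prior p`; given the labels,
each pair `i < j` is an edge with probability `M (X_i) (X_j)`, independently; each vertex is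
revealed with probability `q`, independently of everything else. -/
def SBM.weight (M : Matrix (Fin 2) (Fin 2) ℝ) (p q : ℝ) {n : ℕ} (ω : SBM.Sample n) : ENNReal :=
  (∏ i, ENNReal.ofReal (SBM.prior p (ω.label i))) *
  (∏ e ∈ Finset.univ.filter (fun e : Fin n × Fin n => e.1 < e.2),
    if ω.graph.Adj e.1 e.2 then ENNReal.ofReal (M (ω.label e.1) (ω.label e.2))
    else ENNReal.ofReal (1 - M (ω.label e.1) (ω.label e.2))) *
  (∏ i, if i ∈ ω.revealed then ENNReal.ofReal q else ENNReal.ofReal (1 - q))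

/-- The joint law of labels, graph and revealed set. It is a probability measure whenever
`p`, `q` and the entries of the symmetric matrix `M` lie in `[0, 1]`. -/
def SBM.law (M : Matrix (Fin 2) (Fin 2) ℝ) (p q : ℝ) (n : ℕ) : Measure (SBM.Sample n) :=
  Measure.sum fun ω : SBM.Sample n => SBM.weight M p q ω • Measure.dirac ω

/-- The vertices at graph distance at most `r` from `i`. -/
def SBM.ball {n : ℕ} (g : SimpleGraph (Fin n)) (i : Fin n) (r : ℕ) : Set (Fin n) :=
  {v | g.edist i v ≤ r}

/-- The vertices at graph distance exactly `r` from `i`. -/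
def SBM.sphere {n : ℕ} (g : SimpleGraph (Fin n)) (i : Fin n) (r : ℕ) : Set (Fin n) :=
  {v | g.edist i v = r}

/-- What is observed at depth `r` around a root: the ball of radius `r` (its vertices and its
induced edges) and the revealed labels on its boundary (`none` where nothing is observed). -/
structure SBM.View (n : ℕ) where
  verts : Set (Fin n)
  edges : SimpleGraph (Fin n)
  labels : Fin n → Option (Fin 2)

open Classical in
/-- The depth-`r` view from the vertex `i` in the outcome `ω`. -/
def SBM.view {n : ℕ} (i : Fin n) (r : ℕ) (ω : SBM.Sample n) : SBM.View n where
  verts := SBM.ball ω.graph i r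
  edges := (ω.graph.induce (SBM.ball ω.graph i r)).spanningCoe
  labels := fun v =>
    if v ∈ SBM.sphere ω.graph i r ∧ v ∈ ω.revealed then some (ω.label v) else none

/-- The posterior probability that vertex `i` has class `x`, given the depth-`r` view from `i`,
evaluated at the outcome `ω`. -/
def SBM.posterior {n : ℕ} (P : Measure (SBM.Sample n)) (i : Fin n) (r : ℕ) (x : Fin 2)
    (ω : SBM.Sample n) : ENNReal :=
  ProbabilityTheory.cond P {ω' | SBM.view i r ω' = SBM.view i r ω} {ω' | ω'.label i = x}

/-- The depth-`r` posterior log-ratio `ξ` of the root `i`, with values in `[-∞, +∞]`. -/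
def SBM.logRatio {n : ℕ} (P : Measure (SBM.Sample n)) (i : Fin n) (r : ℕ)
    (ω : SBM.Sample n) : EReal :=
  ENNReal.log (SBM.posterior P i r 0 ω / SBM.posterior P i r 1 ω)

open Classical in
/-- The local test: class 1 if `ξ ≥ log (p / (1 - p))`, class 2 otherwise. -/
def SBM.localTest {n : ℕ} (P : Measure (SBM.Sample n)) (p : ℝ) (r : ℕ) (i : Fin n)
    (ω : SBM.Sample n) : Fin 2 :=
  if ((Real.log (p / (1 - p)) : ℝ) : EReal) ≤ SBM.logRatio P i r ω then 0 else 1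

/-- The rescaled average success probability
`(1/n) ∑ i, (ℙ(T_i = 1 | X_i = 1) + ℙ(T_i = 2 | X_i = 2) - 1)`. -/
def SBM.successProb {n : ℕ} (P : Measure (SBM.Sample n)) (T : Fin n → SBM.Sample n → Fin 2) : ℝ :=
  (1 / (n : ℝ)) * ∑ i : Fin n,
    ((ProbabilityTheory.cond P {ω | ω.label i = 0}).real {ω | T i ω = 0} +
      (ProbabilityTheory.cond P {ω | ω.label i = 1}).real {ω | T i ω = 1} - 1)

/-- `G(μ) = λ / (1-p)² * 𝔼[1 / (p + (1-p) exp(√μ Z - μ/2)) - 1]` with `Z` standard normal. -/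
def SBM.G (p lam μ : ℝ) : ℝ :=
  lam / (1 - p) ^ 2 *
    ∫ z, (1 / (p + (1 - p) * Real.exp (Real.sqrt μ * z - μ / 2)) - 1) ∂(gaussianReal 0 1)

/-- The sequence `μ_1 = q λ / (p (1-p))`, `μ_{k+1} = G(μ_k)`; `SBM.muSeq p lam q k` is `μ_{k+1}`. -/
def SBM.muSeq (p lam q : ℝ) : ℕ → ℝ
  | 0 => q * lam / (p * (1 - p))
  | k + 1 => SBM.G p lam (SBM.muSeq p lam q k)

/-- `ℙ(N(μ/2, μ) > 0)` for `μ > 0`, extended by continuity to the value `1/2` at `μ = 0`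
(that is, `ℙ(Z > -√μ/2)` with `Z` standard normal). -/
def SBM.gaussPos (μ : ℝ) : ℝ :=
  if μ = 0 then 1 / 2 else (gaussianReal (μ / 2) μ.toNNReal).real (Set.Ioi 0)

end

namespace SBM

/-! The threshold `log (p / (1 - p))` turns the posterior test into the likelihood ratio test, so
the success probability at a vertex is exactly the total variation distance between the laws of its
depth-`r` view given the two classes (`success_term`, where it appears as a sum of maxima minus
one). The three limits then concern this distance.

Limit in `n`. The view converges to a two-type Poisson branching tree with law `treeLaw`, and the
success probability tends to `gap (treeLaw …)` (`tendsto_successProb`). Only lower bounds are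
needed. For each tree labelled by vertices, the probability that it is the neighbourhood of its root
is bounded below (`law_real_realizes_ge`). Summing over labelled trees of a shape, with weight one
over the number of plane orderings so that no view is counted more than once, bounds below both the
sum of maxima and the sum of minima of the two view laws (`sum_shapeMass_le`). These sums add up to
2, and so do their tree analogues, so the two lower bounds enclose the limit. No coupling and no
estimate of cycles is required.

Limit in `d`. With `ε = 1 - b`, a child subtree contributes a log-likelihood ratio `childLLR p (ε *
dev)`, where `dev` is the deviation of the child's posterior from its prior. By the exponential
formula, the characteristic function of the total is the exponential of a sum over subtrees
(`IsPair.hasSum_charFun`). The posterior averages to the prior, so the first-order term, of size `d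
* ε`, vanishes exactly; the second-order term has size `d * ε ^ 2 = lam`. Hence the log-likelihood
ratio tends to `N(μ/2, μ)` under class 1, with `μ` proportional to the second moment of `dev` one
level below (`tendsto_tsum_nextLaw`). The second moment at the next level is the expectation of a
logistic function of this ratio, and that is the recursion `μ ↦ G μ` (`tendsto_treeLaw`). The
distance itself tends to `𝔼 (1 - e^{-W})⁺`, which a Gaussian tilt evaluates (`gaussGap_eq`).

Limit in `r`. `G` is monotone and bounded on the nonnegative reals, so the sequence is monotone and
converges (`exists_tendsto_muSeq`); the Gaussian expression is continuous in `μ`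
(`tendsto_gaussGap`). -/

/-! ### The scalar recursion: monotonicity of `G` and convergence of the sequence. -/

lemma map_affine_gaussianReal (s m : ℝ) :
    (gaussianReal 0 1).map (fun z => s * z + m) = gaussianReal m (s ^ 2).toNNReal := by
  have h1 : (gaussianReal 0 1).map (fun z => s * z) = gaussianReal 0 (s ^ 2).toNNReal := by
    rw [gaussianReal_map_const_mul]
    congr 1
    · simp
    · ext; simp [sq_nonneg]
  have h2 : (fun z : ℝ => s * z + m) = (fun z => z + m) ∘ (fun z => s * z) := rfl
  rw [h2, ← Measure.map_map (by fun_prop) (by fun_prop), h1, gaussianReal_map_add_const]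
  simp

/-- The logistic function `1 / (p + (1 - p) e^x)`. -/
noncomputable def logistic (p x : ℝ) : ℝ := 1 / (p + (1 - p) * Real.exp x)

variable {p : ℝ}

lemma logistic_denom_pos (hp0 : 0 < p) (hp : p ≤ 1 / 2) (x : ℝ) :
    0 < p + (1 - p) * Real.exp x := by
  have := Real.exp_pos x
  have : 0 ≤ (1 - p) * Real.exp x := mul_nonneg (by linarith) this.le
  linarith

lemma logistic_nonneg (hp0 : 0 < p) (hp : p ≤ 1 / 2) (x : ℝ) : 0 ≤ logistic p x :=
  (one_div_pos.2 (logistic_denom_pos hp0 hp x)).le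

lemma logistic_le (hp0 : 0 < p) (hp : p ≤ 1 / 2) (x : ℝ) : logistic p x ≤ 1 / p := by
  refine one_div_le_one_div_of_le hp0 ?_
  have : 0 ≤ (1 - p) * Real.exp x := mul_nonneg (by linarith) (Real.exp_pos x).le
  linarith

lemma continuous_logistic (hp0 : 0 < p) (hp : p ≤ 1 / 2) : Continuous (logistic p) := by
  unfold logistic
  exact continuous_const.div (by fun_prop) fun x => (logistic_denom_pos hp0 hp x).ne'

lemma integrable_logistic (hp0 : 0 < p) (hp : p ≤ 1 / 2) (f : ℝ → ℝ) (hf : Continuous f)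
    (ν : Measure ℝ) [IsFiniteMeasure ν] : Integrable (fun x => logistic p (f x)) ν := by
  refine Integrable.of_bound ((continuous_logistic hp0 hp).comp hf).aestronglyMeasurable (1 / p)
    (ae_of_all _ fun x => ?_)
  rw [Real.norm_of_nonneg (logistic_nonneg hp0 hp _)]
  exact logistic_le hp0 hp _

/-- The convex function `u ↦ 1 / u` lies above its tangent at `u = p + (1 - p) e^x`. The bound is
linear in `e^y - 1`, so the correction disappears when `e^y` has mean 1. -/
lemma logistic_add_ge (hp0 : 0 < p) (hp : p ≤ 1 / 2) (x y : ℝ) :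
    logistic p x - (1 - p) * Real.exp x * (Real.exp y - 1) * logistic p x ^ 2
      ≤ logistic p (x + y) := by
  unfold logistic
  rw [Real.exp_add]
  have hA := logistic_denom_pos hp0 hp x
  have hB := logistic_denom_pos hp0 hp (x + y)
  rw [Real.exp_add] at hB
  set A := p + (1 - p) * Real.exp x
  set B := p + (1 - p) * (Real.exp x * Real.exp y)
  have h : (1 - p) * Real.exp x * (Real.exp y - 1) = B - A := by simp only [A, B]; ring
  rw [h, div_pow, one_pow, ← sub_nonneg]
  have : 1 / B - (1 / A - (B - A) * (1 / A ^ 2)) = (B - A) ^ 2 / (A ^ 2 * B) := by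
    field_simp; ring
  rw [this]
  positivity

lemma integral_exp_sub_one (δ : ℝ) (hδ : 0 ≤ δ) :
    ∫ y, (Real.exp y - 1) ∂(gaussianReal (-δ / 2) δ.toNNReal) = 0 := by
  have hint : Integrable (fun y : ℝ => Real.exp y) (gaussianReal (-δ / 2) δ.toNNReal) := by
    simpa using integrable_exp_mul_gaussianReal (μ := -δ / 2) (v := δ.toNNReal) 1
  have h1 := congrFun (mgf_id_gaussianReal (μ := -δ / 2) (v := δ.toNNReal)) 1
  simp only [mgf, id, one_mul] at h1
  rw [integral_sub hint (integrable_const _), h1]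
  simp only [Real.coe_toNNReal _ hδ, integral_const, probReal_univ, smul_eq_mul, mul_one, one_pow]
  rw [show -δ / 2 + δ / 2 = 0 by ring]
  simp

/-- Jensen's inequality along the exponential martingale: going from `μ` to `ν` adds an independent
`N(-δ/2, δ)` increment, whose exponential has mean 1, and the logistic function is convex in the
exponential. -/
lemma integral_logistic_mono (hp0 : 0 < p) (hp : p ≤ 1 / 2) {μ ν : ℝ} (hμ : 0 ≤ μ) (h : μ ≤ ν) :
    ∫ x, logistic p x ∂(gaussianReal (-μ / 2) μ.toNNReal)
      ≤ ∫ x, logistic p x ∂(gaussianReal (-ν / 2) ν.toNNReal) := by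
  set δ := ν - μ
  have hδ : 0 ≤ δ := sub_nonneg.2 h
  have hconv : gaussianReal (-ν / 2) ν.toNNReal =
      (gaussianReal (-μ / 2) μ.toNNReal) ∗ (gaussianReal (-δ / 2) δ.toNNReal) := by
    rw [gaussianReal_conv_gaussianReal, ← Real.toNNReal_add hμ hδ]
    congr 1
    · simp only [δ]; ring
    · simp [δ]
  rw [hconv, integral_conv (f := logistic p) (integrable_logistic hp0 hp id continuous_id _)]
  have hint : Integrable (fun y : ℝ => Real.exp y) (gaussianReal (-δ / 2) δ.toNNReal) := by
    simpa using integrable_exp_mul_gaussianReal (μ := -δ / 2) (v := δ.toNNReal) 1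
  refine integral_mono (integrable_logistic hp0 hp id continuous_id _) ?_ fun x => ?_
  · refine Integrable.of_bound (C := 1 / p) ?_ (ae_of_all _ fun x => ?_)
    · refine StronglyMeasurable.aestronglyMeasurable ?_
      refine StronglyMeasurable.integral_prod_right' (f := fun z : ℝ × ℝ => logistic p (z.1 + z.2)) ?_
      exact ((continuous_logistic hp0 hp).comp (by fun_prop)).stronglyMeasurable
    · refine (norm_integral_le_of_norm_le_const (C := 1 / p) (ae_of_all _ fun y => ?_)).trans ?_
      · rw [Real.norm_of_nonneg (logistic_nonneg hp0 hp _)]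
        exact logistic_le hp0 hp _
      · simp
  · have h2 : ∫ y, (logistic p x - (1 - p) * Real.exp x * (Real.exp y - 1) * logistic p x ^ 2)
        ∂(gaussianReal (-δ / 2) δ.toNNReal) = logistic p x := by
      have : ∀ y, logistic p x - (1 - p) * Real.exp x * (Real.exp y - 1) * logistic p x ^ 2
        = logistic p x - ((1 - p) * Real.exp x * logistic p x ^ 2) * (Real.exp y - 1) := by
        intro y; ring
      simp_rw [this]
      have hint' : Integrable (fun y : ℝ => Real.exp y - 1) (gaussianReal (-δ / 2) δ.toNNReal) :=
        hint.sub (integrable_const _)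
      rw [integral_sub (integrable_const _) (hint'.const_mul _), integral_const_mul, integral_exp_sub_one δ hδ]
      simp
    calc logistic p x = _ := h2.symm
      _ ≤ _ := by
        refine integral_mono ?_ ?_ fun y => logistic_add_ge hp0 hp x y
        · exact (integrable_const _).sub
            (((hint.sub (integrable_const _)).const_mul _).mul_const _)
        · exact integrable_logistic hp0 hp _ (by fun_prop) _

/-- Expressing `G` through the law `N(-μ/2, μ)` makes the dependence on `μ` a convolution semigroup,
which is what the monotonicity argument uses. -/
lemma G_eq (hp0 : 0 < p) (hp : p ≤ 1 / 2) (lam : ℝ) {μ : ℝ} (hμ : 0 ≤ μ) :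
    G p lam μ = lam / (1 - p) ^ 2 *
      (∫ x, logistic p x ∂(gaussianReal (-μ / 2) μ.toNNReal) - 1) := by
  have hm := map_affine_gaussianReal (Real.sqrt μ) (-μ / 2)
  rw [Real.sq_sqrt hμ] at hm
  rw [G, ← hm, integral_map (by fun_prop) (continuous_logistic hp0 hp).aestronglyMeasurable]
  congr 1
  have : ∀ z : ℝ, Real.sqrt μ * z + -μ / 2 = Real.sqrt μ * z - μ / 2 := by intro z; ring
  simp_rw [this]
  have hi : Integrable (fun z => logistic p (Real.sqrt μ * z - μ / 2)) (gaussianReal 0 1) :=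
    integrable_logistic hp0 hp _ (by fun_prop) _
  unfold logistic at hi ⊢
  rw [integral_sub hi (integrable_const _)]
  simp

lemma G_mono (hp0 : 0 < p) (hp : p ≤ 1 / 2) {lam : ℝ} (hlam : 0 ≤ lam) {μ ν : ℝ} (hμ : 0 ≤ μ)
    (h : μ ≤ ν) : G p lam μ ≤ G p lam ν := by
  rw [G_eq hp0 hp lam hμ, G_eq hp0 hp lam (hμ.trans h)]
  have := integral_logistic_mono hp0 hp hμ h
  gcongr

lemma G_zero (p lam : ℝ) : G p lam 0 = 0 := by
  simp [G]

lemma G_nonneg (hp0 : 0 < p) (hp : p ≤ 1 / 2) {lam : ℝ} (hlam : 0 ≤ lam) {μ : ℝ} (hμ : 0 ≤ μ) :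
    0 ≤ G p lam μ := by
  have := G_mono hp0 hp hlam le_rfl hμ
  rwa [G_zero] at this

lemma G_le (hp0 : 0 < p) (hp : p ≤ 1 / 2) {lam : ℝ} (hlam : 0 ≤ lam) {μ : ℝ} (hμ : 0 ≤ μ) :
    G p lam μ ≤ lam / (1 - p) ^ 2 * (1 / p - 1) := by
  rw [G_eq hp0 hp lam hμ]
  gcongr
  calc _ ≤ ∫ _, 1 / p ∂(gaussianReal (-μ / 2) μ.toNNReal) :=
        integral_mono (integrable_logistic hp0 hp id continuous_id _) (integrable_const _)
          fun x => logistic_le hp0 hp x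
    _ = 1 / p := by simp

lemma muSeq_nonneg (hp0 : 0 < p) (hp : p ≤ 1 / 2) {lam q : ℝ} (hlam : 0 ≤ lam) (hq0 : 0 ≤ q)
    (k : ℕ) : 0 ≤ muSeq p lam q k := by
  induction k with
  | zero =>
    have : 0 < 1 - p := by linarith
    simp only [muSeq]
    positivity
  | succ k ih => exact G_nonneg hp0 hp hlam ih

/-- The recursion `μ ↦ G μ` converges, being monotone and bounded. -/
lemma exists_tendsto_muSeq (hp0 : 0 < p) (hp : p ≤ 1 / 2) {lam q : ℝ} (hlam : 0 ≤ lam)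
    (hq0 : 0 ≤ q) : ∃ μinf, Tendsto (muSeq p lam q) atTop (𝓝 μinf) := by
  have h0 := muSeq_nonneg hp0 hp (q := q) hlam hq0
  -- Since `G` is monotone, the direction of the first step persists.
  rcases le_total (muSeq p lam q 0) (muSeq p lam q 1) with h | h
  · have hm : Monotone (muSeq p lam q) := by
      refine monotone_nat_of_le_succ fun k => ?_
      induction k with
      | zero => exact h
      | succ k ih => exact G_mono hp0 hp hlam (h0 k) ih
    refine ⟨_, tendsto_atTop_ciSup hm ⟨max (muSeq p lam q 0) (lam / (1 - p) ^ 2 * (1 / p - 1)), ?_⟩⟩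
    rintro _ ⟨k, rfl⟩
    cases k with
    | zero => exact le_max_left _ _
    | succ k => exact (G_le hp0 hp hlam (h0 k)).trans (le_max_right _ _)
  · have hm : Antitone (muSeq p lam q) := by
      refine antitone_nat_of_succ_le fun k => ?_
      induction k with
      | zero => exact h
      | succ k ih => exact G_mono hp0 hp hlam (h0 (k + 1)) ih
    refine ⟨_, tendsto_atTop_ciInf hm ⟨0, ?_⟩⟩
    rintro _ ⟨k, rfl⟩
    exact h0 k

/-! ### The Gaussian total variation distance. -/

/-- `𝔼 (1 - e^{-W})⁺` for `W ∼ N(μ/2, μ)`. -/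
noncomputable def gaussGap (μ : ℝ) : ℝ :=
  ∫ w, max (1 - Real.exp (-w)) 0 ∂(gaussianReal (μ / 2) μ.toNNReal)

lemma abs_max_one_sub_exp_le (w : ℝ) : ‖max (1 - Real.exp (-w)) 0‖ ≤ 1 := by
  rw [Real.norm_of_nonneg (le_max_right _ _)]
  exact max_le (by linarith [Real.exp_pos (-w)]) zero_le_one

/-- The integrand lives on the positive half-line, and weighting `N(μ/2, μ)` by `e^{-w}` gives
`N(-μ/2, μ)`, the reflected law. The integral is therefore the mass of the positive half-line minus
that of the negative one. -/
lemma gaussGap_eq (μ : ℝ) (hμ : 0 ≤ μ) : gaussGap μ = 2 * gaussPos μ - 1 := by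
  unfold gaussGap gaussPos
  split_ifs with h
  · subst h
    simp
  have hpos : 0 < μ := lt_of_le_of_ne hμ (Ne.symm h)
  have hv : μ.toNNReal ≠ 0 := by simpa using hpos
  have hcoe : (μ.toNNReal : ℝ) = μ := Real.coe_toNNReal _ hμ
  set g := gaussianReal (μ / 2) μ.toNNReal with hg
  have hind : ∀ w, max (1 - Real.exp (-w)) 0 =
      (Set.Ioi (0 : ℝ)).indicator (fun w => 1 - Real.exp (-w)) w := by
    intro w
    by_cases hw : 0 < w
    · rw [Set.indicator_of_mem (by exact hw), max_eq_left]
      have : Real.exp (-w) ≤ 1 := Real.exp_le_one_iff.2 (by linarith)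
      linarith
    · rw [Set.indicator_of_notMem (by exact hw), max_eq_right]
      have : 1 ≤ Real.exp (-w) := Real.one_le_exp (by linarith)
      linarith
  simp_rw [hind]
  have hint : Integrable (fun y : ℝ => Real.exp (-y)) g := by
    simpa using integrable_exp_mul_gaussianReal (μ := μ / 2) (v := μ.toNNReal) (-1)
  rw [integral_indicator measurableSet_Ioi, integral_sub (integrable_const _) hint.integrableOn]
  have htilt : ∫ w in Set.Ioi (0:ℝ), Real.exp (-w) ∂g
      = (gaussianReal (-(μ / 2)) μ.toNNReal).real (Set.Ioi 0) := by
    rw [Measure.real, gaussianReal_apply_eq_integral _ hv, ENNReal.toReal_ofReal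
      (integral_nonneg fun x => gaussianPDFReal_nonneg _ _ _), hg,
      ← integral_indicator measurableSet_Ioi, integral_gaussianReal_eq_integral_smul hv,
      ← integral_indicator measurableSet_Ioi]
    congr 1
    ext w
    by_cases hw : w ∈ Set.Ioi (0:ℝ)
    · simp only [Set.indicator_of_mem hw, smul_eq_mul, gaussianPDFReal, hcoe]
      rw [mul_assoc, ← Real.exp_add]
      congr 2
      field_simp
      ring
    · simp [Set.indicator_of_notMem hw]
  have hneg : (gaussianReal (-(μ / 2)) μ.toNNReal).real (Set.Ioi 0) = g.real (Set.Iio 0) := by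
    rw [← gaussianReal_map_neg, map_measureReal_apply measurable_neg measurableSet_Ioi]
    congr 1
    ext x; simp
  have : NullSingletonClass g := nullSingletonClass_gaussianReal hv
  have hcompl : g.real (Set.Iio 0) = 1 - g.real (Set.Ioi 0) := by
    rw [← probReal_compl_eq_one_sub measurableSet_Ioi, Set.compl_Ioi]
    exact measureReal_congr Iio_ae_eq_Iic
  rw [htilt, hneg, hcompl]
  simp
  ring

/-- All the Gaussian laws are realised on one standard normal variable, so dominated convergence
applies, including at the degenerate limit `m = 0`. -/
lemma tendsto_gaussGap {m : ℝ} {μ : ℕ → ℝ} (hμ : ∀ k, 0 ≤ μ k) (h : Tendsto μ atTop (𝓝 m)) :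
    Tendsto (fun k => gaussGap (μ k)) atTop (𝓝 (gaussGap m)) := by
  have hm : 0 ≤ m := ge_of_tendsto' h hμ
  have key : ∀ x, 0 ≤ x → gaussGap x =
      ∫ z, max (1 - Real.exp (-(Real.sqrt x * z + x / 2))) 0 ∂(gaussianReal 0 1) := by
    intro x hx
    have hma := map_affine_gaussianReal (Real.sqrt x) (x / 2)
    rw [Real.sq_sqrt hx] at hma
    rw [gaussGap, ← hma, integral_map (by fun_prop)
      (Continuous.aestronglyMeasurable (by fun_prop))]
  rw [key m hm]
  simp_rw [fun k => key (μ k) (hμ k)]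
  refine tendsto_integral_of_dominated_convergence (fun _ => 1) (fun k => ?_) (integrable_const _)
    (fun k => ae_of_all _ fun z => abs_max_one_sub_exp_le _) (ae_of_all _ fun z => ?_)
  · exact Continuous.aestronglyMeasurable (by fun_prop)
  · have hc : Continuous fun x : ℝ => max (1 - Real.exp (-(Real.sqrt x * z + x / 2))) 0 := by
      fun_prop
    exact (hc.tendsto m).comp h

/-! ### The exponential formula for weighted lists. -/

section ListSums

variable {τ : Type*} {𝕜 : Type*} [RCLike 𝕜]

/-- Absolute summability is carried through the induction because the product of two series needs it
at each step. -/
lemma hasSum_prod_fin {f : τ → 𝕜} {s : 𝕜} (hf : HasSum f s) (hn : Summable fun t => ‖f t‖) (k : ℕ) :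
    (Summable fun v : Fin k → τ => ‖∏ i, f (v i)‖) ∧
      HasSum (fun v : Fin k → τ => ∏ i, f (v i)) (s ^ k) := by
  induction k with
  | zero =>
    refine ⟨(hasSum_fintype _).summable, ?_⟩
    convert! hasSum_fintype (fun v : Fin 0 → τ => ∏ i, f (v i))
    simp
  | succ k ih =>
    have key : ∀ x : τ × (Fin k → τ),
        (∏ i, f (Fin.consEquiv (fun _ : Fin (k + 1) => τ) x i)) = f x.1 * ∏ i, f (x.2 i) := by
      intro x
      rw [Fin.prod_univ_succ]
      simp [Fin.consEquiv]
    constructor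
    · rw [← (Fin.consEquiv (fun _ : Fin (k + 1) => τ)).summable_iff]
      have h : ((fun v : Fin (k + 1) → τ => ‖∏ i, f (v i)‖) ∘
          (Fin.consEquiv (fun _ : Fin (k + 1) => τ))) =
          fun x : τ × (Fin k → τ) => ‖f x.1 * ∏ i, f (x.2 i)‖ := by
        funext x; simp only [Function.comp, key]
      rw [h]
      have ih1 := ih.1
      set F := fun v : Fin k → τ => ∏ i, f (v i) with hF
      have hF' : ∀ v, ∏ i, f (v i) = F v := fun _ => rfl
      simp only [hF'] at ih1 ⊢
      clear_value F
      exact hn.mul_norm ih1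
    · rw [← (Fin.consEquiv (fun _ : Fin (k + 1) => τ)).hasSum_iff, pow_succ']
      have h : ((fun v : Fin (k + 1) → τ => ∏ i, f (v i)) ∘
          (Fin.consEquiv (fun _ : Fin (k + 1) => τ))) =
          fun x : τ × (Fin k → τ) => f x.1 * ∏ i, f (x.2 i) := by
        funext x; simp only [Function.comp, key]
      rw [h]
      obtain ⟨ih1, ih2⟩ := ih
      set F := fun v : Fin k → τ => ∏ i, f (v i) with hF
      have hF' : ∀ v, ∏ i, f (v i) = F v := fun _ => rfl
      simp only [hF'] at ih1 ⊢
      clear_value F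
      exact hf.mul ih2 (summable_mul_of_summable_norm hn ih1)

/-- The exponential formula for sums over lists of a product weight. -/
lemma hasSum_list_exp {f : τ → 𝕜} {s : 𝕜} (hf : HasSum f s) (hn : Summable fun t => ‖f t‖) :
    HasSum (fun l : List τ => ((l.length.factorial : ℕ) : 𝕜)⁻¹ * (l.map f).prod)
      (NormedSpace.exp s) := by
  rw [← (List.equivSigmaTuple (α := τ)).symm.hasSum_iff]
  have key : ∀ x : (Σ k, Fin k → τ),
      ((fun l : List τ => ((l.length.factorial : ℕ) : 𝕜)⁻¹ * (l.map f).prod) ∘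
        (List.equivSigmaTuple (α := τ)).symm) x = ((x.1.factorial : ℕ) : 𝕜)⁻¹ * ∏ i, f (x.2 i) := by
    rintro ⟨k, v⟩
    simp [List.equivSigmaTuple, List.map_ofFn, List.prod_ofFn]
  rw [funext key]
  obtain ⟨S, hS⟩ := hn
  have hS' : HasSum (fun t => ‖(‖f t‖ : ℝ)‖) S := by simpa using hS
  refine HasSum.sigma_of_hasSum (NormedSpace.expSeries_div_hasSum_exp s) (fun k => ?_) ?_
  · rw [div_eq_inv_mul]
    exact ((hasSum_prod_fin hf ⟨S, hS⟩ k).2).mul_left _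
  -- The norms sum to the exponential series of `S = ∑ ‖f t‖`, by the same expansion applied to
  -- `‖f‖`.
  · refine Summable.of_norm ?_
    rw [summable_sigma_of_nonneg fun _ => norm_nonneg _]
    constructor
    · intro k
      simp only [norm_mul]
      exact (hasSum_prod_fin hf ⟨S, hS⟩ k).1.mul_left _
    · refine (NormedSpace.expSeries_div_hasSum_exp S).summable.congr fun k => ?_
      have h1 := (hasSum_prod_fin hS ⟨S, hS'⟩ k).2
      have h2 : ∀ v : Fin k → τ, ‖((k.factorial : ℕ) : 𝕜)⁻¹ * ∏ i, f (v i)‖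
          = ((k.factorial : ℕ) : ℝ)⁻¹ * ∏ i, ‖f (v i)‖ := by
        intro v
        rw [norm_mul, norm_prod, norm_inv, RCLike.norm_natCast]
      simp only [h2]
      rw [(h1.mul_left _).tsum_eq, div_eq_inv_mul]

end ListSums

/-! ### The two-type Poisson branching tree. -/

/-- Shapes of plane trees of height at most `r`, with a possibly revealed label on each vertex at
depth `r`. -/
def Shape : ℕ → Type
  | 0 => Option (Fin 2)
  | r + 1 => List (Shape r)

/-- The probability of observing `o` at a vertex of class `x`. -/
noncomputable def obs (q : ℝ) (x : Fin 2) : Option (Fin 2) → ℝ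
  | none => 1 - q
  | some y => if y = x then q else 0

/-- The law, on plane trees, of the depth-`r` view of the two-type Poisson branching process whose
root has class `x`; a vertex of class `x` has `Poisson (prior y * K x y)` children of class `y`. -/
noncomputable def treeLaw (p q d : ℝ) (K : Matrix (Fin 2) (Fin 2) ℝ) :
    ∀ r : ℕ, Fin 2 → Shape r → ℝ
  | 0, x, o => obs q x o
  | r + 1, x, l => Real.exp (-d) * (((List.length l).factorial : ℝ)⁻¹ *
      (List.map (fun c => ∑ y, prior p y * (K x y * treeLaw p q d K r y c)) l).prod)

section TreeLaw

variable {p q d : ℝ} {K : Matrix (Fin 2) (Fin 2) ℝ}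

lemma obs_nonneg (hq0 : 0 ≤ q) (hq1 : q ≤ 1) (x : Fin 2) (o : Option (Fin 2)) : 0 ≤ obs q x o := by
  cases o with
  | none => simpa [obs] using hq1
  | some y => simp only [obs]; split_ifs <;> simp [hq0]

lemma prior_nonneg (hp0 : 0 ≤ p) (hp1 : p ≤ 1) (x : Fin 2) : 0 ≤ prior p x := by
  fin_cases x <;> simp [prior, hp0, hp1]

lemma sum_prior (p : ℝ) : ∑ y, prior p y = 1 := by simp [prior]

lemma treeLaw_nonneg (hp0 : 0 ≤ p) (hp1 : p ≤ 1) (hq0 : 0 ≤ q) (hq1 : q ≤ 1)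
    (hK : ∀ x y, 0 ≤ K x y) (r : ℕ) (x : Fin 2) (l : Shape r) : 0 ≤ treeLaw p q d K r x l := by
  induction r generalizing x with
  | zero => exact obs_nonneg hq0 hq1 x l
  | succ r ih =>
    refine mul_nonneg (Real.exp_pos _).le (mul_nonneg (by positivity) (List.prod_nonneg ?_))
    intro a ha
    obtain ⟨c, -, rfl⟩ := List.mem_map.1 ha
    exact Finset.sum_nonneg fun y _ =>
      mul_nonneg (prior_nonneg hp0 hp1 y) (mul_nonneg (hK x y) (ih y c))

lemma hasSum_obs (q : ℝ) (x : Fin 2) : HasSum (obs q x) 1 := by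
  convert! hasSum_fintype (obs q x)
  fin_cases x <;> simp [Fintype.sum_option, obs]

/-- Both classes have mean offspring `d`, so the sum over lists of children is `e^d`, which the
factor `e^{-d}` normalises. -/
lemma hasSum_treeLaw (hp0 : 0 ≤ p) (hp1 : p ≤ 1) (hq0 : 0 ≤ q) (hq1 : q ≤ 1)
    (hK : ∀ x y, 0 ≤ K x y) (hrow : ∀ x, ∑ y, prior p y * K x y = d) (r : ℕ) (x : Fin 2) :
    HasSum (treeLaw p q d K r x) 1 := by
  induction r generalizing x with
  | zero => exact hasSum_obs q x
  | succ r ih =>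
    have h1 : HasSum (fun c : Shape r => ∑ y, prior p y * (K x y * treeLaw p q d K r y c)) d := by
      have := hasSum_sum fun y (_ : y ∈ Finset.univ) => (ih y).mul_left (prior p y * K x y)
      simpa only [mul_one, hrow x, mul_assoc] using this
    have hn : ∀ c : Shape r, 0 ≤ ∑ y, prior p y * (K x y * treeLaw p q d K r y c) := fun c =>
      Finset.sum_nonneg fun y _ => mul_nonneg (prior_nonneg hp0 hp1 y)
        (mul_nonneg (hK x y) (treeLaw_nonneg hp0 hp1 hq0 hq1 hK r y c))
    have h2 := (hasSum_list_exp h1 (h1.summable.congr fun c => by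
      rw [Real.norm_of_nonneg (hn c)])).mul_left (Real.exp (-d))
    rw [← Real.exp_eq_exp_ℝ, ← Real.exp_add, neg_add_cancel, Real.exp_zero] at h2
    exact h2

end TreeLaw

/-! ### Second-order expansion of the contribution of one child. -/

open Asymptotics in
lemma isLittleO_log_one_add :
    (fun x : ℝ => Real.log (1 + x) - x + x ^ 2 / 2) =o[𝓝 0] fun x => x ^ 2 := by
  have h1 : (fun x : ℝ => Real.log (1 + x) - x + x ^ 2 / 2) =O[𝓝 0] fun x => x ^ 3 := by
    refine IsBigO.of_bound 2 ?_
    filter_upwards [Metric.ball_mem_nhds (0:ℝ) (by norm_num : (0:ℝ) < 1/2)] with x hx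
    rw [Metric.mem_ball, dist_zero_right, Real.norm_eq_abs] at hx
    have := Real.abs_log_sub_add_sum_range_le (x := -x) (by rw [abs_neg]; linarith) 2
    simp only [Finset.sum_range_succ, Finset.range_zero, Finset.sum_empty, zero_add, pow_one,
      CharP.cast_eq_zero, div_one, Nat.reduceAdd, even_two, Even.neg_pow, Nat.cast_one,
      sub_neg_eq_add, abs_neg] at this
    rw [Real.norm_eq_abs, norm_pow, Real.norm_eq_abs]
    calc _ = |-x + x ^ 2 / (1 + 1) + Real.log (1 + x)| := by congr 1; ring
      _ ≤ _ := this
      _ ≤ 2 * |x| ^ 3 := by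
        rw [div_le_iff₀ (by linarith)]
        have : 0 ≤ |x| ^ 3 := by positivity
        nlinarith
  exact h1.trans_isLittleO (isLittleO_pow_pow (by norm_num))

/-- The log-likelihood ratio contributed by one child. -/
noncomputable def childLLR (p η : ℝ) : ℝ := Real.log (1 + η / p) - Real.log (1 - η / (1 - p))

/-- The characteristic exponent contributed by one child under class 1. -/
noncomputable def tilt (p s η : ℝ) : ℂ :=
  ((1 + η / p : ℝ) : ℂ) * Complex.exp (s * childLLR p η * Complex.I)

/-- First-order coefficient of `tilt`. -/
noncomputable def tiltA (p s : ℝ) : ℂ :=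
  (1 + s * Complex.I) * (1 / p : ℝ) - s * Complex.I * (-(1 / (1 - p)) : ℝ)

/-- Second-order coefficient of `tilt`. -/
noncomputable def tiltB (p s : ℝ) : ℂ :=
  -((1 + s * Complex.I) * (1 / p : ℝ) ^ 2 - s * Complex.I * (-(1 / (1 - p)) : ℝ) ^ 2) / 2
    + tiltA p s ^ 2 / 2

/-- The combination `i s - s²` is twice the characteristic exponent of `N(1/2, 1)`: this is where
the relation between mean and variance of the limit `N(μ/2, μ)` comes from. -/
lemma tiltB_eq {p : ℝ} (hp0 : 0 < p) (hp : p ≤ 1 / 2) (s : ℝ) :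
    tiltB p s = (s * Complex.I - s ^ 2) / (2 * (p * (1 - p)) ^ 2) := by
  have h1 : (p : ℂ) ≠ 0 := by exact_mod_cast hp0.ne'
  have h2 : (1 - p : ℂ) ≠ 0 := by
    have : (1 - p : ℝ) ≠ 0 := by linarith
    exact_mod_cast this
  unfold tiltB tiltA
  push_cast
  field_simp
  ring_nf
  simp only [Complex.I_sq]
  ring

-- Near 0, `tilt` is the exponential of a combination of two logarithms. Expanding the logarithms to
-- second order and then the exponential gives the linear coefficient, and the quadratic one as that
-- of the logarithm plus half the square of the linear one.
open Asymptotics in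
lemma isLittleO_tilt (p s : ℝ) :
    (fun η : ℝ => tilt p s η - 1 - tiltA p s * η - tiltB p s * η ^ 2) =o[𝓝 0]
      fun η : ℝ => η ^ 2 := by
  have hlin : ∀ k : ℝ, (fun η : ℝ => ((Real.log (1 + k * η) - k * η + (k * η) ^ 2 / 2 : ℝ) : ℂ))
      =o[𝓝 0] fun η : ℝ => η ^ 2 := by
    intro k
    have ht : Tendsto (fun η : ℝ => k * η) (𝓝 0) (𝓝 0) := by
      have : Continuous fun η : ℝ => k * η := by fun_prop
      simpa using this.tendsto 0
    have h := (isLittleO_log_one_add.comp_tendsto ht)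
    have h2 : (fun η : ℝ => (k * η) ^ 2) =O[𝓝 0] fun η : ℝ => η ^ 2 := by
      simp_rw [mul_pow]
      exact (isBigO_refl _ _).const_mul_left _
    have h3 := h.trans_isBigO h2
    exact isLittleO_norm_left.1 (h3.norm_left.congr_left fun η => (Complex.norm_real _).symm)
  set Λ : ℝ → ℂ := fun η => (1 + s * Complex.I) * (Real.log (1 + 1 / p * η) : ℝ)
    - s * Complex.I * (Real.log (1 + -(1 / (1 - p)) * η) : ℝ) with hΛ
  set β : ℂ :=
    -((1 + s * Complex.I) * (1 / p : ℝ) ^ 2 - s * Complex.I * (-(1 / (1 - p)) : ℝ) ^ 2) / 2 with hβ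
  have hL2 : (fun η : ℝ => Λ η - tiltA p s * η - β * η ^ 2) =o[𝓝 0] fun η : ℝ => η ^ 2 := by
    have h := ((hlin (1 / p)).const_mul_left (1 + s * Complex.I)).sub
      ((hlin (-(1 / (1 - p)))).const_mul_left (s * Complex.I))
    refine h.congr_left fun η => ?_
    simp only [hΛ, hβ, tiltA]
    push_cast
    ring
  have hsq : (fun η : ℝ => β * (η : ℂ) ^ 2) =O[𝓝 0] fun η : ℝ => η ^ 2 := by
    refine IsBigO.const_mul_left ?_ _
    refine IsBigO.of_bound 1 (Eventually.of_forall fun η => ?_)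
    simp
  have hid : (fun η : ℝ => tiltA p s * (η : ℂ)) =O[𝓝 0] fun η : ℝ => η := by
    refine IsBigO.const_mul_left ?_ _
    refine IsBigO.of_bound 1 (Eventually.of_forall fun η => ?_)
    simp
  have hL1 : (fun η : ℝ => Λ η - tiltA p s * η) =O[𝓝 0] fun η : ℝ => η ^ 2 := by
    refine (hL2.isBigO.add hsq).congr_left fun η => ?_
    ring
  have hpow : (fun η : ℝ => η ^ 2) =O[𝓝 0] fun η : ℝ => η := by
    simpa using (isLittleO_pow_pow (𝕜 := ℝ) (m := 1) (n := 2) (by norm_num)).isBigO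
  have hL0 : Λ =O[𝓝 0] fun η : ℝ => η := by
    refine ((hL1.trans hpow).add hid).congr_left fun η => ?_
    ring
  have hLt : Tendsto Λ (𝓝 0) (𝓝 0) := hL0.trans_tendsto tendsto_id
  have hexp : (fun η : ℝ => Complex.exp (Λ η) - 1 - Λ η - Λ η ^ 2 / 2) =o[𝓝 0]
      fun η : ℝ => η ^ 2 := by
    have h := (Complex.exp_sub_sum_range_isBigO_pow 3).comp_tendsto hLt
    have h2 : (fun η => Λ η ^ 3) =O[𝓝 0] fun η : ℝ => η ^ 3 := hL0.pow 3
    have h3 := (h.trans h2).trans_isLittleO (isLittleO_pow_pow (m := 2) (n := 3) (by norm_num))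
    refine h3.congr_left fun η => ?_
    simp [Finset.sum_range_succ]
    ring
  -- The square `Λ²` may be replaced by `(tiltA η)²`: the difference of squares factors as `O(η²)`
  -- times `O(η)`.
  have hprod : (fun η : ℝ => (Λ η - tiltA p s * η) * (Λ η + tiltA p s * η)) =o[𝓝 0]
      fun η : ℝ => η ^ 2 := by
    have h := hL1.mul (hL0.add hid)
    have h2 : (fun η : ℝ => η ^ 2 * η) =o[𝓝 0] fun η : ℝ => η ^ 2 := by
      refine (isLittleO_pow_pow (𝕜 := ℝ) (m := 2) (n := 3) (by norm_num)).congr_left fun η => ?_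
      ring
    exact h.trans_isLittleO h2
  have hfin := (hexp.add hL2).add (hprod.const_mul_left (1 / 2))
  refine hfin.congr' ?_ EventuallyEq.rfl
  have hpos : ∀ᶠ η : ℝ in 𝓝 0, 0 < 1 + η / p := by
    have : Continuous fun η : ℝ => 1 + η / p := by fun_prop
    exact this.tendsto 0 |>.eventually (lt_mem_nhds (by simp))
  filter_upwards [hpos] with η hη
  have h1 : tilt p s η = Complex.exp (Λ η) := by
    rw [tilt, ← Real.exp_log hη, Complex.ofReal_exp, ← Complex.exp_add]
    congr 1
    simp only [hΛ, childLLR]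
    rw [show 1 + 1 / p * η = 1 + η / p by ring, show 1 + -(1 / (1 - p)) * η = 1 - η / (1 - p) by ring]
    push_cast
    ring
  rw [h1, tiltB, ← hβ]
  ring

/-! ### Discrete weights as probability measures on the line. -/

section DiscreteLaw

variable {α : Type*}

/-- The probability mass function with real weights `w`. -/
noncomputable def realPMF (w : α → ℝ) (hw : ∀ a, 0 ≤ w a) (h1 : HasSum w 1) : PMF α :=
  ⟨fun a => ENNReal.ofReal (w a), by
    have := ENNReal.summable.hasSum (f := fun a => ENNReal.ofReal (w a))
    rwa [← ENNReal.ofReal_tsum_of_nonneg hw h1.summable, h1.tsum_eq, ENNReal.ofReal_one] at this⟩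

/-- The law of `W` under the probability mass function `w`. -/
noncomputable def discreteLaw (w W : α → ℝ) (hw : ∀ a, 0 ≤ w a) (h1 : HasSum w 1) :
    ProbabilityMeasure ℝ :=
  letI : MeasurableSpace α := ⊤
  ⟨Measure.map W (realPMF w hw h1).toMeasure,
    Measure.isProbabilityMeasure_map (Measurable.aemeasurable measurable_from_top)⟩

lemma integral_discreteLaw {E : Type*} [NormedAddCommGroup E] [NormedSpace ℝ E] [CompleteSpace E]
    (w W : α → ℝ) (hw : ∀ a, 0 ≤ w a) (h1 : HasSum w 1) (f : ℝ → E)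
    (hf : StronglyMeasurable f) (C : ℝ) (hC : ∀ x, ‖f x‖ ≤ C) :
    ∫ x, f x ∂(discreteLaw w W hw h1 : Measure ℝ) = ∑' a, w a • f (W a) := by
  let _ : MeasurableSpace α := ⊤
  have hm : Measurable W := measurable_from_top
  change ∫ x, f x ∂(Measure.map W _) = _
  rw [integral_map hm.aemeasurable hf.aestronglyMeasurable, PMF.integral_eq_tsum]
  · refine tsum_congr fun a => ?_
    congr 1
    exact ENNReal.toReal_ofReal (hw a)
  · exact Integrable.of_bound (hf.comp_measurable hm).aestronglyMeasurable C
      (ae_of_all _ fun a => hC _)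

end DiscreteLaw

/-! ### One generation: posteriors, log-likelihood ratios and their characteristic function. -/

section NextLaw

variable {τ : Type*} (p : ℝ) (P : Fin 2 → τ → ℝ)

/-- The mixture of the two conditional laws. -/
noncomputable def mix (t : τ) : ℝ := p * P 0 t + (1 - p) * P 1 t

/-- The posterior probability of class 1. -/
noncomputable def post (t : τ) : ℝ := p * P 0 t / mix p P t

/-- The deviation of the posterior from the prior. -/
noncomputable def dev (t : τ) : ℝ := post p P t - p

/-- The conditional law of a list of subtrees given the class of the root. -/
noncomputable def nextLaw (d : ℝ) (K : Matrix (Fin 2) (Fin 2) ℝ) (x : Fin 2) (l : List τ) : ℝ :=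
  Real.exp (-d) * (((List.length l).factorial : ℝ)⁻¹ *
      (List.map (fun c => ∑ y, prior p y * (K x y * P y c)) l).prod)

/-- The normalised connectivity matrix as a function of `ε = 1 - b`. -/
noncomputable def sbmMat (p ε : ℝ) : Matrix (Fin 2) (Fin 2) ℝ :=
  !![1 + (1 - p) * ε / p, 1 - ε; 1 - ε, 1 + p * ε / (1 - p)]

/-- The log-likelihood ratio of a list of subtrees. -/
noncomputable def llrSum (ε : ℝ) (l : List τ) : ℝ :=
  (l.map fun c => childLLR p (ε * dev p P c)).sum

variable {p P}

lemma summable_mul_of_bdd {w f : τ → ℝ} {C : ℝ} (hw : ∀ t, 0 ≤ w t) (hs : Summable w)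
    (hf : ∀ t, |f t| ≤ C) : Summable fun t => w t * f t := by
  refine Summable.of_norm_bounded (hs.mul_right C) fun t => ?_
  rw [norm_mul, Real.norm_of_nonneg (hw t), Real.norm_eq_abs]
  exact mul_le_mul_of_nonneg_left (hf t) (hw t)

/-- A pair of conditional laws given the class, with a prior `p`. -/
structure IsPair (p : ℝ) (P : Fin 2 → τ → ℝ) : Prop where
  p_pos : 0 < p
  p_le : p ≤ 1 / 2
  nonneg : ∀ x t, 0 ≤ P x t
  hasSum : ∀ x, HasSum (P x) 1

namespace IsPair

variable (h : IsPair p P)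
include h

lemma one_sub_pos : 0 < 1 - p := by linarith [h.p_le]

lemma mix_nonneg (t : τ) : 0 ≤ mix p P t :=
  add_nonneg (mul_nonneg h.p_pos.le (h.nonneg 0 t)) (mul_nonneg h.one_sub_pos.le (h.nonneg 1 t))

lemma hasSum_mix : HasSum (mix p P) 1 := by
  have := ((h.hasSum 0).mul_left p).add ((h.hasSum 1).mul_left (1 - p))
  rw [mul_one, mul_one, add_sub_cancel] at this
  exact this

/-- Bayes' formula without a division. Where `mix` vanishes, so does `P 0`, and the default value of
`post` is harmless. -/
lemma mix_mul_post (t : τ) : mix p P t * post p P t = p * P 0 t := by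
  rcases eq_or_ne (mix p P t) 0 with h0 | h0
  · have h1 := mul_nonneg h.p_pos.le (h.nonneg 0 t)
    have h2 := mul_nonneg h.one_sub_pos.le (h.nonneg 1 t)
    rw [h0, zero_mul]
    unfold mix at h0
    linarith
  · rw [post]; field_simp

lemma post_nonneg (t : τ) : 0 ≤ post p P t :=
  div_nonneg (mul_nonneg h.p_pos.le (h.nonneg 0 t)) (h.mix_nonneg t)

lemma post_le_one (t : τ) : post p P t ≤ 1 := by
  refine div_le_one_of_le₀ ?_ (h.mix_nonneg t)
  have := mul_nonneg h.one_sub_pos.le (h.nonneg 1 t)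
  unfold mix
  linarith

lemma abs_dev_le (t : τ) : |dev p P t| ≤ 1 := by
  have h1 := h.post_nonneg t
  have h2 := h.post_le_one t
  have h3 := h.p_pos
  have h4 := h.p_le
  unfold dev
  rw [abs_le]
  constructor <;> linarith

/-- The posterior averages to the prior. This exact cancellation removes the first-order term, whose
coefficient `d * ε` need not stay bounded. -/
lemma hasSum_mix_mul_dev : HasSum (fun t => mix p P t * dev p P t) 0 := by
  have := ((h.hasSum 0).mul_left p).sub (h.hasSum_mix.mul_left p)
  simp only [mul_one, sub_self] at this
  refine this.congr_fun fun t => ?_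
  rw [dev, mul_sub, h.mix_mul_post]
  ring

/-- The second moment of the posterior under the mixture is `p` times its mean under class 1, since
`mix * post = p * P 0`. A variance thus becomes a class-1 expectation, computable from the limit law
of the log-likelihood ratio. -/
lemma tsum_mix_mul_dev_sq :
    HasSum (fun t => mix p P t * dev p P t ^ 2) (p * (∑' t, P 0 t * post p P t - p)) := by
  have hs : Summable fun t => P 0 t * post p P t :=
    summable_mul_of_bdd (C := 1) (h.nonneg 0) (h.hasSum 0).summable fun t => by
      rw [abs_of_nonneg (h.post_nonneg t)]; exact h.post_le_one t
  have h1 := (hs.hasSum.mul_left p).sub ((h.hasSum 0).mul_left (p * p))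
  have h2 := h1.sub (h.hasSum_mix_mul_dev.mul_left p)
  convert! h2 using 1
  · ext t
    have := h.mix_mul_post t
    simp only [dev]
    linear_combination (post p P t - p) * this
  · ring

/-- Relative to the intensity `d * mix`, which does not depend on the class of the parent, that
class appears only through the small factor `1 + ε * dev / p`, or `1 - ε * dev / (1 - p)` in
`child_one`. The identity behind it is `mix * dev = p (1 - p) (P 0 - P 1)`. -/
lemma child_zero (d ε : ℝ) (t : τ) :
    ∑ y, prior p y * ((d • sbmMat p ε) 0 y * P y t)
      = d * mix p P t * (1 + ε * dev p P t / p) := by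
  have h1 := h.mix_mul_post t
  have h2 := h.p_pos.ne'
  simp only [Fin.sum_univ_two, prior, sbmMat, Matrix.smul_apply, smul_eq_mul, Matrix.of_apply,
    Matrix.cons_val', Matrix.cons_val_zero, Matrix.cons_val_one, Matrix.cons_val_fin_one, dev]
  have h3 : d * mix p P t * (1 + ε * (post p P t - p) / p)
    = d * (mix p P t * (1 - ε) + ε * (mix p P t * post p P t) / p) := by field_simp; ring
  rw [h3, h1, mix]
  field_simp
  ring

lemma child_one (d ε : ℝ) (t : τ) :
    ∑ y, prior p y * ((d • sbmMat p ε) 1 y * P y t)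
      = d * mix p P t * (1 - ε * dev p P t / (1 - p)) := by
  have h1 := h.mix_mul_post t
  have h2 := h.one_sub_pos.ne'
  simp only [Fin.sum_univ_two, prior, sbmMat, Matrix.smul_apply, smul_eq_mul, Matrix.of_apply,
    Matrix.cons_val', Matrix.cons_val_zero, Matrix.cons_val_one, Matrix.cons_val_fin_one, dev]
  have h3 : d * mix p P t * (1 - ε * (post p P t - p) / (1 - p))
    = d * (mix p P t * (1 + ε * p / (1 - p)) - ε * (mix p P t * post p P t) / (1 - p)) := by
      field_simp; ring
  rw [h3, h1, mix]
  field_simp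
  ring

lemma one_add_pos {ε : ℝ} (hε : |ε| < p) (t : τ) : 0 < 1 + ε * dev p P t / p := by
  have h1 : |ε * dev p P t / p| < 1 := by
    rw [abs_div, abs_mul, abs_of_pos h.p_pos, div_lt_one h.p_pos]
    exact (mul_le_of_le_one_right (abs_nonneg _) (h.abs_dev_le t)).trans_lt hε
  linarith [(abs_lt.1 h1).1]

lemma one_sub_dev_pos {ε : ℝ} (hε : |ε| < p) (t : τ) : 0 < 1 - ε * dev p P t / (1 - p) := by
  have h1 : |ε * dev p P t / (1 - p)| < 1 := by
    rw [abs_div, abs_mul, abs_of_pos h.one_sub_pos, div_lt_one h.one_sub_pos]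
    refine (mul_le_of_le_one_right (abs_nonneg _) (h.abs_dev_le t)).trans_lt ?_
    linarith [h.p_le]
  linarith [(abs_lt.1 h1).2]

/-- Both laws are Poisson products over the same intensity, so their density is the product of the
ratios of child factors. The bound on `ε` keeps these factors positive; `p ≤ 1 / 2` covers the
second class. -/
lemma nextLaw_one {d ε : ℝ} (hε : |ε| < p) (l : List τ) :
    nextLaw p P d (d • sbmMat p ε) 1 l
      = nextLaw p P d (d • sbmMat p ε) 0 l * Real.exp (-llrSum p P ε l) := by
  simp only [nextLaw, h.child_zero, h.child_one, llrSum]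
  have key : (l.map fun c => d * mix p P c * (1 - ε * dev p P c / (1 - p))).prod =
      (l.map fun c => d * mix p P c * (1 + ε * dev p P c / p)).prod *
        Real.exp (-(l.map fun c => childLLR p (ε * dev p P c)).sum) := by
    induction l with
    | nil => simp
    | cons c l ih =>
      simp only [List.map_cons, List.prod_cons, List.sum_cons, ih, neg_add, Real.exp_add]
      have h1 := h.one_add_pos hε c
      have h2 := h.one_sub_dev_pos hε c
      have h3 : Real.exp (-childLLR p (ε * dev p P c))
          = (1 - ε * dev p P c / (1 - p)) / (1 + ε * dev p P c / p) := by
        rw [childLLR, neg_sub, Real.exp_sub, Real.exp_log h1, Real.exp_log h2]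
      rw [h3]
      generalize 1 - ε * dev p P c / (1 - p) = A at *
      generalize 1 + ε * dev p P c / p = B at *
      field_simp
  rw [key]
  ring

/-- The posterior of the parent is a logistic function of the log-likelihood ratio; this is the
origin of the integrand of `G`. Multiplying by the class-1 law avoids lists of zero mass. -/
lemma nextLaw_zero_mul_post {d ε : ℝ} (hε : |ε| < p) (l : List τ) :
    nextLaw p P d (d • sbmMat p ε) 0 l * post p (nextLaw p P d (d • sbmMat p ε)) l
      = nextLaw p P d (d • sbmMat p ε) 0 l * (p * logistic p (-llrSum p P ε l)) := by
  rw [post, mix, h.nextLaw_one hε]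
  have := logistic_denom_pos h.p_pos h.p_le (-llrSum p P ε l)
  unfold logistic
  rcases eq_or_ne (nextLaw p P d (d • sbmMat p ε) 0 l) 0 with h0 | h0
  · simp [h0]
  · generalize nextLaw p P d (d • sbmMat p ε) 0 l = A at *
    congr 1
    rw [show p * A + (1 - p) * (A * Real.exp (-llrSum p P ε l))
      = (p + (1 - p) * Real.exp (-llrSum p P ε l)) * A by ring]
    field_simp

lemma norm_tilt_le (s ε : ℝ) (t : τ) : ‖tilt p s (ε * dev p P t)‖ ≤ 1 + |ε| / p := by
  rw [tilt, norm_mul, ← Complex.ofReal_mul, Complex.norm_exp_ofReal_mul_I, mul_one,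
    Complex.norm_real, Real.norm_eq_abs]
  refine (abs_add_le _ _).trans ?_
  rw [abs_one, abs_div, abs_mul, abs_of_pos h.p_pos]
  gcongr
  · exact h.p_pos.le
  · exact mul_le_of_le_one_right (abs_nonneg _) (h.abs_dev_le t)

lemma summable_mix_mul {f : τ → ℂ} {C : ℝ} (d : ℝ) (hf : ∀ t, ‖f t‖ ≤ C) :
    Summable fun t => ‖((d * mix p P t : ℝ) : ℂ) * f t‖ := by
  refine Summable.of_nonneg_of_le (fun _ => norm_nonneg _) (fun t => ?_)
    ((h.hasSum_mix.summable.mul_left |d|).mul_right C)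
  rw [norm_mul, Complex.norm_real, Real.norm_eq_abs, abs_mul, abs_of_nonneg (h.mix_nonneg t)]
  exact mul_le_mul_of_nonneg_left (hf t) (mul_nonneg (abs_nonneg _) (h.mix_nonneg t))

/-- The characteristic function of the log-likelihood ratio under class 1. -/
lemma hasSum_charFun (d ε s : ℝ) :
    HasSum (fun l => nextLaw p P d (d • sbmMat p ε) 0 l •
        Complex.exp (s * llrSum p P ε l * Complex.I))
      (Complex.exp (∑' t, ((d * mix p P t : ℝ) : ℂ) * (tilt p s (ε * dev p P t) - 1))) := by
  have hn := h.summable_mix_mul d fun t => h.norm_tilt_le s ε t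
  have h1 := hasSum_list_exp hn.of_norm.hasSum hn
  rw [← Complex.exp_eq_exp_ℂ] at h1
  have h2 := h1.mul_left (Complex.exp (-d))
  rw [← Complex.exp_add] at h2
  convert! h2 using 1
  · ext l
    have key : ((l.map fun c => d * mix p P c * (1 + ε * dev p P c / p)).prod : ℂ) *
        Complex.exp (s * llrSum p P ε l * Complex.I) =
        (l.map fun c => ((d * mix p P c : ℝ) : ℂ) * tilt p s (ε * dev p P c)).prod := by
      induction l with
      | nil => simp [llrSum]
      | cons c l ih =>
        simp only [llrSum, List.map_cons, List.prod_cons, List.sum_cons] at ih ⊢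
        rw [← ih, tilt]
        push_cast
        rw [mul_add (s : ℂ), add_mul _ _ Complex.I, Complex.exp_add]
        ring
    rw [← key, nextLaw, Complex.real_smul]
    simp only [h.child_zero]
    push_cast
    ring
  · congr 1
    have hm : HasSum (fun t => ((d * mix p P t : ℝ) : ℂ)) (d : ℂ) := by
      have := (h.hasSum_mix.mul_left d)
      rw [mul_one] at this
      exact Complex.hasSum_ofReal.2 this
    rw [show (-(d : ℂ)) + ∑' t, ((d * mix p P t : ℝ) : ℂ) * tilt p s (ε * dev p P t)
      = ∑' t, ((d * mix p P t : ℝ) : ℂ) * tilt p s (ε * dev p P t) - d by ring]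
    rw [← hm.tsum_eq, ← hn.of_norm.tsum_sub hm.summable]
    exact tsum_congr fun t => by ring

/-- The total intensity is `d` for both classes because `dev` has mean 0 under `mix`, so the
recursion stays within pairs of probability laws. -/
lemma nextLaw_isPair {d ε : ℝ} (hd : 0 ≤ d) (hε : |ε| < p) :
    IsPair p (nextLaw p P d (d • sbmMat p ε)) := by
  have h0 : ∀ l, 0 ≤ nextLaw p P d (d • sbmMat p ε) 0 l := by
    intro l
    refine mul_nonneg (Real.exp_pos _).le (mul_nonneg (by positivity) (List.prod_nonneg ?_))
    intro a ha
    obtain ⟨c, -, rfl⟩ := List.mem_map.1 ha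
    rw [h.child_zero]
    exact mul_nonneg (mul_nonneg hd (h.mix_nonneg c)) (h.one_add_pos hε c).le
  have hs : ∀ (f : τ → ℝ), (∀ c, 0 ≤ f c) → HasSum f d → HasSum (fun l : List τ =>
      Real.exp (-d) * (((List.length l).factorial : ℝ)⁻¹ * (List.map f l).prod)) 1 := by
    intro f hf hfs
    have h2 := (hasSum_list_exp hfs (hfs.summable.congr fun c => by
      rw [Real.norm_of_nonneg (hf c)])).mul_left (Real.exp (-d))
    rwa [← Real.exp_eq_exp_ℝ, ← Real.exp_add, neg_add_cancel, Real.exp_zero] at h2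
  refine ⟨h.p_pos, h.p_le, fun x l => ?_, fun x => ?_⟩
  · fin_cases x
    · exact h0 l
    · change 0 ≤ nextLaw p P d (d • sbmMat p ε) 1 l
      rw [h.nextLaw_one hε]
      exact mul_nonneg (h0 l) (Real.exp_pos _).le
  · fin_cases x
    · refine hs _ (fun c => ?_) ?_
      · change 0 ≤ ∑ y, prior p y * ((d • sbmMat p ε) 0 y * P y c)
        rw [h.child_zero]
        exact mul_nonneg (mul_nonneg hd (h.mix_nonneg c)) (h.one_add_pos hε c).le
      · change HasSum (fun c => ∑ y, prior p y * ((d • sbmMat p ε) 0 y * P y c)) d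
        have := (h.hasSum_mix.mul_left d).add (h.hasSum_mix_mul_dev.mul_left (d * ε / p))
        simp only [mul_one, mul_zero, add_zero] at this
        refine this.congr_fun fun c => ?_
        rw [h.child_zero]; ring
    · refine hs _ (fun c => ?_) ?_
      · change 0 ≤ ∑ y, prior p y * ((d • sbmMat p ε) 1 y * P y c)
        rw [h.child_one]
        exact mul_nonneg (mul_nonneg hd (h.mix_nonneg c)) (h.one_sub_dev_pos hε c).le
      · change HasSum (fun c => ∑ y, prior p y * ((d • sbmMat p ε) 1 y * P y c)) d
        have := (h.hasSum_mix.mul_left d).sub (h.hasSum_mix_mul_dev.mul_left (d * ε / (1 - p)))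
        simp only [mul_one, mul_zero, sub_zero] at this
        refine this.congr_fun fun c => ?_
        rw [h.child_one]; ring

end IsPair

end NextLaw

/-! ### The large-degree limit of the tree laws. -/

section Limit

variable {τ : Type*} {p : ℝ} {P : ℕ → Fin 2 → τ → ℝ} {d ε : ℕ → ℝ} {lam v : ℝ}

/-- The expansion of `tilt` is summed against `d * mix`. The linear part cancels, the quadratic part
carries `d * ε ^ 2 = lam`, and the remainder is uniformly small because `|dev| ≤ 1` and `ε → 0`. -/
lemma tendsto_charExponent (h : ∀ n, IsPair p (P n)) (hd : ∀ n, 0 ≤ d n)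
    (hε : Tendsto ε atTop (𝓝 0)) (hlam : ∀ n, d n * ε n ^ 2 = lam)
    (hv : Tendsto (fun n => ∑' t, mix p (P n) t * dev p (P n) t ^ 2) atTop (𝓝 v)) (s : ℝ) :
    Tendsto (fun n => ∑' t, ((d n * mix p (P n) t : ℝ) : ℂ) * (tilt p s (ε n * dev p (P n) t) - 1))
      atTop (𝓝 (tiltB p s * lam * v)) := by
  have hlam0 : 0 ≤ lam := hlam 0 ▸ mul_nonneg (hd 0) (sq_nonneg _)
  set R : ℝ → ℂ := fun η => tilt p s η - 1 - tiltA p s * η - tiltB p s * η ^ 2 with hR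
  have hRo := isLittleO_tilt p s
  have hsum : ∀ n, Summable fun t => ((d n * mix p (P n) t : ℝ) : ℂ) *
      (tilt p s (ε n * dev p (P n) t) - 1) := fun n =>
    ((h n).summable_mix_mul (C := (1 + |ε n| / p) + 1) (d n) fun t =>
      (norm_sub_le _ _).trans (by
        rw [norm_one]; exact add_le_add_left ((h n).norm_tilt_le s (ε n) t) 1)).of_norm
  have hA : ∀ n, HasSum (fun t => tiltA p s * (d n * ε n) *
      ((mix p (P n) t * dev p (P n) t : ℝ) : ℂ)) 0 := fun n => by
    have := (Complex.hasSum_ofReal.2 (h n).hasSum_mix_mul_dev).mul_left (tiltA p s * (d n * ε n))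
    simpa using this
  have hB : ∀ n, HasSum (fun t => tiltB p s * (d n * ε n ^ 2 : ℝ) *
      ((mix p (P n) t * dev p (P n) t ^ 2 : ℝ) : ℂ))
      (tiltB p s * lam * (∑' t, mix p (P n) t * dev p (P n) t ^ 2 : ℝ)) := fun n => by
    have := (Complex.hasSum_ofReal.2 (h n).tsum_mix_mul_dev_sq.summable.hasSum).mul_left
      (tiltB p s * (d n * ε n ^ 2 : ℝ))
    rwa [hlam n] at this ⊢
  have hdec : ∀ n, ∑' t, ((d n * mix p (P n) t : ℝ) : ℂ) * R (ε n * dev p (P n) t) =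
      ∑' t, ((d n * mix p (P n) t : ℝ) : ℂ) * (tilt p s (ε n * dev p (P n) t) - 1)
      - tiltB p s * lam * (∑' t, mix p (P n) t * dev p (P n) t ^ 2 : ℝ) := by
    intro n
    have := ((hsum n).hasSum.sub (hA n)).sub (hB n)
    rw [sub_zero] at this
    rw [← this.tsum_eq]
    refine tsum_congr fun t => ?_
    simp only [hR]
    push_cast
    ring
  have hrem : Tendsto (fun n => ∑' t, ((d n * mix p (P n) t : ℝ) : ℂ) * R (ε n * dev p (P n) t))
      atTop (𝓝 0) := by
    rw [Metric.tendsto_nhds]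
    intro κ hκ
    -- The remainder is at most `lam` times the tolerance, and `lam * (κ / (lam + 1)) < κ` also when
    -- `lam = 0`.
    have hκ' : 0 < κ / (lam + 1) := by positivity
    obtain ⟨δ, hδ, hδR⟩ := Metric.eventually_nhds_iff.1 (hRo.def hκ')
    have h1 : ∀ᶠ n in atTop, |ε n| < δ := by
      exact hε.abs.eventually_lt_const (by simpa using hδ)
    filter_upwards [h1] with n hn
    rw [dist_zero_right]
    have hb : ∀ t, ‖((d n * mix p (P n) t : ℝ) : ℂ) * R (ε n * dev p (P n) t)‖
        ≤ (lam * (κ / (lam + 1))) * mix p (P n) t := by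
      intro t
      have hdev := (h n).abs_dev_le t
      have hle : |ε n * dev p (P n) t| ≤ |ε n| := by
        rw [abs_mul]; exact mul_le_of_le_one_right (abs_nonneg _) hdev
      have h2 := hδR (y := ε n * dev p (P n) t)
        (by rw [Real.dist_eq, sub_zero]; exact hle.trans_lt hn)
      rw [norm_mul, Complex.norm_real, Real.norm_of_nonneg
        (mul_nonneg (hd n) ((h n).mix_nonneg t))]
      have h3 : ‖R (ε n * dev p (P n) t)‖ ≤ κ / (lam + 1) * ε n ^ 2 := by
        refine h2.trans ?_
        rw [norm_pow, Real.norm_eq_abs, ← sq_abs (ε n)]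
        gcongr
      calc _ ≤ d n * mix p (P n) t * (κ / (lam + 1) * ε n ^ 2) :=
            mul_le_mul_of_nonneg_left h3 (mul_nonneg (hd n) ((h n).mix_nonneg t))
        _ = (d n * ε n ^ 2) * (κ / (lam + 1)) * mix p (P n) t := by ring
        _ = _ := by rw [hlam n]
    have h4 := (h n).hasSum_mix.mul_left (lam * (κ / (lam + 1)))
    refine (tsum_of_norm_bounded h4 hb).trans_lt ?_
    rw [mul_one, mul_div_assoc', div_lt_iff₀ (by positivity)]
    nlinarith
  have hv' : Tendsto (fun n => tiltB p s * lam *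
      ((∑' t, mix p (P n) t * dev p (P n) t ^ 2 : ℝ) : ℂ)) atTop (𝓝 (tiltB p s * lam * v)) :=
    ((Complex.continuous_ofReal.tendsto v).comp hv).const_mul _
  have := hrem.add hv'
  rw [zero_add] at this
  refine this.congr fun n => ?_
  rw [hdec n]
  ring

/-- Under class 1 the log-likelihood ratio is asymptotically `N(μ/2, μ)`. -/
lemma tendsto_tsum_nextLaw (h : ∀ n, IsPair p (P n)) (hd : ∀ n, 0 ≤ d n)
    (hε : Tendsto ε atTop (𝓝 0)) (hεp : ∀ n, |ε n| < p) (hlam : ∀ n, d n * ε n ^ 2 = lam)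
    (hv : Tendsto (fun n => ∑' t, mix p (P n) t * dev p (P n) t ^ 2) atTop (𝓝 v))
    {μ : ℝ} (hμ : μ = lam * v / (p * (1 - p)) ^ 2) (hμ0 : 0 ≤ μ)
    (f : ℝ → ℝ) (hf : Continuous f) (C : ℝ) (hC : ∀ x, ‖f x‖ ≤ C) :
    Tendsto (fun n => ∑' l, nextLaw p (P n) (d n) (d n • sbmMat p (ε n)) 0 l *
      f (llrSum p (P n) (ε n) l)) atTop (𝓝 (∫ w, f w ∂(gaussianReal (μ / 2) μ.toNNReal))) := by
  have hn := fun n => (h n).nextLaw_isPair (hd n) (hεp n)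
  set ν : ℕ → ProbabilityMeasure ℝ := fun n => discreteLaw
    (nextLaw p (P n) (d n) (d n • sbmMat p (ε n)) 0) (llrSum p (P n) (ε n))
    ((hn n).nonneg 0) ((hn n).hasSum 0) with hν
  have hlim : Tendsto ν atTop (𝓝 ⟨gaussianReal (μ / 2) μ.toNNReal, inferInstance⟩) := by
    -- Lévy's continuity theorem.
    refine ProbabilityMeasure.tendsto_of_tendsto_charFun fun s => ?_
    have hchar : ∀ n, charFun (ν n : Measure ℝ) s = Complex.exp
        (∑' t, ((d n * mix p (P n) t : ℝ) : ℂ) * (tilt p s (ε n * dev p (P n) t) - 1)) := by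
      intro n
      rw [charFun_apply_real, hν, integral_discreteLaw _ _ _ _ _ (Continuous.stronglyMeasurable
        (by fun_prop)) 1 fun x => ?_]
      · exact ((h n).hasSum_charFun (d n) (ε n) s).tsum_eq
      · rw [← Complex.ofReal_mul, Complex.norm_exp_ofReal_mul_I]
    simp_rw [hchar]
    change Tendsto _ _ (𝓝 (charFun (gaussianReal (μ / 2) μ.toNNReal) s))
    rw [charFun_gaussianReal, Real.coe_toNNReal _ hμ0]
    refine (Complex.continuous_exp.tendsto _).comp ?_
    convert! tendsto_charExponent h hd hε hlam hv s using 2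
    rw [tiltB_eq (h 0).p_pos (h 0).p_le, hμ]
    push_cast
    generalize ((p : ℂ) * (1 - p)) ^ 2 = Y
    ring
  have h2 := (ProbabilityMeasure.tendsto_iff_forall_integral_tendsto.1 hlim)
    (BoundedContinuousFunction.ofNormedAddCommGroup f hf C hC)
  refine h2.congr fun n => ?_
  simp only [BoundedContinuousFunction.coe_ofNormedAddCommGroup, hν]
  rw [integral_discreteLaw _ _ _ _ _ hf.stronglyMeasurable C hC]
  rfl

/-- The limits of the second moment of the posterior deviation. -/
noncomputable def devLim (p lam q : ℝ) : ℕ → ℝ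
  | 0 => q * (p * (1 - p))
  | r + 1 => p * (p * ∫ x, logistic p x
      ∂(gaussianReal (-muSeq p lam q r / 2) (muSeq p lam q r).toNNReal) - p)

lemma muSeq_eq_devLim (hp0 : 0 < p) (hp : p ≤ 1 / 2) (hlam : 0 ≤ lam) {q : ℝ} (hq0 : 0 ≤ q)
    (r : ℕ) : muSeq p lam q r = lam * devLim p lam q r / (p * (1 - p)) ^ 2 := by
  have h1 : 1 - p ≠ 0 := by linarith
  cases r with
  | zero => simp only [muSeq, devLim]; field_simp
  | succ r =>
    rw [muSeq, G_eq hp0 hp _ (muSeq_nonneg hp0 hp hlam hq0 r), devLim]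
    field_simp

/-- The total variation distance between the two conditional laws of a pair. -/
noncomputable def gap {τ : Type*} (P : Fin 2 → τ → ℝ) : ℝ := ∑' t, max (P 0 t - P 1 t) 0

/-- The limits of the total variation distance. -/
noncomputable def gapLim (p lam q : ℝ) : ℕ → ℝ
  | 0 => q
  | r + 1 => gaussGap (muSeq p lam q r)

/-- By definition, `treeLaw` at height `r + 1` is `nextLaw` applied to `treeLaw` at height `r`. -/
lemma isPair_treeLaw (hp0 : 0 < p) (hp : p ≤ 1 / 2) {q d ε : ℝ} (hq0 : 0 ≤ q) (hq1 : q ≤ 1)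
    (hd : 0 ≤ d) (hε : |ε| < p) (r : ℕ) : IsPair p (treeLaw p q d (d • sbmMat p ε) r) := by
  induction r with
  | zero => exact ⟨hp0, hp, fun x o => obs_nonneg hq0 hq1 x o, fun x => hasSum_obs q x⟩
  | succ r ih => exact ih.nextLaw_isPair hd hε

/-- The induction runs on the second moment alone: it determines the Gaussian limit of the
log-likelihood ratio one level up, and two bounded continuous test functions of that ratio yield the
next second moment and the total variation distance. -/
lemma tendsto_treeLaw (hp0 : 0 < p) (hp : p ≤ 1 / 2) (hlam0 : 0 ≤ lam) {q : ℝ} (hq0 : 0 ≤ q)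
    (hq1 : q ≤ 1) (hd : ∀ n, 0 ≤ d n)
    (hε : Tendsto ε atTop (𝓝 0)) (hεp : ∀ n, |ε n| < p) (hlam : ∀ n, d n * ε n ^ 2 = lam) (r : ℕ) :
    Tendsto (fun n => ∑' t, mix p (treeLaw p q (d n) (d n • sbmMat p (ε n)) r) t *
      dev p (treeLaw p q (d n) (d n • sbmMat p (ε n)) r) t ^ 2) atTop (𝓝 (devLim p lam q r)) ∧
    Tendsto (fun n => gap (treeLaw p q (d n) (d n • sbmMat p (ε n)) r)) atTop
      (𝓝 (gapLim p lam q r)) := by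
  have hpair := fun n r => isPair_treeLaw hp0 hp hq0 hq1 (hd n) (hεp n) r
  induction r with
  | zero =>
    have hp1 : (1 - p) ≠ 0 := by linarith
    constructor
    · simp_rw [fun n => (hpair n 0).tsum_mix_mul_dev_sq.tsum_eq]
      refine tendsto_const_nhds.congr fun n => ?_
      -- At a leaf the posterior is `p` with probability `1 - q` and 1 with probability `q`, under
      -- class 1.
      have : ∑' t, treeLaw p q (d n) (d n • sbmMat p (ε n)) 0 0 t *
          post p (treeLaw p q (d n) (d n • sbmMat p (ε n)) 0) t = (1 - q) * p + q := by
        have e : (fun t => treeLaw p q (d n) (d n • sbmMat p (ε n)) 0 0 t *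
          post p (treeLaw p q (d n) (d n • sbmMat p (ε n)) 0) t) =
          fun o : Option (Fin 2) => obs q 0 o * (p * obs q 0 o / (p * obs q 0 o +
            (1 - p) * obs q 1 o)) := rfl
        rw [e]
        change ∑' o : Option (Fin 2), _ = _
        rw [tsum_fintype, Fintype.sum_option, Fin.sum_univ_two]
        simp only [obs, ↓reduceIte, one_ne_zero, zero_mul, add_zero, mul_zero, zero_ne_one]
        rw [← add_mul, add_sub_cancel, one_mul]
        congr 1
        · rcases eq_or_ne (1 - q) 0 with h | h
          · simp [h]
          · field_simp
        · rcases eq_or_ne q 0 with h | h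
          · simp [h]
          · field_simp
      rw [this, devLim]
      ring
    · refine tendsto_const_nhds.congr fun n => ?_
      have e : gap (treeLaw p q (d n) (d n • sbmMat p (ε n)) 0) =
        ∑' o : Option (Fin 2), max (obs q 0 o - obs q 1 o) 0 := rfl
      rw [e, tsum_fintype, Fintype.sum_option, Fin.sum_univ_two]
      simp [obs, gapLim, hq0]
  | succ r ih =>
    have hμ0 := muSeq_nonneg hp0 hp (q := q) hlam0 hq0 r
    have hlim := tendsto_tsum_nextLaw (fun n => hpair n r) hd hε hεp hlam ih.1
      (muSeq_eq_devLim hp0 hp hlam0 hq0 r) hμ0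
    constructor
    · simp_rw [fun n => (hpair n (r + 1)).tsum_mix_mul_dev_sq.tsum_eq]
      rw [devLim]
      refine Tendsto.const_mul p (Tendsto.sub_const ?_ p)
      have h1 := hlim (fun x => p * logistic p (-x))
        (((continuous_logistic hp0 hp).comp continuous_neg).const_mul p) 1 (fun x => by
          rw [Real.norm_of_nonneg (mul_nonneg hp0.le (logistic_nonneg hp0 hp _))]
          calc p * logistic p (-x) ≤ p * (1 / p) :=
                mul_le_mul_of_nonneg_left (logistic_le hp0 hp _) hp0.le
            _ = 1 := by field_simp)
      -- Reflection carries `N(μ/2, μ)` to `N(-μ/2, μ)`, the law appearing in `G_eq`.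
      have h2 : ∫ w, p * logistic p (-w) ∂gaussianReal (muSeq p lam q r / 2)
          (muSeq p lam q r).toNNReal = p * ∫ x, logistic p x
          ∂(gaussianReal (-muSeq p lam q r / 2) (muSeq p lam q r).toNNReal) := by
        rw [integral_const_mul, neg_div, ← gaussianReal_map_neg, integral_map (by fun_prop)
          (continuous_logistic hp0 hp).aestronglyMeasurable]
      rw [h2] at h1
      refine h1.congr fun n => ?_
      exact tsum_congr fun l => ((hpair n r).nextLaw_zero_mul_post (hεp n) l).symm
    · rw [gapLim]
      have h1 := hlim (fun w => max (1 - Real.exp (-w)) 0) (by fun_prop) 1 abs_max_one_sub_exp_le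
      refine h1.congr fun n => ?_
      refine tsum_congr fun l => ?_
      change _ = max (nextLaw p _ (d n) (d n • sbmMat p (ε n)) 0 l -
        nextLaw p _ (d n) (d n • sbmMat p (ε n)) 1 l) 0
      rw [(hpair n r).nextLaw_one (hεp n), mul_max_of_nonneg _ _
        (((hpair n r).nextLaw_isPair (hd n) (hεp n)).nonneg 0 l), mul_zero, mul_sub, mul_one]

end Limit

/-- The limit in the degree of the total variation distance between the two tree laws. -/
lemma tendsto_gap_treeLaw {p lam q : ℝ} (hp0 : 0 < p) (hp : p ≤ 1 / 2) (hlam0 : 0 ≤ lam)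
    (hq0 : 0 ≤ q) (hq1 : q ≤ 1) (a b c : ℝ → ℝ)
    (hdeg1 : ∀ d : ℝ, 0 < d → p * a d + (1 - p) * b d = 1)
    (hdeg2 : ∀ d : ℝ, 0 < d → p * b d + (1 - p) * c d = 1)
    (hsnr : ∀ d : ℝ, 0 < d → d * (1 - b d) ^ 2 = lam) (r : ℕ) :
    Tendsto (fun d => gap (treeLaw p q d (d • !![a d, b d; b d, c d]) r)) atTop
      (𝓝 (gapLim p lam q r)) := by
  have hp1 : (1 - p) ≠ 0 := by linarith
  have hmat : ∀ d, 0 < d → !![a d, b d; b d, c d] = sbmMat p (1 - b d) := by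
    intro d hd
    have h1 : a d = 1 + (1 - p) * (1 - b d) / p := by
      have := hdeg1 d hd
      field_simp
      linarith
    have h2 : c d = 1 + p * (1 - b d) / (1 - p) := by
      have := hdeg2 d hd
      field_simp
      linarith
    rw [sbmMat, ← h1, ← h2, sub_sub_cancel]
  have hε0 : Tendsto (fun d => 1 - b d) atTop (𝓝 0) := by
    rw [tendsto_zero_iff_abs_tendsto_zero]
    have h1 : Tendsto (fun d : ℝ => Real.sqrt (lam / d)) atTop (𝓝 0) := by
      have h2 : Tendsto (fun d : ℝ => lam / d) atTop (𝓝 0) := tendsto_const_nhds.div_atTop tendsto_id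
      have h3 := (Real.continuous_sqrt.tendsto 0).comp h2
      rwa [Real.sqrt_zero] at h3
    refine h1.congr' ?_
    filter_upwards [eventually_gt_atTop 0] with d hd
    rw [← hsnr d hd, mul_div_cancel_left₀ _ hd.ne', Real.sqrt_sq_eq_abs]
    rfl
  -- Along a sequence of degrees, positivity of `d` and `|ε| < p` hold only eventually, so an
  -- initial segment is dropped.
  refine tendsto_of_seq_tendsto fun x hx => ?_
  have hev : ∀ᶠ n in atTop, 0 < x n ∧ |1 - b (x n)| < p := by
    have h1 := hx.eventually (eventually_gt_atTop 0)
    have h2 := (hε0.comp hx).abs.eventually_lt_const (u := p) (by simpa using hp0)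
    exact h1.and h2
  obtain ⟨N, hN⟩ := eventually_atTop.1 hev
  rw [← tendsto_add_atTop_iff_nat N]
  have hN' := fun n => hN (n + N) (Nat.le_add_left _ _)
  have := (tendsto_treeLaw (d := fun n => x (n + N)) (ε := fun n => 1 - b (x (n + N))) hp0 hp hlam0
    hq0 hq1 (fun n => (hN' n).1.le) ((hε0.comp hx).comp (tendsto_add_atTop_nat N))
    (fun n => (hN' n).2) (fun n => hsnr _ (hN' n).1) r).2
  refine this.congr fun n => ?_
  simp only [Function.comp]
  rw [hmat _ (hN' n).1]

/-! ### Combinatorics of plane trees and of their labellings. -/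

namespace Shape

/-- The number of plane orderings of a shape. -/
def fact : ∀ r, Shape r → ℕ
  | 0, _ => 1
  | r + 1, l => (List.length l).factorial * (List.map (fact r) l).prod

/-- The number of edges of a shape. -/
def ec : ∀ r, Shape r → ℕ
  | 0, _ => 0
  | r + 1, l => (List.map (fun c => 1 + ec r c) l).sum

/-- The number of vertices of depth less than `r`. -/
def ic : ∀ r, Shape r → ℕ
  | 0, _ => 0
  | r + 1, l => 1 + (List.map (ic r) l).sum

end Shape

/-- Plane trees of height at most `r` with vertices labelled by `V`, and a possibly revealed class
on each vertex at depth `r`. -/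
def LTree (V : Type) : ℕ → Type
  | 0 => V × Option (Fin 2)
  | r + 1 => V × List (LTree V r)

namespace LTree

variable {V : Type}

def root : ∀ r, LTree V r → V
  | 0, t => t.1
  | _ + 1, t => t.1

/-- The pairs `(parent, child)`. -/
def edges : ∀ r, LTree V r → List (V × V)
  | 0, _ => []
  | r + 1, t => t.2.flatMap fun c => (t.1, root r c) :: edges r c

def verts (r : ℕ) (t : LTree V r) : List V := root r t :: (edges r t).map Prod.snd

/-- The vertices of depth less than `r`. -/
def inner : ∀ r, LTree V r → List V
  | 0, _ => []
  | r + 1, t => t.1 :: t.2.flatMap (inner r)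

/-- The vertices of depth `r`, with their observations. -/
def leaves : ∀ r, LTree V r → List (V × Option (Fin 2))
  | 0, t => [(t.1, t.2)]
  | r + 1, t => t.2.flatMap (leaves r)

/-- The vertices of depth `k`. -/
def lev : ∀ r, ℕ → LTree V r → List V
  | 0, 0, t => [t.1]
  | 0, _ + 1, _ => []
  | _ + 1, 0, t => [t.1]
  | r + 1, k + 1, t => t.2.flatMap (lev r k)

def shape : ∀ r, LTree V r → Shape r
  | 0, t => t.2
  | r + 1, t => t.2.map (shape r)

lemma verts_succ (r : ℕ) (v : V) (l : List (LTree V r)) :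
    verts (r + 1) ((v, l) : LTree V (r + 1)) = v :: l.flatMap (verts r) := by
  simp only [verts, root, edges, List.map_flatMap, List.map_cons]
  rfl

lemma mem_edges_succ {r : ℕ} {v : V} {l : List (LTree V r)} {x y : V} :
    (x, y) ∈ edges (r + 1) ((v, l) : LTree V (r + 1)) ↔
      ∃ c ∈ l, (x = v ∧ y = root r c) ∨ (x, y) ∈ edges r c := by
  simp only [edges, List.mem_flatMap, List.mem_cons, Prod.mk.injEq]

lemma root_mem_verts (r : ℕ) (t : LTree V r) : root r t ∈ verts r t := by simp [verts]

lemma snd_mem_verts {r : ℕ} {t : LTree V r} {x y : V} (h : (x, y) ∈ edges r t) : y ∈ verts r t :=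
  List.mem_cons_of_mem _ (List.mem_map.2 ⟨_, h, rfl⟩)

lemma fst_mem_verts {r : ℕ} {t : LTree V r} {x y : V} (h : (x, y) ∈ edges r t) : x ∈ verts r t := by
  induction r generalizing x y with
  | zero => simp [edges] at h
  | succ r ih =>
    obtain ⟨v, l⟩ := t
    rw [verts_succ]
    obtain ⟨c, hc, ⟨rfl, rfl⟩ | h⟩ := mem_edges_succ.1 h
    · simp
    · exact List.mem_cons_of_mem _ (List.mem_flatMap.2 ⟨c, hc, ih h⟩)

lemma nodup_succ {r : ℕ} {v : V} {l : List (LTree V r)}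
    (h : (verts (r + 1) ((v, l) : LTree V (r + 1))).Nodup) :
    (∀ c ∈ l, v ∉ verts r c) ∧ (∀ c ∈ l, (verts r c).Nodup) ∧
      l.Pairwise fun c c' => List.Disjoint (verts r c) (verts r c') := by
  rw [verts_succ, List.nodup_cons, List.nodup_flatMap] at h
  refine ⟨fun c hc hv => h.1 (List.mem_flatMap.2 ⟨c, hc, hv⟩), h.2.1, h.2.2⟩

lemma eq_of_mem_verts {r : ℕ} {l : List (LTree V r)}
    (h : l.Pairwise fun c c' => List.Disjoint (verts r c) (verts r c')) {c c' : LTree V r}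
    (hc : c ∈ l) (hc' : c' ∈ l) {x : V} (hx : x ∈ verts r c) (hx' : x ∈ verts r c') : c = c' := by
  by_contra hne
  have : Std.Symm fun c c' : LTree V r => List.Disjoint (verts r c) (verts r c') :=
    ⟨fun _ _ hd => List.Disjoint.symm hd⟩
  exact (h.forall hc hc' hne) hx hx'

section Recovery

variable (H : SimpleGraph V) (lab : V → Option (Fin 2))

/-- `t` is the exploration tree of the graph `H` with observations `lab`, started at the root of `t`
and not returning to `par`. -/
def Expl : ∀ r, Option V → LTree V r → Prop
  | 0, _, t => lab t.1 = t.2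
  | r + 1, par, t => (t.2.map (root r)).Nodup ∧
      (∀ w, w ∈ t.2.map (root r) ↔ H.Adj t.1 w ∧ par ≠ some w) ∧
      ∀ c ∈ t.2, Expl r (some t.1) c

variable {H lab}

/-- Exploring the graph of a tree with distinct labels returns the tree. The last alternative in the
adjacency hypothesis is the link from the root back to its parent, which is what a subtree sees of
the rest of the graph. -/
lemma expl_of_nodup {r : ℕ} {par : Option V} {t : LTree V r} (hn : (verts r t).Nodup)
    (hH : ∀ u ∈ verts r t, ∀ w, H.Adj u w ↔
      (u, w) ∈ edges r t ∨ (w, u) ∈ edges r t ∨ (u = root r t ∧ par = some w))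
    (hpar : ∀ w ∈ verts r t, par ≠ some w)
    (hlab : ∀ v o, (v, o) ∈ leaves r t → lab v = o) : Expl H lab r par t := by
  induction r generalizing par with
  | zero => exact hlab _ _ (by simp [leaves])
  | succ r ih =>
    obtain ⟨v, l⟩ := t
    obtain ⟨h1, h2, h3⟩ := nodup_succ hn
    have hsub : ∀ c ∈ l, ∀ w ∈ verts r c, w ∈ verts (r + 1) ((v, l) : LTree V (r + 1)) := by
      intro c hc w hw
      rw [verts_succ]
      exact List.mem_cons_of_mem _ (List.mem_flatMap.2 ⟨c, hc, hw⟩)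
    refine ⟨?_, fun w => ⟨?_, ?_⟩, ?_⟩
    · refine List.pairwise_map.2 (h3.imp fun hd he => ?_)
      exact hd (root_mem_verts r _) (he ▸ root_mem_verts r _)
    · intro hw
      obtain ⟨c, hc, rfl⟩ := List.mem_map.1 hw
      refine ⟨(hH v (by simp [verts_succ]) _).2 (Or.inl (mem_edges_succ.2 ⟨c, hc, Or.inl ⟨rfl, rfl⟩⟩)),
        hpar _ (hsub c hc _ (root_mem_verts r c))⟩
    · rintro ⟨hadj, hp⟩
      rcases (hH v (by simp [verts_succ]) w).1 hadj with h | h | h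
      · obtain ⟨c, hc, h | h⟩ := mem_edges_succ.1 h
        · exact List.mem_map.2 ⟨c, hc, h.2.symm⟩
        · exact absurd (fst_mem_verts h) (h1 c hc)
      · obtain ⟨c, hc, h | h⟩ := mem_edges_succ.1 h
        · exact absurd (h.2 ▸ root_mem_verts r c) (h1 c hc)
        · exact absurd (snd_mem_verts h) (h1 c hc)
      · exact absurd h.2 hp
    · intro c hc
      refine ih (h2 c hc) (fun u hu w => ?_) (fun w hw he => ?_) fun x o hx => ?_
      · rw [hH u (hsub c hc u hu)]
        have huv : u ≠ v := fun he => h1 c hc (he ▸ hu)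
        constructor
        · rintro (h | h | h)
          · obtain ⟨c', hc', h | h⟩ := mem_edges_succ.1 h
            · exact absurd h.1 huv
            · rw [eq_of_mem_verts h3 hc hc' hu (fst_mem_verts h)]
              exact Or.inl h
          · obtain ⟨c', hc', h | h⟩ := mem_edges_succ.1 h
            · have := eq_of_mem_verts h3 hc hc' hu (h.2 ▸ root_mem_verts r c')
              subst this
              exact Or.inr (Or.inr ⟨h.2, by rw [h.1]⟩)
            · rw [eq_of_mem_verts h3 hc hc' hu (snd_mem_verts h)]
              exact Or.inr (Or.inl h)
          · exact absurd h.1 huv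
        · rintro (h | h | h)
          · exact Or.inl (mem_edges_succ.2 ⟨c, hc, Or.inr h⟩)
          · exact Or.inr (Or.inl (mem_edges_succ.2 ⟨c, hc, Or.inr h⟩))
          · refine Or.inr (Or.inl (mem_edges_succ.2 ⟨c, hc, Or.inl ⟨?_, h.1⟩⟩))
            exact (Option.some_injective _ h.2).symm
      · obtain rfl : v = w := Option.some_injective _ he
        exact h1 c hc hw
      · exact hlab x o (List.mem_flatMap.2 ⟨c, hc, hx⟩)

end Recovery

-- A list mapped onto `L` is a choice of one preimage for each entry, so the sum factorises into
-- sums over fibres.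
open Classical in
lemma tsum_list_le_one {α β : Type*} (f : α → β) (e : α → ENNReal)
    (h : ∀ w, ∑' c, (if f c = w then e c else 0) ≤ 1) (L : List β) :
    ∑' l : List α, (if l.map f = L then (l.map e).prod else 0) ≤ 1 := by
  induction L with
  | nil =>
    rw [tsum_eq_single []]
    · simp
    · intro l hl
      simp [hl]
  | cons w L ih =>
    have hinj : Function.Injective fun x : α × List α => x.1 :: x.2 := by
      rintro ⟨a, l⟩ ⟨b, m⟩ h
      simpa using h
    rw [← hinj.tsum_eq]
    · have : ∀ x : α × List α, (if (x.1 :: x.2).map f = w :: L then ((x.1 :: x.2).map e).prod else 0)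
          = (if f x.1 = w then e x.1 else 0) * (if x.2.map f = L then (x.2.map e).prod else 0) := by
        rintro ⟨a, l⟩
        by_cases h1 : f a = w <;> by_cases h2 : l.map f = L <;> simp [h1, h2]
      simp_rw [this]
      rw [ENNReal.tsum_prod (f := fun a l => (if f a = w then e a else 0) *
        (if List.map f l = L then (List.map e l).prod else 0))]
      simp_rw [ENNReal.tsum_mul_left]
      rw [ENNReal.tsum_mul_right]
      exact mul_le_one' (h w) ih
    · intro l hl
      cases l with
      | nil => simp at hl
      | cons a l => exact ⟨(a, l), rfl⟩

open Classical in
/-- Each rooted graph is explored by at most `fact` plane trees of each shape. -/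
lemma tsum_inv_fact_le_one [Fintype V] (H : SimpleGraph V) (lab : V → Option (Fin 2)) (r : ℕ)
    (par : Option V) (v : V) :
    ∑' t : LTree V r, (if root r t = v then
      (if Expl H lab r par t then (((shape r t).fact r : ℕ) : ENNReal)⁻¹ else 0) else 0) ≤ 1 := by
  induction r generalizing par v with
  | zero =>
    change ∑' t : V × Option (Fin 2), _ ≤ _
    rw [tsum_eq_single ((v, lab v) : V × Option (Fin 2))]
    · refine (ite_le_one ?_ zero_le_one)
      refine (ite_le_one ?_ zero_le_one)
      simp [Shape.fact]
    · rintro ⟨w, o⟩ hne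
      by_cases h1 : w = v
      · exact (if_pos h1).trans (if_neg fun h2 : lab w = o => hne (by rw [← h2, h1]))
      · exact if_neg h1
  | succ r ih =>
    have hinj : Function.Injective fun l : List (LTree V r) => ((v, l) : V × List (LTree V r)) :=
      fun a b h => (Prod.mk.inj h).2
    change ∑' t : V × List (LTree V r), _ ≤ _
    rw [← hinj.tsum_eq]
    swap
    · rintro ⟨w, l⟩ hwl
      rw [Function.mem_support] at hwl
      have : w = v := by
        by_contra hne
        exact hwl (if_neg hne)
      exact ⟨l, by rw [this]⟩
    -- The roots of the child subtrees must enumerate `C` without repetition: at most `C.card !`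
    -- orderings, each with weight `1 / C.card !`, while the subtrees above a fixed ordering
    -- contribute at most 1 by induction.
    set C : Finset V := Finset.univ.filter fun w => H.Adj v w ∧ par ≠ some w with hC
    set e : LTree V r → ENNReal := fun c =>
      if Expl H lab r (some v) c then (((shape r c).fact r : ℕ) : ENNReal)⁻¹ else 0 with he
    have hfact : ∀ l : List (LTree V r), (∀ c ∈ l, Expl H lab r (some v) c) →
        (((shape (r + 1) ((v, l) : LTree V (r + 1))).fact (r + 1) : ℕ) : ENNReal)⁻¹ =
          ((l.length.factorial : ℕ) : ENNReal)⁻¹ * (l.map e).prod := by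
      intro l hl
      have h1 : ((shape (r + 1) ((v, l) : LTree V (r + 1))).fact (r + 1)) =
          l.length.factorial * (l.map fun c => (shape r c).fact r).prod := by
        simp only [shape, Shape.fact]
        rw [List.length_map, List.map_map]
        rfl
      rw [h1, Nat.cast_mul, ENNReal.mul_inv (Or.inr (ENNReal.natCast_ne_top _))
        (Or.inl (ENNReal.natCast_ne_top _))]
      congr 1
      induction l with
      | nil => simp
      | cons c l ihl =>
        rw [List.map_cons, List.prod_cons, List.map_cons, List.prod_cons, Nat.cast_mul,
          ENNReal.mul_inv (Or.inr (ENNReal.natCast_ne_top _)) (Or.inl (ENNReal.natCast_ne_top _)),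
          ihl (fun c hc => hl c (List.mem_cons_of_mem _ hc)) (by
            simp only [shape, Shape.fact]
            rw [List.length_map, List.map_map]
            rfl)]
        simp only [he, if_pos (hl c List.mem_cons_self)]
    have hle : ∀ l : List (LTree V r), (if root (r + 1) ((v, l) : LTree V (r + 1)) = v then
        (if Expl H lab (r + 1) par ((v, l) : LTree V (r + 1)) then
          (((shape (r + 1) ((v, l) : LTree V (r + 1))).fact (r + 1) : ℕ) : ENNReal)⁻¹ else 0) else 0)
        ≤ ∑ L ∈ C.toList.permutations.toFinset, ((C.card.factorial : ℕ) : ENNReal)⁻¹ *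
          (if l.map (root r) = L then (l.map e).prod else 0) := by
      intro l
      split_ifs with h1 h2
      · obtain ⟨hnd, hmem, hch⟩ := h2
        have hperm : (l.map (root r)).Perm C.toList := by
          refine (List.perm_ext_iff_of_nodup hnd C.nodup_toList).2 fun w => ?_
          rw [hmem w, Finset.mem_toList, hC, Finset.mem_filter]
          simp
        have hlen : l.length = C.card := by
          have := hperm.length_eq
          rwa [List.length_map, Finset.length_toList] at this
        rw [hfact l hch, hlen]
        have hin : l.map (root r) ∈ C.toList.permutations.toFinset := by
          rw [List.mem_toFinset, List.mem_permutations]; exact hperm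
        refine le_trans ?_ (Finset.single_le_sum (f := fun L =>
          ((C.card.factorial : ℕ) : ENNReal)⁻¹ *
          (if l.map (root r) = L then (l.map e).prod else 0)) (fun _ _ => zero_le) hin)
        simp
      · exact zero_le
      · exact zero_le
    refine (ENNReal.tsum_le_tsum hle).trans ?_
    rw [Summable.tsum_finsetSum fun _ _ => ENNReal.summable]
    simp_rw [ENNReal.tsum_mul_left]
    refine (Finset.sum_le_card_nsmul _ _ ((C.card.factorial : ℕ) : ENNReal)⁻¹ fun L _ => ?_).trans ?_
    · exact mul_le_of_le_one_right (zero_le)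
        (tsum_list_le_one (root r) e (fun w => ih (some v) w) L)
    · rw [nsmul_eq_mul]
      have hcard : C.toList.permutations.toFinset.card ≤ C.card.factorial := by
        refine (List.toFinset_card_le _).trans ?_
        rw [List.length_permutations, Finset.length_toList]
      calc _ ≤ ((C.card.factorial : ℕ) : ENNReal) * ((C.card.factorial : ℕ) : ENNReal)⁻¹ := by
            gcongr
        _ = 1 := ENNReal.mul_inv_cancel (by
            simp [Nat.factorial_ne_zero]) (ENNReal.natCast_ne_top _)

section Count

lemma length_edges (r : ℕ) (t : LTree V r) : (edges r t).length = (shape r t).ec r := by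
  induction r with
  | zero => rfl
  | succ r ih =>
    obtain ⟨v, l⟩ := t
    simp only [edges, shape, Shape.ec, List.length_flatMap]
    rw [List.map_map]
    congr 1
    refine List.map_congr_left fun c _ => ?_
    rw [List.length_cons, ih, add_comm]
    rfl

lemma length_inner (r : ℕ) (t : LTree V r) : (inner r t).length = (shape r t).ic r := by
  induction r with
  | zero => rfl
  | succ r ih =>
    obtain ⟨v, l⟩ := t
    simp only [inner, shape, Shape.ic, List.length_flatMap, List.length_cons]
    rw [List.map_map, add_comm]
    congr 2
    exact List.map_congr_left fun c _ => ih c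

/-- `verts` lists the vertices in depth-first order, so any list of names of the right length can be
poured into the shape in that order. -/
lemma exists_of_verts (r : ℕ) (l : Shape r) (v : V) (L : List V) (hL : L.length = l.ec r) :
    ∃ t : LTree V r, shape r t = l ∧ verts r t = v :: L := by
  induction r generalizing v L with
  | zero =>
    refine ⟨((v, l) : V × Option (Fin 2)), rfl, ?_⟩
    have : L = [] := List.eq_nil_of_length_eq_zero hL
    rw [this]
    rfl
  | succ r ih =>
    suffices h : ∃ cs : List (LTree V r), cs.map (shape r) = l ∧ cs.flatMap (verts r) = L by
      obtain ⟨cs, h1, h2⟩ := h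
      exact ⟨((v, cs) : V × List (LTree V r)), h1, by rw [verts_succ, h2]⟩
    change List (Shape r) at l
    induction l generalizing L with
    | nil => exact ⟨[], rfl, (List.eq_nil_of_length_eq_zero hL).symm⟩
    | cons a l ihl =>
      have hlen : L.length = (1 + a.ec r) + (List.map (fun c => 1 + Shape.ec r c) l).sum := by
        rw [hL]; simp [Shape.ec]
      cases L with
      | nil => simp at hlen; omega
      | cons w L =>
        rw [List.length_cons] at hlen
        -- The name `w` goes to the root of the first subtree, the next `a.ec r` names to its
        -- descendants, the others to the later subtrees.
        obtain ⟨t, ht1, ht2⟩ := ih a w (L.take (a.ec r)) (by rw [List.length_take]; omega)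
        obtain ⟨cs, h1, h2⟩ := ihl (L.drop (a.ec r)) (by
          rw [List.length_drop]
          simp only [Shape.ec]
          omega)
        refine ⟨t :: cs, ?_, ?_⟩
        · rw [List.map_cons, ht1, h1]
        · rw [List.flatMap_cons, ht2, h2, List.cons_append, List.take_append_drop]

/-- For each shape and each root there are as many labelled trees as injections. -/
lemma exists_finset_nodup (n r : ℕ) (i : Fin n) (l : Shape r) :
    ∃ S : Finset (LTree (Fin n) r), S.card = (n - 1).descFactorial (l.ec r) ∧
      ∀ t ∈ S, shape r t = l ∧ root r t = i ∧ (verts r t).Nodup := by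
  classical
  have hex : ∀ φ : Fin (l.ec r) ↪ {v : Fin n // v ≠ i}, ∃ t : LTree (Fin n) r, shape r t = l ∧
      verts r t = i :: List.ofFn fun k => (φ k : Fin n) := fun φ =>
    exists_of_verts r l i _ (by rw [List.length_ofFn])
  choose T hT1 hT2 using hex
  have hinj : Function.Injective T := by
    intro φ ψ h
    have h2 : (i :: List.ofFn fun k => (φ k : Fin n)) = i :: List.ofFn fun k => (ψ k : Fin n) := by
      rw [← hT2, ← hT2, h]
    have h3 := List.ofFn_injective (List.cons.inj h2).2
    ext k
    exact congrArg Fin.val (congrFun h3 k)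
  refine ⟨Finset.univ.image T, ?_, ?_⟩
  · rw [Finset.card_image_of_injective _ hinj, Finset.card_univ, Fintype.card_embedding_eq,
      Fintype.card_fin, Fintype.card_subtype_compl, Fintype.card_fin, Fintype.card_subtype_eq]
  · intro t ht
    obtain ⟨φ, -, rfl⟩ := Finset.mem_image.1 ht
    refine ⟨hT1 φ, ?_, ?_⟩
    · have := hT2 φ
      rw [verts] at this
      exact (List.cons.inj this).1
    · rw [hT2, List.nodup_cons]
      constructor
      · intro hmem
        obtain ⟨k, hk⟩ := (List.mem_ofFn' _ _).1 hmem
        exact (φ k).2 hk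
      · rw [List.nodup_ofFn]
        exact fun a b h => φ.injective (Subtype.ext h)

end Count

end LTree

/-! ### Levels of a labelled tree. -/

namespace LTree

variable {V : Type}

lemma mem_lev_zero {r : ℕ} {t : LTree V r} {x : V} : x ∈ lev r 0 t ↔ x = root r t := by
  cases r <;> simp [lev, root]

lemma mem_lev_succ {r k : ℕ} {v : V} {l : List (LTree V r)} {x : V} :
    x ∈ lev (r + 1) (k + 1) ((v, l) : LTree V (r + 1)) ↔ ∃ c ∈ l, x ∈ lev r k c := by
  simp [lev, List.mem_flatMap]

lemma mem_verts_succ {r : ℕ} {v : V} {l : List (LTree V r)} {x : V} :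
    x ∈ verts (r + 1) ((v, l) : LTree V (r + 1)) ↔ x = v ∨ ∃ c ∈ l, x ∈ verts r c := by
  simp [verts_succ, List.mem_flatMap]

lemma mem_verts_iff_lev {r : ℕ} {t : LTree V r} {x : V} :
    x ∈ verts r t ↔ ∃ k ≤ r, x ∈ lev r k t := by
  induction r with
  | zero =>
    constructor
    · intro h
      refine ⟨0, le_rfl, mem_lev_zero.2 ?_⟩
      simpa [verts, edges] using h
    · rintro ⟨k, hk, h⟩
      obtain rfl : k = 0 := by omega
      rw [mem_lev_zero.1 h]
      exact root_mem_verts 0 t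
  | succ r ih =>
    obtain ⟨v, l⟩ := t
    rw [mem_verts_succ]
    constructor
    · rintro (rfl | ⟨c, hc, h⟩)
      · exact ⟨0, by omega, mem_lev_zero.2 rfl⟩
      · obtain ⟨k, hk, h⟩ := ih.1 h
        exact ⟨k + 1, by omega, mem_lev_succ.2 ⟨c, hc, h⟩⟩
    · rintro ⟨k, hk, h⟩
      cases k with
      | zero => exact Or.inl (mem_lev_zero.1 h)
      | succ k =>
        obtain ⟨c, hc, h⟩ := mem_lev_succ.1 h
        exact Or.inr ⟨c, hc, ih.2 ⟨k, by omega, h⟩⟩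

lemma le_of_mem_lev {r k : ℕ} {t : LTree V r} {x : V} (h : x ∈ lev r k t) : k ≤ r := by
  induction r generalizing k with
  | zero => cases k with
    | zero => rfl
    | succ k => simp [lev] at h
  | succ r ih => cases k with
    | zero => omega
    | succ k =>
      obtain ⟨v, l⟩ := t
      obtain ⟨c, hc, h⟩ := mem_lev_succ.1 h
      have := ih h
      omega

lemma mem_verts_of_lev {r k : ℕ} {t : LTree V r} {x : V} (h : x ∈ lev r k t) : x ∈ verts r t :=
  mem_verts_iff_lev.2 ⟨k, le_of_mem_lev h, h⟩

lemma exists_lev_of_edge {r : ℕ} {t : LTree V r} {x y : V} (h : (x, y) ∈ edges r t) :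
    ∃ k, x ∈ lev r k t ∧ y ∈ lev r (k + 1) t := by
  induction r with
  | zero => simp [edges] at h
  | succ r ih =>
    obtain ⟨v, l⟩ := t
    obtain ⟨c, hc, ⟨rfl, rfl⟩ | h⟩ := mem_edges_succ.1 h
    · exact ⟨0, mem_lev_zero.2 rfl, mem_lev_succ.2 ⟨c, hc, mem_lev_zero.2 rfl⟩⟩
    · obtain ⟨k, h1, h2⟩ := ih h
      exact ⟨k + 1, mem_lev_succ.2 ⟨c, hc, h1⟩, mem_lev_succ.2 ⟨c, hc, h2⟩⟩

lemma exists_parent {r k : ℕ} {t : LTree V r} {y : V} (h : y ∈ lev r (k + 1) t) :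
    ∃ x ∈ lev r k t, (x, y) ∈ edges r t := by
  induction r generalizing k with
  | zero => simp [lev] at h
  | succ r ih =>
    obtain ⟨v, l⟩ := t
    obtain ⟨c, hc, h⟩ := mem_lev_succ.1 h
    cases k with
    | zero => exact ⟨v, mem_lev_zero.2 rfl, mem_edges_succ.2 ⟨c, hc, Or.inl ⟨rfl, mem_lev_zero.1 h⟩⟩⟩
    | succ k =>
      obtain ⟨x, hx, he⟩ := ih h
      exact ⟨x, mem_lev_succ.2 ⟨c, hc, hx⟩, mem_edges_succ.2 ⟨c, hc, Or.inr he⟩⟩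

lemma lev_unique {r j k : ℕ} {t : LTree V r} (hn : (verts r t).Nodup) {x : V}
    (hj : x ∈ lev r j t) (hk : x ∈ lev r k t) : j = k := by
  induction r generalizing j k with
  | zero =>
    have h1 := le_of_mem_lev hj
    have h2 := le_of_mem_lev hk
    omega
  | succ r ih =>
    obtain ⟨v, l⟩ := t
    obtain ⟨h1, h2, h3⟩ := nodup_succ hn
    have hv : ∀ k, v ∉ lev (r + 1) (k + 1) ((v, l) : LTree V (r + 1)) := by
      intro k h
      obtain ⟨c, hc, h⟩ := mem_lev_succ.1 h
      exact h1 c hc (mem_verts_of_lev h)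
    cases j with
    | zero =>
      obtain rfl : x = v := mem_lev_zero.1 hj
      cases k with
      | zero => rfl
      | succ k => exact absurd hk (hv k)
    | succ j =>
      cases k with
      | zero =>
        obtain rfl : x = v := mem_lev_zero.1 hk
        exact absurd hj (hv j)
      | succ k =>
        obtain ⟨c, hc, hj⟩ := mem_lev_succ.1 hj
        obtain ⟨c', hc', hk⟩ := mem_lev_succ.1 hk
        obtain rfl := eq_of_mem_verts h3 hc hc' (mem_verts_of_lev hj) (mem_verts_of_lev hk)
        rw [ih (h2 c hc) hj hk]

lemma mem_inner_iff {r : ℕ} {t : LTree V r} {x : V} :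
    x ∈ inner r t ↔ ∃ k < r, x ∈ lev r k t := by
  induction r with
  | zero => simp [inner]
  | succ r ih =>
    obtain ⟨v, l⟩ := t
    have : x ∈ inner (r + 1) ((v, l) : LTree V (r + 1)) ↔ x = v ∨ ∃ c ∈ l, x ∈ inner r c := by
      simp [inner, List.mem_flatMap]
    rw [this]
    constructor
    · rintro (rfl | ⟨c, hc, h⟩)
      · exact ⟨0, by omega, mem_lev_zero.2 rfl⟩
      · obtain ⟨k, hk, h⟩ := ih.1 h
        exact ⟨k + 1, by omega, mem_lev_succ.2 ⟨c, hc, h⟩⟩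
    · rintro ⟨k, hk, h⟩
      cases k with
      | zero => exact Or.inl (mem_lev_zero.1 h)
      | succ k =>
        obtain ⟨c, hc, h⟩ := mem_lev_succ.1 h
        exact Or.inr ⟨c, hc, ih.2 ⟨k, by omega, h⟩⟩

lemma mem_leaves_succ {r : ℕ} {v : V} {l : List (LTree V r)} {x : V × Option (Fin 2)} :
    x ∈ leaves (r + 1) ((v, l) : LTree V (r + 1)) ↔ ∃ c ∈ l, x ∈ leaves r c := by
  simp [leaves, List.mem_flatMap]

lemma mem_lev_last_iff {r : ℕ} {t : LTree V r} {x : V} :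
    x ∈ lev r r t ↔ ∃ o, (x, o) ∈ leaves r t := by
  induction r with
  | zero =>
    rw [mem_lev_zero]
    constructor
    · rintro rfl
      exact ⟨t.2, by simp [leaves, root]⟩
    · rintro ⟨o, h⟩
      simp only [leaves, List.mem_singleton] at h
      exact (Prod.mk.inj h).1
  | succ r ih =>
    obtain ⟨v, l⟩ := t
    rw [mem_lev_succ]
    simp only [mem_leaves_succ, ih]
    constructor
    · rintro ⟨c, hc, o, h⟩
      exact ⟨o, c, hc, h⟩
    · rintro ⟨o, c, hc, h⟩
      exact ⟨c, hc, o, h⟩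

lemma leaves_unique {r : ℕ} {t : LTree V r} (hn : (verts r t).Nodup) {x : V}
    {o o' : Option (Fin 2)} (h : (x, o) ∈ leaves r t) (h' : (x, o') ∈ leaves r t) : o = o' := by
  induction r with
  | zero =>
    simp only [leaves, List.mem_singleton] at h h'
    rw [(Prod.mk.inj h).2, (Prod.mk.inj h').2]
  | succ r ih =>
    obtain ⟨v, l⟩ := t
    obtain ⟨h1, h2, h3⟩ := nodup_succ hn
    obtain ⟨c, hc, h⟩ := mem_leaves_succ.1 h
    obtain ⟨c', hc', h'⟩ := mem_leaves_succ.1 h'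
    have m1 := mem_verts_of_lev (mem_lev_last_iff.2 ⟨_, h⟩)
    have m2 := mem_verts_of_lev (mem_lev_last_iff.2 ⟨_, h'⟩)
    obtain rfl := eq_of_mem_verts h3 hc hc' m1 m2
    exact ih (h2 c hc) h h'

lemma inner_subset {r : ℕ} {t : LTree V r} {x : V} (h : x ∈ inner r t) : x ∈ verts r t := by
  obtain ⟨k, h1, h2⟩ := mem_inner_iff.1 h
  exact mem_verts_of_lev h2

lemma edges_asymm {r : ℕ} {t : LTree V r} (hn : (verts r t).Nodup) {x y : V}
    (h : (x, y) ∈ edges r t) : (y, x) ∉ edges r t := by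
  intro h'
  obtain ⟨k, h1, h2⟩ := exists_lev_of_edge h
  obtain ⟨j, h3, h4⟩ := exists_lev_of_edge h'
  have e1 := lev_unique hn h1 h4
  have e2 := lev_unique hn h2 h3
  omega

lemma edges_ne {r : ℕ} {t : LTree V r} (hn : (verts r t).Nodup) {x y : V}
    (h : (x, y) ∈ edges r t) : x ≠ y := by
  rintro rfl
  exact edges_asymm hn h h

end LTree

/-! ### Graph neighbourhoods described by labelled trees. -/

open LTree

variable {n : ℕ}

open Classical in
/-- The view described by a labelled tree. -/
noncomputable def treeView (r : ℕ) (t : LTree (Fin n) r) : View n where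
  verts := {v | v ∈ verts r t}
  edges := SimpleGraph.fromRel fun u v => (u, v) ∈ edges r t
  labels := fun v =>
    if (v, some 0) ∈ leaves r t then some 0 else if (v, some 1) ∈ leaves r t then some 1 else none

/-- The outcome `ω` contains the labelled tree `t` as a neighbourhood. -/
def Realizes (r : ℕ) (t : LTree (Fin n) r) (ω : Sample n) : Prop :=
  (∀ u ∈ verts r t, ∀ v ∈ verts r t,
    (ω.graph.Adj u v ↔ (u, v) ∈ edges r t ∨ (v, u) ∈ edges r t)) ∧
  (∀ u ∈ inner r t, ∀ v, v ∉ verts r t → ¬ ω.graph.Adj u v) ∧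
  ∀ v o, (v, o) ∈ leaves r t →
    (o = none ∧ v ∉ ω.revealed) ∨ (o = some (ω.label v) ∧ v ∈ ω.revealed)

lemma treeView_labels {r : ℕ} {t : LTree (Fin n) r} (hn : (verts r t).Nodup) {v : Fin n}
    {o : Option (Fin 2)} (h : (v, o) ∈ leaves r t) : (treeView r t).labels v = o := by
  classical
  simp only [treeView]
  split_ifs with h1 h2
  · exact leaves_unique hn h1 h
  · exact leaves_unique hn h2 h
  · match o, h with
    | none, _ => rfl
    | some 0, h => exact absurd h h1
    | some 1, h => exact absurd h h2

/-- The view of `t` thus determines `t` up to the order of the children, which allows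
`tsum_inv_fact_le_one` to control the number of trees sharing a view. -/
lemma expl_treeView {r : ℕ} {t : LTree (Fin n) r} (hn : (verts r t).Nodup) :
    Expl (treeView r t).edges (treeView r t).labels r none t := by
  refine expl_of_nodup hn (fun u hu w => ?_) (fun w _ => by simp) fun v o h => treeView_labels hn h
  simp only [treeView, SimpleGraph.fromRel_adj]
  constructor
  · rintro ⟨-, h | h⟩
    · exact Or.inl h
    · exact Or.inr (Or.inl h)
  · rintro (h | h | h)
    · exact ⟨edges_ne hn h, Or.inl h⟩
    · exact ⟨(edges_ne hn h).symm, Or.inr h⟩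
    · simp at h

lemma edist_le_succ_iff (g : SimpleGraph (Fin n)) (i v : Fin n) (k : ℕ) :
    g.edist i v ≤ ((k + 1 : ℕ) : ℕ∞) ↔ g.edist i v ≤ (k : ℕ∞) ∨
      ∃ u, g.edist i u ≤ (k : ℕ∞) ∧ g.Adj u v := by
  constructor
  · intro h
    have hne : g.edist i v ≠ ⊤ := ne_top_of_le_ne_top (ENat.natCast_ne_top _) h
    obtain ⟨p, hp⟩ := SimpleGraph.exists_walk_of_edist_ne_top hne
    have hlen : p.length ≤ k + 1 := by rw [← hp] at h; exact_mod_cast h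
    rcases Nat.lt_or_ge k p.length with hk | hk
    · right
      have hnn : ¬ p.Nil := by
        intro hnil
        have := SimpleGraph.Walk.length_eq_zero_iff.2 hnil
        omega
      refine ⟨p.penultimate, ?_, p.adj_penultimate hnn⟩
      refine (SimpleGraph.edist_le p.dropLast).trans ?_
      have : p.dropLast.length = p.length - 1 := by simp
      rw [this]
      exact_mod_cast (by omega : p.length - 1 ≤ k)
    · left
      rw [← hp]
      exact_mod_cast hk
  · rintro (h | ⟨u, h, hadj⟩)
    · exact h.trans (by exact_mod_cast Nat.le_succ k)
    · refine (SimpleGraph.edist_triangle (v := u)).trans ?_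
      rw [SimpleGraph.edist_eq_one_iff_adj.2 hadj]
      push_cast
      gcongr

/-- Graph distance from the root is depth in the tree: vertices of depth less than `r` have no
neighbour outside the tree, and tree edges join consecutive levels. -/
lemma edist_le_iff_lev {r : ℕ} {t : LTree (Fin n) r} (hn : (verts r t).Nodup) {ω : Sample n}
    (h : Realizes r t ω) (k : ℕ) (hk : k ≤ r) (v : Fin n) :
    ω.graph.edist (root r t) v ≤ (k : ℕ∞) ↔ ∃ j ≤ k, v ∈ lev r j t := by
  induction k generalizing v with
  | zero =>
    simp only [Nat.cast_zero, nonpos_iff_eq_zero, SimpleGraph.edist_eq_zero_iff]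
    constructor
    · rintro rfl
      exact ⟨0, rfl, mem_lev_zero.2 rfl⟩
    · rintro ⟨j, rfl, hj⟩
      exact (mem_lev_zero.1 hj).symm
  | succ k ih =>
    have ih := ih (by omega)
    rw [edist_le_succ_iff, ih]
    constructor
    · rintro (⟨j, hj, hv⟩ | ⟨u, hu, hadj⟩)
      · exact ⟨j, by omega, hv⟩
      · obtain ⟨j, hj, hu⟩ := (ih u).1 hu
        have hin : u ∈ inner r t := mem_inner_iff.2 ⟨j, by omega, hu⟩
        have hv : v ∈ verts r t := by
          by_contra hv
          exact h.2.1 u hin v hv hadj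
        rcases (h.1 u (inner_subset hin) v hv).1 hadj with he | he
        · obtain ⟨m, h1, h2⟩ := exists_lev_of_edge he
          have := lev_unique hn h1 hu
          exact ⟨m + 1, by omega, h2⟩
        · obtain ⟨m, h1, h2⟩ := exists_lev_of_edge he
          have := lev_unique hn h2 hu
          exact ⟨m, by omega, h1⟩
    · rintro ⟨j, hj, hv⟩
      rcases Nat.lt_or_ge j (k + 1) with hlt | hge
      · exact Or.inl ⟨j, by omega, hv⟩
      · obtain rfl : j = k + 1 := by omega
        obtain ⟨u, hu, he⟩ := exists_parent hv
        exact Or.inr ⟨u, (ih u).2 ⟨k, le_rfl, hu⟩,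
          (h.1 u (fst_mem_verts he) v (snd_mem_verts he)).2 (Or.inl he)⟩

lemma mem_ball_iff {r : ℕ} {t : LTree (Fin n) r} (hn : (verts r t).Nodup) {ω : Sample n}
    (h : Realizes r t ω) (v : Fin n) : v ∈ ball ω.graph (root r t) r ↔ v ∈ verts r t := by
  rw [mem_verts_iff_lev, ← edist_le_iff_lev hn h r le_rfl]
  rfl

lemma mem_sphere_iff {r : ℕ} {t : LTree (Fin n) r} (hn : (verts r t).Nodup) {ω : Sample n}
    (h : Realizes r t ω) (v : Fin n) : v ∈ sphere ω.graph (root r t) r ↔ v ∈ lev r r t := by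
  have h1 : v ∈ sphere ω.graph (root r t) r ↔ ω.graph.edist (root r t) v = (r : ℕ∞) := Iff.rfl
  rw [h1]
  constructor
  · intro he
    obtain ⟨j, hj, hv⟩ := (edist_le_iff_lev hn h r le_rfl v).1 he.le
    have h2 := (edist_le_iff_lev hn h j hj v).2 ⟨j, le_rfl, hv⟩
    rw [he] at h2
    have h3 : r ≤ j := by exact_mod_cast h2
    obtain rfl : j = r := by omega
    exact hv
  · intro hv
    refine le_antisymm ((edist_le_iff_lev hn h r le_rfl v).2 ⟨r, le_rfl, hv⟩) ?_
    by_contra hlt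
    rw [not_le] at hlt
    obtain ⟨m, hm⟩ := ENat.ne_top_iff_exists.1 (ne_top_of_lt hlt)
    rw [← hm] at hlt
    have hmr : m < r := by exact_mod_cast hlt
    obtain ⟨j, hj, hv'⟩ := (edist_le_iff_lev hn h m hmr.le v).1 hm.symm.le
    have := lev_unique hn hv hv'
    omega

/-- On the event `Realizes r t`, the depth-`r` view is the tree `t`. -/
lemma view_eq_treeView {r : ℕ} {t : LTree (Fin n) r} (hn : (verts r t).Nodup) {ω : Sample n}
    (h : Realizes r t ω) : view (root r t) r ω = treeView r t := by
  classical
  have hb := mem_ball_iff hn h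
  have hs := mem_sphere_iff hn h
  have e1 : (view (root r t) r ω).verts = (treeView r t).verts := Set.ext fun v => hb v
  have e2 : (view (root r t) r ω).edges = (treeView r t).edges := by
    ext u v
    simp only [view, treeView, SimpleGraph.map_adj, SimpleGraph.comap_adj,
      SimpleGraph.fromRel_adj, Function.Embedding.subtype_apply]
    constructor
    · rintro ⟨a, b, hadj, rfl, rfl⟩
      exact ⟨hadj.ne, (h.1 a ((hb a).1 a.2) b ((hb b).1 b.2)).1 hadj⟩
    · rintro ⟨-, he⟩
      have hu : u ∈ verts r t := he.elim fst_mem_verts snd_mem_verts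
      have hv : v ∈ verts r t := he.elim snd_mem_verts fst_mem_verts
      exact ⟨⟨u, (hb u).2 hu⟩, ⟨v, (hb v).2 hv⟩, (h.1 u hu v hv).2 he, rfl, rfl⟩
  have e3 : (view (root r t) r ω).labels = (treeView r t).labels := by
    funext v
    by_cases hv : v ∈ lev r r t
    · obtain ⟨o, ho⟩ := mem_lev_last_iff.1 hv
      rw [treeView_labels hn ho]
      simp only [view, hs v, hv, true_and]
      rcases h.2.2 v o ho with ⟨rfl, hr⟩ | ⟨rfl, hr⟩
      · rw [if_neg hr]
      · rw [if_pos hr]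
    · have h1 : ∀ o, (v, o) ∉ leaves r t := fun o ho => hv (mem_lev_last_iff.2 ⟨o, ho⟩)
      simp [view, treeView, hs v, hv, h1]
  cases hx : view (root r t) r ω
  cases hy : treeView r t
  rw [hx, hy] at e1 e2 e3
  simp only at e1 e2 e3
  rw [e1, e2, e3]

/-! ### Averages over independent labels. -/

section LabelExpectation

variable {V : Type} [Fintype V] [DecidableEq V] (p : ℝ)

/-- Expectation over independent labels with law `prior p`. -/
noncomputable def labelExp (F : (V → Fin 2) → ℝ) : ℝ := ∑ σ, (∏ v, prior p (σ v)) * F σ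

lemma sum_prod_prior (f : V → Fin 2 → ℝ) :
    ∑ σ : V → Fin 2, ∏ v, f v (σ v) = ∏ v, ∑ y, f v y := by
  rw [Finset.prod_univ_sum, Fintype.piFinset_univ]

lemma labelExp_one : labelExp (V := V) p (fun _ => 1) = 1 := by
  simp only [labelExp, mul_one]
  rw [sum_prod_prior (fun _ y => prior p y)]
  simp only [sum_prior, Finset.prod_const_one]

variable {p}

lemma labelExp_mono (hp0 : 0 ≤ p) (hp1 : p ≤ 1) {F G : (V → Fin 2) → ℝ} (h : ∀ σ, F σ ≤ G σ) :
    labelExp p F ≤ labelExp p G :=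
  Finset.sum_le_sum fun σ _ => mul_le_mul_of_nonneg_left (h σ)
    (Finset.prod_nonneg fun _ _ => prior_nonneg hp0 hp1 _)

lemma labelExp_sum {ι : Type*} (s : Finset ι) (F : ι → (V → Fin 2) → ℝ) :
    labelExp p (fun σ => ∑ j ∈ s, F j σ) = ∑ j ∈ s, labelExp p (F j) := by
  simp only [labelExp, Finset.mul_sum]
  exact Finset.sum_comm

lemma labelExp_const_mul (c : ℝ) (F : (V → Fin 2) → ℝ) :
    labelExp p (fun σ => c * F σ) = c * labelExp p F := by
  simp only [labelExp, Finset.mul_sum]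
  exact Finset.sum_congr rfl fun σ _ => by ring

/-- Functions of disjoint sets of labels are independent. -/
lemma labelExp_mul (B : Set V) {F G : (V → Fin 2) → ℝ}
    (hF : ∀ σ τ : V → Fin 2, (∀ v ∉ B, σ v = τ v) → F σ = F τ)
    (hG : ∀ σ τ : V → Fin 2, (∀ v ∈ B, σ v = τ v) → G σ = G τ) :
    labelExp p (fun σ => F σ * G σ) = labelExp p F * labelExp p G := by
  classical
  have h1 : labelExp p (fun σ => F σ * G σ) =
      ∑ x : (V → Fin 2) × (V → Fin 2), ((∏ v, prior p (x.1 v)) * (∏ v, prior p (x.2 v))) *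
        (F x.1 * G x.1) := by
    rw [Fintype.sum_prod_type]
    have h2 := labelExp_one (V := V) p
    simp only [labelExp, mul_one] at h2 ⊢
    refine Finset.sum_congr rfl fun σ _ => ?_
    calc _ = ((∏ v, prior p (σ v)) * (F σ * G σ)) * ∑ τ : V → Fin 2, ∏ v, prior p (τ v) := by
          rw [h2, mul_one]
      _ = _ := by
        rw [Finset.mul_sum]
        exact Finset.sum_congr rfl fun τ _ => by ring
  have h3 : labelExp p F * labelExp p G =
      ∑ x : (V → Fin 2) × (V → Fin 2), ((∏ v, prior p (x.1 v)) * (∏ v, prior p (x.2 v))) *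
        (F x.1 * G x.2) := by
    rw [Fintype.sum_prod_type]
    simp only [labelExp, Finset.sum_mul_sum]
    refine Finset.sum_congr rfl fun σ _ => Finset.sum_congr rfl fun τ _ => by ring
  -- With a second independent copy of the labels, exchanging the two copies on `B` is an involution
  -- preserving the product weight, and it decouples `F` from `G`.
  set m : (V → Fin 2) → (V → Fin 2) → V → Fin 2 := fun σ τ v => if v ∈ B then τ v else σ v with hm
  have hinv : Function.Involutive
      fun x : (V → Fin 2) × (V → Fin 2) => (m x.1 x.2, m x.2 x.1) := by
    rintro ⟨σ, τ⟩
    simp only [hm, Prod.mk.injEq]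
    constructor <;> (funext v; by_cases hv : v ∈ B <;> simp [hv])
  rw [h1, h3, ← Equiv.sum_comp (hinv.toPerm)]
  refine Finset.sum_congr rfl fun x _ => ?_
  obtain ⟨σ, τ⟩ := x
  simp only [Function.Involutive.coe_toPerm]
  rw [hF (m σ τ) σ fun v hv => by simp [hm, hv], hG (m σ τ) τ fun v hv => by simp [hm, hv],
    ← Finset.prod_mul_distrib, ← Finset.prod_mul_distrib]
  congr 1
  refine Finset.prod_congr rfl fun v _ => ?_
  by_cases hv : v ∈ B
  · simp only [hm, hv, if_true]; ring
  · simp only [hm, hv, if_false]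

lemma labelExp_ite_eq (v : V) (y : Fin 2) :
    labelExp p (fun σ => if σ v = y then 1 else 0) = prior p y := by
  have h : ∀ σ : V → Fin 2, (∏ w, prior p (σ w)) * (if σ v = y then 1 else 0) =
      ∏ w, (prior p (σ w) * (if w = v then (if σ w = y then 1 else 0) else 1)) := by
    intro σ
    rw [Finset.prod_mul_distrib, Finset.prod_ite_eq' Finset.univ v]
    simp
  simp only [labelExp, h]
  rw [sum_prod_prior (fun w z => prior p z * (if w = v then (if z = y then 1 else 0) else 1)),
    Finset.prod_eq_single v]
  · simp
  · intro w _ hw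
    simp only [hw, if_false, mul_one, sum_prior]
  · intro h; exact absurd (Finset.mem_univ v) h

/-- Averaging over a single label. -/
lemma labelExp_resample (v : V) (F : (V → Fin 2) → Fin 2 → ℝ)
    (hF : ∀ y, ∀ σ τ : V → Fin 2, (∀ w, w ≠ v → σ w = τ w) → F σ y = F τ y) :
    labelExp p (fun σ => F σ (σ v)) = ∑ y, prior p y * labelExp p (fun σ => F σ y) := by
  have h1 : (fun σ : V → Fin 2 => F σ (σ v)) =
      fun σ => ∑ y, F σ y * (if σ v = y then 1 else 0) := by
    funext σ
    simp
  rw [h1, labelExp_sum]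
  refine Finset.sum_congr rfl fun y _ => ?_
  rw [labelExp_mul {v} (fun σ τ h => hF y σ τ fun w hw => h w (by simpa using hw))
    (fun σ τ h => by rw [h v (by simp)]), labelExp_ite_eq, mul_comm]

/-- Averaging out the labels of a set of vertices, as a lower bound. -/
lemma labelExp_prod_ge (hp0 : 0 ≤ p) (hp1 : p ≤ 1) (O : Finset V) {F : (V → Fin 2) → ℝ}
    (hF0 : ∀ σ, 0 ≤ F σ)
    (hF : ∀ σ τ : V → Fin 2, (∀ v ∉ O, σ v = τ v) → F σ = F τ)
    {h : (V → Fin 2) → Fin 2 → ℝ} (h0 : ∀ σ y, 0 ≤ h σ y)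
    (hh : ∀ y, ∀ σ τ : V → Fin 2, (∀ v ∉ O, σ v = τ v) → h σ y = h τ y)
    {θ : ℝ} (hθ0 : 0 ≤ θ) (hθ : ∀ σ, θ ≤ ∑ y, prior p y * h σ y) :
    θ ^ O.card * labelExp p F ≤ labelExp p (fun σ => F σ * ∏ v ∈ O, h σ (σ v)) := by
  suffices H : ∀ S ⊆ O, θ ^ S.card * labelExp p F ≤
      labelExp p (fun σ => F σ * ∏ v ∈ S, h σ (σ v)) from H O subset_rfl
  intro S
  induction S using Finset.induction_on with
  | empty => intro _; simp
  | insert o S ho ih =>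
    intro hS
    have hoO : o ∈ O := hS (Finset.mem_insert_self _ _)
    have ih := ih ((Finset.subset_insert _ _).trans hS)
    have hloc : ∀ σ τ : V → Fin 2, (∀ w, w ≠ o → σ w = τ w) → ∀ w ∉ O, σ w = τ w :=
      fun σ τ hst w hw => hst w fun he => hw (he ▸ hoO)
    have e1 : (fun σ : V → Fin 2 => F σ * ∏ v ∈ insert o S, h σ (σ v)) =
        fun σ => (fun σ y => (F σ * ∏ v ∈ S, h σ (σ v)) * h σ y) σ (σ o) := by
      -- Neither `F`, nor `h` through its first argument, nor the factors indexed by `S` reads the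
      -- label of `o`, so that label is averaged freely; this produces the factor `θ`.
      funext σ
      rw [Finset.prod_insert ho]
      ring
    rw [e1, labelExp_resample o (fun σ y => (F σ * ∏ v ∈ S, h σ (σ v)) * h σ y)]
    · have e2 : ∑ y, prior p y * labelExp p (fun σ => (F σ * ∏ v ∈ S, h σ (σ v)) * h σ y) =
          labelExp p (fun σ => (F σ * ∏ v ∈ S, h σ (σ v)) * ∑ y, prior p y * h σ y) := by
        simp_rw [Finset.mul_sum]
        rw [labelExp_sum]
        refine Finset.sum_congr rfl fun y _ => ?_
        rw [← labelExp_const_mul]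
        congr 1
        funext σ
        ring
      rw [e2, Finset.card_insert_of_notMem ho, pow_succ']
      calc θ * θ ^ S.card * labelExp p F = θ * (θ ^ S.card * labelExp p F) := by ring
        _ ≤ θ * labelExp p (fun σ => F σ * ∏ v ∈ S, h σ (σ v)) :=
          mul_le_mul_of_nonneg_left ih hθ0
        _ = labelExp p (fun σ => θ * (F σ * ∏ v ∈ S, h σ (σ v))) := (labelExp_const_mul _ _).symm
        _ ≤ _ := by
          refine labelExp_mono hp0 hp1 fun σ => ?_
          rw [mul_comm θ]
          exact mul_le_mul_of_nonneg_left (hθ σ)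
            (mul_nonneg (hF0 σ) (Finset.prod_nonneg fun v _ => h0 _ _))
    · intro y σ τ hst
      have e3 : ∀ v ∈ S, h σ (σ v) = h τ (τ v) := by
        intro v hv
        rw [hst v fun he => ho (he ▸ hv), hh _ σ τ (hloc σ τ hst)]
      simp only [hF σ τ (hloc σ τ hst), hh y σ τ (hloc σ τ hst), Finset.prod_congr rfl e3]

end LabelExpectation

/-! ### Likelihoods of labelled trees and their averages over labels. -/

section TreeLikelihood

open LTree

/-- The likelihood of a shape given the class of the root, without the normalising factors. -/
noncomputable def lik (p q : ℝ) (M : Matrix (Fin 2) (Fin 2) ℝ) : ∀ r : ℕ, Fin 2 → Shape r → ℝ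
  | 0, x, o => obs q x o
  | r + 1, x, l => (List.map (fun c => ∑ y, prior p y * (M x y * lik p q M r y c)) l).prod

/-- The likelihood of a labelled tree given all labels, the root having class `x`. -/
noncomputable def labelledLik {V : Type} (q : ℝ) (M : Matrix (Fin 2) (Fin 2) ℝ) (σ : V → Fin 2) :
    ∀ r : ℕ, Fin 2 → LTree V r → ℝ
  | 0, x, t => obs q x t.2
  | r + 1, _, t => (t.2.map fun c => M (σ t.1) (σ (root r c)) *
      labelledLik q M σ r (σ (root r c)) c).prod

lemma prod_edges_mul_prod_leaves {V : Type} (q : ℝ) (M : Matrix (Fin 2) (Fin 2) ℝ)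
    (σ : V → Fin 2) (r : ℕ) (t : LTree V r) :
    ((edges r t).map fun e => M (σ e.1) (σ e.2)).prod *
      ((leaves r t).map fun e => obs q (σ e.1) e.2).prod =
    labelledLik q M σ r (σ (root r t)) t := by
  induction r with
  | zero => simp [edges, leaves, labelledLik, root]
  | succ r ih =>
    obtain ⟨v, l⟩ := t
    simp only [edges, leaves, labelledLik]
    induction l with
    | nil => simp
    | cons c l ihl =>
      simp only [List.flatMap_cons, List.map_append, List.map_cons, List.prod_append,
        List.prod_cons, ← ih c]
      rw [← ihl]
      ring

lemma labelledLik_nonneg {V : Type} {q : ℝ} (hq0 : 0 ≤ q) (hq1 : q ≤ 1)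
    {M : Matrix (Fin 2) (Fin 2) ℝ} (hM : ∀ x y, 0 ≤ M x y)
    (σ : V → Fin 2) (r : ℕ) (x : Fin 2) (t : LTree V r) : 0 ≤ labelledLik q M σ r x t := by
  induction r generalizing x with
  | zero => exact obs_nonneg hq0 hq1 _ _
  | succ r ih =>
    refine List.prod_nonneg fun a ha => ?_
    obtain ⟨c, -, rfl⟩ := List.mem_map.1 ha
    exact mul_nonneg (hM _ _) (ih _ c)

lemma labelledLik_congr {V : Type} {q : ℝ} {M : Matrix (Fin 2) (Fin 2) ℝ} {σ τ : V → Fin 2} {r : ℕ}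
    {x : Fin 2} {t : LTree V r} (h : ∀ v ∈ verts r t, σ v = τ v) :
    labelledLik q M σ r x t = labelledLik q M τ r x t := by
  induction r generalizing x with
  | zero => rfl
  | succ r ih =>
    obtain ⟨v, l⟩ := t
    simp only [labelledLik]
    congr 1
    refine List.map_congr_left fun c hc => ?_
    have hsub : ∀ w ∈ verts r c, σ w = τ w := fun w hw =>
      h w (mem_verts_succ.2 (Or.inr ⟨c, hc, hw⟩))
    rw [ih hsub, hsub _ (root_mem_verts r c), h v (mem_verts_succ.2 (Or.inl rfl))]

/-- `labelledLik` with the class of the root forced to be `x`. -/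
noncomputable def rootedLik {V : Type} (q : ℝ) (M : Matrix (Fin 2) (Fin 2) ℝ) (σ : V → Fin 2) :
    ∀ r : ℕ, Fin 2 → LTree V r → ℝ
  | 0, x, t => obs q x t.2
  | r + 1, x, t => (t.2.map fun c => M x (σ (root r c)) *
      labelledLik q M σ r (σ (root r c)) c).prod

lemma rootedLik_root {V : Type} (q : ℝ) (M : Matrix (Fin 2) (Fin 2) ℝ) (σ : V → Fin 2) (r : ℕ)
    (t : LTree V r) : rootedLik q M σ r (σ (root r t)) t = labelledLik q M σ r (σ (root r t)) t := by
  cases r <;> rfl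

lemma rootedLik_congr {V : Type} {q : ℝ} {M : Matrix (Fin 2) (Fin 2) ℝ} {σ τ : V → Fin 2} {r : ℕ}
    {x : Fin 2} {t : LTree V r} (hn : (verts r t).Nodup)
    (h : ∀ v ∈ verts r t, v ≠ root r t → σ v = τ v) :
    rootedLik q M σ r x t = rootedLik q M τ r x t := by
  cases r with
  | zero => rfl
  | succ r =>
    obtain ⟨v, l⟩ := t
    obtain ⟨h1, -, -⟩ := nodup_succ hn
    simp only [rootedLik]
    congr 1
    refine List.map_congr_left fun c hc => ?_
    have hsub : ∀ w ∈ verts r c, σ w = τ w := fun w hw =>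
      h w (mem_verts_succ.2 (Or.inr ⟨c, hc, hw⟩)) fun he => h1 c hc (by
        obtain rfl : w = v := he
        exact hw)
    rw [labelledLik_congr hsub, hsub _ (root_mem_verts r c)]

variable {V : Type} [Fintype V] [DecidableEq V] {p q : ℝ} {M : Matrix (Fin 2) (Fin 2) ℝ}

/-- Averaging the likelihood of a labelled tree over the labels of its vertices. -/
lemma labelExp_rootedLik (r : ℕ) (x : Fin 2) (t : LTree V r) (hn : (verts r t).Nodup) :
    labelExp p (fun σ => rootedLik q M σ r x t) = lik p q M r x (shape r t) := by
  induction r generalizing x with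
  | zero =>
    have := labelExp_const_mul (p := p) (V := V) (obs q x t.2) (fun _ => 1)
    rw [labelExp_one] at this
    simpa [rootedLik, lik, shape] using this
  | succ r ih =>
    obtain ⟨v, l⟩ := t
    obtain ⟨-, h2, h3⟩ := nodup_succ hn
    clear hn
    have hshape : shape (r + 1) ((v, l) : LTree V (r + 1)) = (l.map (shape r) : List (Shape r)) := rfl
    rw [hshape]
    simp only [rootedLik, lik]
    rw [List.map_map]
    induction l with
    | nil => simpa using labelExp_one p
    | cons c l ihl =>
      simp only [List.map_cons, List.prod_cons]
      -- The first subtree and the remaining ones have disjoint vertex sets, hence independent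
      -- factors.
      rw [labelExp_mul {w | w ∉ verts r c}]
      · rw [ihl (fun c hc => h2 c (List.mem_cons_of_mem _ hc)) (List.pairwise_cons.1 h3).2 rfl]
        congr 1
        have hnc := h2 c List.mem_cons_self
        have e1 : (fun σ : V → Fin 2 => M x (σ (root r c)) *
            labelledLik q M σ r (σ (root r c)) c) =
            fun σ => (fun σ y => M x y * rootedLik q M σ r y c) σ (σ (root r c)) := by
          funext σ
          simp only [rootedLik_root]
        rw [e1, labelExp_resample (root r c) (fun σ y => M x y * rootedLik q M σ r y c)]
        · refine Finset.sum_congr rfl fun y _ => ?_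
          rw [labelExp_const_mul, ih y c hnc]
        · intro y σ τ hst
          simp only [rootedLik_congr hnc fun w _ hw => hst w hw]
      · intro σ τ hst
        have hst' : ∀ w ∈ verts r c, σ w = τ w := fun w hw => hst w (by simpa using hw)
        rw [labelledLik_congr hst', hst' _ (root_mem_verts r c)]
      · intro σ τ hst
        congr 1
        refine List.map_congr_left fun c' hc' => ?_
        have hst' : ∀ w ∈ verts r c', σ w = τ w := fun w hw =>
          hst w fun hw' => (List.pairwise_cons.1 h3).1 c' hc' hw' hw
        rw [labelledLik_congr hst', hst' _ (root_mem_verts r c')]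

end TreeLikelihood

/-! ### From likelihoods of shapes to the branching law. -/

section LikTreeLaw

variable {p q d : ℝ} {K : Matrix (Fin 2) (Fin 2) ℝ}

/-- Each edge carries one factor of the matrix. For the graph, `s = 1 / n`, and this power is
compensated by the number of ways of naming the vertices. -/
lemma lik_smul (s : ℝ) (r : ℕ) (x : Fin 2) (l : Shape r) :
    lik p q (s • K) r x l = s ^ l.ec r * lik p q K r x l := by
  induction r generalizing x with
  | zero => simp [lik, Shape.ec]
  | succ r ih =>
    change List (Shape r) at l
    simp only [lik, Shape.ec]
    induction l with
    | nil => simp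
    | cons c l ihl =>
      simp only [List.map_cons, List.prod_cons, List.sum_cons]
      rw [ihl, pow_add, pow_add, pow_one]
      simp only [ih, Matrix.smul_apply, smul_eq_mul]
      have : ∑ y, prior p y * (s * K x y * (s ^ c.ec r * lik p q K r y c)) =
          s * s ^ c.ec r * ∑ y, prior p y * (K x y * lik p q K r y c) := by
        rw [Finset.mul_sum]
        exact Finset.sum_congr rfl fun y _ => by ring
      rw [this]
      ring

lemma lik_nonneg (hp0 : 0 ≤ p) (hp1 : p ≤ 1) (hq0 : 0 ≤ q) (hq1 : q ≤ 1)
    (hK : ∀ x y, 0 ≤ K x y) (r : ℕ) (x : Fin 2) (l : Shape r) : 0 ≤ lik p q K r x l := by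
  induction r generalizing x with
  | zero => exact obs_nonneg hq0 hq1 x l
  | succ r ih =>
    refine List.prod_nonneg ?_
    intro a ha
    obtain ⟨c, -, rfl⟩ := List.mem_map.1 ha
    exact Finset.sum_nonneg fun y _ =>
      mul_nonneg (prior_nonneg hp0 hp1 y) (mul_nonneg (hK x y) (ih y c))

lemma fact_pos (r : ℕ) (l : Shape r) : 0 < l.fact r := by
  induction r with
  | zero => simp [Shape.fact]
  | succ r ih =>
    refine Nat.mul_pos (Nat.factorial_pos _) (List.prod_pos fun a ha => ?_)
    obtain ⟨c, -, rfl⟩ := List.mem_map.1 ha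
    exact ih c

/-- Each vertex of depth less than `r` contributes `e^{-d}` and one over the factorial of its number
of children; `ic` counts the former and `fact` collects the latter. -/
lemma fact_mul_treeLaw (r : ℕ) (x : Fin 2) (l : Shape r) :
    (l.fact r : ℝ) * treeLaw p q d K r x l = Real.exp (-(d * l.ic r)) * lik p q K r x l := by
  induction r generalizing x with
  | zero => simp [Shape.fact, Shape.ic, treeLaw, lik]
  | succ r ih =>
    change List (Shape r) at l
    have key : ((l.map (Shape.fact r)).prod : ℝ) *
        (l.map fun c => ∑ y, prior p y * (K x y * treeLaw p q d K r y c)).prod =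
        Real.exp (-(d * ((l.map (Shape.ic r)).sum : ℕ))) *
          (l.map fun c => ∑ y, prior p y * (K x y * lik p q K r y c)).prod := by
      induction l with
      | nil => simp
      | cons c l ihl =>
        simp only [List.map_cons, List.prod_cons, List.sum_cons]
        have h1 : (c.fact r : ℝ) * ∑ y, prior p y * (K x y * treeLaw p q d K r y c) =
            Real.exp (-(d * c.ic r)) * ∑ y, prior p y * (K x y * lik p q K r y c) := by
          rw [Finset.mul_sum, Finset.mul_sum]
          refine Finset.sum_congr rfl fun y _ => ?_
          linear_combination prior p y * K x y * ih y c
        have h2 : Real.exp (-(d * ((c.ic r + (l.map (Shape.ic r)).sum : ℕ) : ℝ))) =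
            Real.exp (-(d * c.ic r)) * Real.exp (-(d * ((l.map (Shape.ic r)).sum : ℕ))) := by
          rw [← Real.exp_add]
          push_cast
          congr 1
          ring
        rw [h2]
        push_cast
        push_cast at ihl
        calc _ = ((c.fact r : ℝ) * ∑ y, prior p y * (K x y * treeLaw p q d K r y c)) *
            (((l.map (Shape.fact r)).prod : ℝ) *
            (l.map fun c => ∑ y, prior p y * (K x y * treeLaw p q d K r y c)).prod) := by
              push_cast; ring
          _ = _ := by
              push_cast
              rw [h1, ihl]; ring
    simp only [Shape.fact, Shape.ic, treeLaw, lik]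
    have h3 : Real.exp (-(d * ((1 + (l.map (Shape.ic r)).sum : ℕ) : ℝ))) =
        Real.exp (-d) * Real.exp (-(d * ((l.map (Shape.ic r)).sum : ℕ))) := by
      rw [← Real.exp_add]
      push_cast
      congr 1
      ring
    rw [h3, mul_assoc (Real.exp (-d)), ← key]
    have h4 : ((l.length.factorial : ℕ) : ℝ) ≠ 0 := by exact_mod_cast Nat.factorial_ne_zero _
    push_cast
    field_simp

end LikTreeLaw

/-! ### The law of the block model as a finite weighted sum. -/

open LTree

section Law

variable {n : ℕ}

/-- An outcome as a triple. -/
def sampleEquiv (n : ℕ) : Sample n ≃ (Fin n → Fin 2) × SimpleGraph (Fin n) × Set (Fin n) where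
  toFun ω := (ω.label, ω.graph, ω.revealed)
  invFun x := ⟨x.1, x.2.1, x.2.2⟩
  left_inv _ := rfl
  right_inv _ := rfl

noncomputable instance : Fintype (Sample n) := by
  classical exact Fintype.ofEquiv _ (sampleEquiv n).symm

/-- The pairs `i < j`. -/
def pairs (n : ℕ) : Finset (Fin n × Fin n) := Finset.univ.filter fun e => e.1 < e.2

open Classical in
/-- The probability of an outcome as a real number. -/
noncomputable def realWeight (M : Matrix (Fin 2) (Fin 2) ℝ) (p q : ℝ) (ω : Sample n) : ℝ :=
  (∏ i, prior p (ω.label i)) *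
  (∏ e ∈ pairs n,
    if ω.graph.Adj e.1 e.2 then M (ω.label e.1) (ω.label e.2)
    else 1 - M (ω.label e.1) (ω.label e.2)) *
  (∏ i, if i ∈ ω.revealed then q else 1 - q)

/-- Parameters for which the law is a probability measure. -/
structure Params (M : Matrix (Fin 2) (Fin 2) ℝ) (p q : ℝ) : Prop where
  p_pos : 0 < p
  p_lt : p < 1
  q_nonneg : 0 ≤ q
  q_le : q ≤ 1
  nonneg : ∀ x y, 0 ≤ M x y
  le_one : ∀ x y, M x y ≤ 1
  symm : ∀ x y, M x y = M y x

variable {M : Matrix (Fin 2) (Fin 2) ℝ} {p q : ℝ}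

lemma realWeight_nonneg (h : Params M p q) (ω : Sample n) : 0 ≤ realWeight M p q ω := by
  refine mul_nonneg (mul_nonneg ?_ ?_) ?_
  · exact Finset.prod_nonneg fun _ _ => prior_nonneg h.p_pos.le h.p_lt.le _
  · refine Finset.prod_nonneg fun e _ => ?_
    split_ifs
    · exact h.nonneg _ _
    · exact sub_nonneg.2 (h.le_one _ _)
  · refine Finset.prod_nonneg fun e _ => ?_
    split_ifs
    · exact h.q_nonneg
    · exact sub_nonneg.2 h.q_le

lemma weight_eq (h : Params M p q) (ω : Sample n) :
    weight M p q ω = ENNReal.ofReal (realWeight M p q ω) := by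
  classical
  have h1 : ∀ i : Fin n, 0 ≤ prior p (ω.label i) := fun _ => prior_nonneg h.p_pos.le h.p_lt.le _
  have h2 : ∀ e : Fin n × Fin n, 0 ≤ (if ω.graph.Adj e.1 e.2 then M (ω.label e.1) (ω.label e.2)
    else 1 - M (ω.label e.1) (ω.label e.2)) := by
    intro e
    split_ifs
    · exact h.nonneg _ _
    · exact sub_nonneg.2 (h.le_one _ _)
  have h3 : ∀ i : Fin n, 0 ≤ (if i ∈ ω.revealed then q else 1 - q) := by
    intro i
    split_ifs
    · exact h.q_nonneg
    · exact sub_nonneg.2 h.q_le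
  unfold realWeight weight pairs
  rw [ENNReal.ofReal_mul (mul_nonneg (Finset.prod_nonneg fun i _ => h1 i)
    (Finset.prod_nonneg fun e _ => h2 e)), ENNReal.ofReal_mul (Finset.prod_nonneg fun i _ => h1 i),
    ENNReal.ofReal_prod_of_nonneg fun i _ => h1 i, ENNReal.ofReal_prod_of_nonneg fun e _ => h2 e,
    ENNReal.ofReal_prod_of_nonneg fun i _ => h3 i]
  congr 1
  · congr 1
    refine Finset.prod_congr rfl fun e _ => ?_
    split_ifs <;> rfl
  · refine Finset.prod_congr rfl fun e _ => ?_
    split_ifs <;> rfl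

open Classical in
lemma law_apply (h : Params M p q) (S : Set (Sample n)) :
    law M p q n S = ENNReal.ofReal (∑ ω, if ω ∈ S then realWeight M p q ω else 0) := by
  rw [law, Measure.sum_apply _ (by trivial), tsum_fintype, ENNReal.ofReal_sum_of_nonneg]
  · refine Finset.sum_congr rfl fun ω _ => ?_
    rw [Measure.smul_apply, Measure.dirac_apply' _ (by trivial), weight_eq h, smul_eq_mul]
    by_cases hω : ω ∈ S <;> simp [hω]
  · intro ω _
    split_ifs
    · exact realWeight_nonneg h ω
    · exact le_rfl

open Classical in
lemma law_real (h : Params M p q) (S : Set (Sample n)) :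
    (law M p q n).real S = ∑ ω, if ω ∈ S then realWeight M p q ω else 0 := by
  rw [Measure.real, law_apply h, ENNReal.toReal_ofReal]
  refine Finset.sum_nonneg fun ω _ => ?_
  split_ifs
  · exact realWeight_nonneg h ω
  · exact le_rfl

-- A graph is a subset of the pairs `i < j`, so the sum is the expansion of a product of binomials.
open Classical in
lemma sum_graph (f g : Fin n × Fin n → ℝ) :
    ∑ G : SimpleGraph (Fin n), ∏ e ∈ pairs n, (if G.Adj e.1 e.2 then f e else g e) =
      ∏ e ∈ pairs n, (f e + g e) := by
  rw [Finset.prod_add]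
  refine Finset.sum_bij' (fun G _ => (pairs n).filter fun e => G.Adj e.1 e.2)
    (fun s _ => SimpleGraph.fromRel fun u v => (u, v) ∈ s) ?_ ?_ ?_ ?_ ?_
  · intro G _
    simp
  · intro s _; exact Finset.mem_univ _
  · intro G _
    ext u v
    simp only [SimpleGraph.fromRel_adj, Finset.mem_filter, pairs, Finset.mem_univ, true_and]
    constructor
    · rintro ⟨-, h | h⟩
      · exact h.2
      · exact h.2.symm
    · intro hadj
      refine ⟨hadj.ne, ?_⟩
      rcases lt_or_gt_of_ne hadj.ne with h | h
      · exact Or.inl ⟨h, hadj⟩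
      · exact Or.inr ⟨h, hadj.symm⟩
  · intro s hs
    have hs' := Finset.mem_powerset.1 hs
    ext ⟨u, v⟩
    simp only [SimpleGraph.fromRel_adj, Finset.mem_filter]
    constructor
    · rintro ⟨hp, -, h | h⟩
      · exact h
      · have h1 := hs' h
        simp only [pairs, Finset.mem_filter, Finset.mem_univ, true_and] at h1 hp
        exact absurd h1 hp.not_gt
    · intro h
      have h1 := hs' h
      refine ⟨h1, ?_, Or.inl h⟩
      simp only [pairs, Finset.mem_filter, Finset.mem_univ, true_and] at h1
      exact h1.ne
  · intro G _
    rw [Finset.prod_ite]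
    congr 2
    ext e
    simp only [Finset.mem_filter, Finset.mem_sdiff]
    tauto

open Classical in
lemma sum_revealed (f g : Fin n → ℝ) :
    ∑ R : Set (Fin n), ∏ i, (if i ∈ R then f i else g i) = ∏ i, (f i + g i) := by
  rw [Finset.prod_add]
  refine Finset.sum_bij' (fun R _ => Finset.univ.filter fun i => i ∈ R) (fun s _ => (s : Set (Fin n)))
    ?_ ?_ ?_ ?_ ?_
  · intro R _; simp
  · intro s _; exact Finset.mem_univ _
  · intro R _; ext i; simp
  · intro s _; ext i; simp
  · intro R _
    rw [Finset.prod_ite]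
    congr 2
    ext i; simp

/-- The sum over outcomes of a function that factorises given the labels. -/
lemma sum_sample (F : (Fin n → Fin 2) → ℝ) (f g : (Fin n → Fin 2) → Fin n × Fin n → ℝ)
    (s t : (Fin n → Fin 2) → Fin n → ℝ) (W : Sample n → ℝ)
    (hW : ∀ ω, W ω = by classical exact F ω.label *
      (∏ e ∈ pairs n, if ω.graph.Adj e.1 e.2 then f ω.label e else g ω.label e) *
      (∏ i, if i ∈ ω.revealed then s ω.label i else t ω.label i)) :
    ∑ ω, W ω = ∑ σ, F σ * (∏ e ∈ pairs n, (f σ e + g σ e)) * ∏ i, (s σ i + t σ i) := by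
  classical
  rw [← Equiv.sum_comp (sampleEquiv n).symm, Fintype.sum_prod_type]
  refine Finset.sum_congr rfl fun σ _ => ?_
  rw [Fintype.sum_prod_type]
  simp only [hW, sampleEquiv, Equiv.coe_fn_symm_mk]
  rw [← sum_graph, ← sum_revealed]
  simp only [← Finset.mul_sum]
  rw [← Finset.sum_mul, ← Finset.mul_sum]

/-- The law of a single label. -/
lemma law_real_label (h : Params M p q) (i : Fin n) (x : Fin 2) :
    (law M p q n).real {ω | ω.label i = x} = prior p x := by
  classical
  rw [law_real h, ← labelExp_ite_eq (p := p) i x, labelExp]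
  rw [sum_sample (fun σ => (∏ v, prior p (σ v)) * (if σ i = x then 1 else 0))
    (fun σ e => M (σ e.1) (σ e.2)) (fun σ e => 1 - M (σ e.1) (σ e.2)) (fun _ _ => q)
    (fun _ _ => 1 - q)]
  · simp
  · intro ω
    simp only [Set.mem_ofPred_eq, realWeight]
    split_ifs
    · ring
    · ring

instance : DiscreteMeasurableSpace (Sample n) := ⟨fun _ => trivial⟩

lemma isProbabilityMeasure_law (h : Params M p q) : IsProbabilityMeasure (law M p q n) := by
  classical
  constructor
  rw [law_apply h]
  have : ∑ ω : Sample n, (if ω ∈ Set.univ then realWeight M p q ω else 0) = 1 := by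
    rw [sum_sample (fun σ => (∏ v, prior p (σ v)) * 1)
      (fun σ e => M (σ e.1) (σ e.2)) (fun σ e => 1 - M (σ e.1) (σ e.2)) (fun _ _ => q)
      (fun _ _ => 1 - q)]
    · simpa [labelExp] using labelExp_one (V := Fin n) p
    · intro ω
      simp only [Set.mem_univ, if_true, realWeight, mul_one]
  rw [← ENNReal.ofReal_one, ← this]
  simp only [Set.mem_univ, if_true]

end Law

/-! ### Probability that a labelled tree is the neighbourhood of its root. -/

section RealizesProb

variable {n : ℕ} {M : Matrix (Fin 2) (Fin 2) ℝ} {p q : ℝ}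

lemma nodup_edges {V : Type} {r : ℕ} {t : LTree V r} (hn : (verts r t).Nodup) :
    (edges r t).Nodup :=
  List.Nodup.of_map _ (List.nodup_cons.1 hn).2

lemma nodup_leaves {V : Type} {r : ℕ} {t : LTree V r} (hn : (verts r t).Nodup) :
    (leaves r t).Nodup := by
  induction r with
  | zero => simp [leaves]
  | succ r ih =>
    obtain ⟨v, l⟩ := t
    obtain ⟨-, h2, h3⟩ := nodup_succ hn
    simp only [leaves]
    rw [List.nodup_flatMap]
    refine ⟨fun c hc => ih (h2 c hc), h3.imp fun {c c'} hd => ?_⟩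
    rintro ⟨x, o⟩ hx hx'
    exact hd (mem_verts_of_lev (mem_lev_last_iff.2 ⟨_, hx⟩))
      (mem_verts_of_lev (mem_lev_last_iff.2 ⟨_, hx'⟩))

/-- A product over unordered pairs of a symmetrised function dominates the product over all ordered
pairs. -/
lemma prod_univ_le_prod_pairs (k : Fin n × Fin n → ℝ) (h0 : ∀ e, 0 ≤ k e) (h1 : ∀ e, k e ≤ 1) :
    ∏ e, k e ≤ ∏ e ∈ pairs n, k e * k e.swap := by
  classical
  rw [Finset.prod_mul_distrib]
  have hswap : ∏ e ∈ pairs n, k e.swap = ∏ e ∈ Finset.univ.filter (fun e : Fin n × Fin n => e.2 < e.1),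
      k e := by
    refine Finset.prod_nbij' Prod.swap Prod.swap ?_ ?_ ?_ ?_ ?_ <;> simp [pairs]
  rw [hswap, ← Finset.prod_union]
  · rw [← Finset.prod_sdiff (Finset.subset_univ
      (pairs n ∪ Finset.univ.filter (fun e : Fin n × Fin n => e.2 < e.1)))]
    refine mul_le_of_le_one_left (Finset.prod_nonneg fun e _ => h0 e) ?_
    exact Finset.prod_le_one (fun e _ => h0 e) fun e _ => h1 e
  · rw [Finset.disjoint_left]
    rintro e he he'
    simp only [pairs, Finset.mem_filter, Finset.mem_univ, true_and] at he he'
    exact lt_asymm he he'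

/-- Pairs forced to be non-adjacent by a tree. -/
def NonEdge (r : ℕ) (t : LTree (Fin n) r) (u v : Fin n) : Prop :=
  ¬ ((u, v) ∈ edges r t ∨ (v, u) ∈ edges r t) ∧
    ((u ∈ verts r t ∧ v ∈ verts r t) ∨ (u ∈ inner r t ∧ v ∉ verts r t) ∨
      (v ∈ inner r t ∧ u ∉ verts r t))

/-- The event is implied by constraints on single pairs and single vertices, so its probability
given the labels can be bounded by a product. -/
lemma realizes_of_pairs {r : ℕ} {t : LTree (Fin n) r} (hn : (verts r t).Nodup) {ω : Sample n}
    (h1 : ∀ e ∈ pairs n, ω.graph.Adj e.1 e.2 → ¬ NonEdge r t e.1 e.2)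
    (h2 : ∀ e ∈ pairs n, ¬ ω.graph.Adj e.1 e.2 →
      ¬ ((e.1, e.2) ∈ edges r t ∨ (e.2, e.1) ∈ edges r t))
    (h3 : ∀ v o, (v, o) ∈ leaves r t →
      (o = none ∧ v ∉ ω.revealed) ∨ (o = some (ω.label v) ∧ v ∈ ω.revealed)) :
    Realizes r t ω := by
  have key : ∀ u v, u < v → (ω.graph.Adj u v → ¬ NonEdge r t u v) ∧
      (((u, v) ∈ edges r t ∨ (v, u) ∈ edges r t) → ω.graph.Adj u v) := by
    intro u v huv
    have hm : (u, v) ∈ pairs n := by simp [pairs, huv]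
    exact ⟨h1 _ hm, fun he => by_contra fun hna => h2 _ hm hna he⟩
  have hsymm : ∀ u v, NonEdge r t u v ↔ NonEdge r t v u := by
    intro u v
    unfold NonEdge
    tauto
  have key' : ∀ u v, u ≠ v → (ω.graph.Adj u v → ¬ NonEdge r t u v) ∧
      (((u, v) ∈ edges r t ∨ (v, u) ∈ edges r t) → ω.graph.Adj u v) := by
    intro u v huv
    rcases lt_or_gt_of_ne huv with h | h
    · exact key u v h
    · obtain ⟨a, b⟩ := key v u h
      refine ⟨fun hadj hne => a hadj.symm ((hsymm u v).1 hne), fun he => (b he.symm).symm⟩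
  refine ⟨fun u hu v hv => ?_, fun u hu v hv hadj => ?_, h3⟩
  · constructor
    · intro hadj
      by_contra he
      exact (key' u v hadj.ne).1 hadj ⟨he, Or.inl ⟨hu, hv⟩⟩
    · intro he
      refine (key' u v ?_).2 he
      rcases he with he | he
      · exact edges_ne hn he
      · exact (edges_ne hn he).symm
  · refine (key' u v hadj.ne).1 hadj ⟨?_, Or.inr (Or.inl ⟨hu, hv⟩)⟩
    rintro (he | he)
    · exact hv (snd_mem_verts he)
    · exact hv (fst_mem_verts he)

open Classical in
/-- Lower bound for the product of the pair factors. -/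
lemma prod_pairs_ge (h : Params M p q) {r : ℕ} {t : LTree (Fin n) r} (hn : (verts r t).Nodup)
    {η : ℝ} (hη : ∀ x y, M x y ≤ η) (hη1 : η ≤ 1) (σ : Fin n → Fin 2) :
    (1 - η) ^ ((edges r t).length + 1) ^ 2 *
      (((edges r t).map fun e => M (σ e.1) (σ e.2)).prod *
      ∏ v ∈ Finset.univ.filter (fun v => v ∉ verts r t),
        ∏ u ∈ (inner r t).toFinset, (1 - M (σ u) (σ v))) ≤
    ∏ e ∈ pairs n, ((if ¬ NonEdge r t e.1 e.2 then M (σ e.1) (σ e.2) else 0) +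
      (if ¬ ((e.1, e.2) ∈ edges r t ∨ (e.2, e.1) ∈ edges r t) then 1 - M (σ e.1) (σ e.2)
        else 0)) := by
  -- The three constraints are encoded on ordered pairs: tree edges, pairs inside the tree (the
  -- source of the exponent `(edges + 1)²`, diagonal included), and pairs joining an inner vertex to
  -- an outside vertex. All factors lie in `[0, 1]`, so overlaps and double counting only lower the
  -- product.
  set kE : Fin n × Fin n → ℝ := fun e =>
    if e ∈ (edges r t).toFinset then M (σ e.1) (σ e.2) else 1 with hkE
  set kI : Fin n × Fin n → ℝ := fun e =>
    if e ∈ (verts r t).toFinset ×ˢ (verts r t).toFinset then 1 - η else 1 with hkI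
  set kO : Fin n × Fin n → ℝ := fun e =>
    if e ∈ (inner r t).toFinset ×ˢ Finset.univ.filter (fun v => v ∉ verts r t)
      then 1 - M (σ e.1) (σ e.2) else 1 with hkO
  have hη0 : 0 ≤ η := (h.nonneg 0 0).trans (hη 0 0)
  have bE : ∀ e, 0 ≤ kE e ∧ kE e ≤ 1 := by
    intro e
    simp only [hkE]
    split_ifs
    · exact ⟨h.nonneg _ _, h.le_one _ _⟩
    · exact ⟨zero_le_one, le_rfl⟩
  have bI : ∀ e, 0 ≤ kI e ∧ kI e ≤ 1 := by
    intro e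
    simp only [hkI]
    split_ifs
    · exact ⟨by linarith, by linarith⟩
    · exact ⟨zero_le_one, le_rfl⟩
  have bO : ∀ e, 0 ≤ kO e ∧ kO e ≤ 1 := by
    intro e
    simp only [hkO]
    split_ifs
    · exact ⟨sub_nonneg.2 (h.le_one _ _), by linarith [h.nonneg (σ e.1) (σ e.2)]⟩
    · exact ⟨zero_le_one, le_rfl⟩
  set k : Fin n × Fin n → ℝ := fun e => kI e * (kE e * kO e) with hk
  have b0 : ∀ e, 0 ≤ k e := fun e => mul_nonneg (bI e).1 (mul_nonneg (bE e).1 (bO e).1)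
  have b1 : ∀ e, k e ≤ 1 := fun e => mul_le_one₀ (bI e).2 (mul_nonneg (bE e).1 (bO e).1)
    (mul_le_one₀ (bE e).2 (bO e).1 (bO e).2)
  have hprod : ∏ e, k e = (1 - η) ^ ((edges r t).length + 1) ^ 2 *
      (((edges r t).map fun e => M (σ e.1) (σ e.2)).prod *
      ∏ v ∈ Finset.univ.filter (fun v => v ∉ verts r t),
        ∏ u ∈ (inner r t).toFinset, (1 - M (σ u) (σ v))) := by
    simp only [hk, Finset.prod_mul_distrib]
    congr 1
    · simp only [hkI]
      rw [Finset.prod_ite_mem, Finset.univ_inter, Finset.prod_const, Finset.card_product,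
        List.toFinset_card_of_nodup hn]
      simp [verts, sq]
    · congr 1
      · simp only [hkE]
        rw [Finset.prod_ite_mem, Finset.univ_inter, List.prod_toFinset _ (nodup_edges hn)]
      · simp only [hkO]
        rw [Finset.prod_ite_mem, Finset.univ_inter, Finset.prod_product_right]
  rw [← hprod]
  refine (prod_univ_le_prod_pairs k b0 b1).trans ?_
  refine Finset.prod_le_prod (fun e _ => mul_nonneg (b0 _) (b0 _)) ?_
  rintro ⟨u, v⟩ -
  simp only [Prod.swap_prod_mk]
  have hM0 := h.nonneg (σ u) (σ v)
  have hM1 := h.le_one (σ u) (σ v)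
  have hMs := h.symm (σ v) (σ u)
  by_cases hE : (u, v) ∈ edges r t ∨ (v, u) ∈ edges r t
  · have hN : ¬ NonEdge r t u v := fun hN => hN.1 hE
    simp only [hN, hE, not_true, not_false_iff, if_true, if_false, add_zero]
    rcases hE with hE | hE
    · calc k (u, v) * k (v, u) ≤ kE (u, v) * 1 := by
            refine mul_le_mul ?_ (b1 _) (b0 _) (bE _).1
            exact (mul_le_of_le_one_left (mul_nonneg (bE _).1 (bO _).1) (bI _).2).trans
              (mul_le_of_le_one_right (bE _).1 (bO _).2)
        _ = M (σ u) (σ v) := by simp [hkE, hE]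
    · calc k (u, v) * k (v, u) ≤ 1 * kE (v, u) := by
            refine mul_le_mul (b1 _) ?_ (b0 _) zero_le_one
            exact (mul_le_of_le_one_left (mul_nonneg (bE _).1 (bO _).1) (bI _).2).trans
              (mul_le_of_le_one_right (bE _).1 (bO _).2)
        _ = M (σ u) (σ v) := by simp [hkE, hE, hMs]
  · by_cases hN : NonEdge r t u v
    · simp only [hN, hE, not_true, not_false_iff, if_true, if_false, zero_add]
      rcases hN.2 with ⟨hu, hv⟩ | ⟨hu, hv⟩ | ⟨hv, hu⟩
      · have e1 : kI (u, v) = 1 - η := by simp [hkI, hu, hv]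
        calc k (u, v) * k (v, u) ≤ kI (u, v) * 1 := by
              refine mul_le_mul ?_ (b1 _) (b0 _) (bI _).1
              exact mul_le_of_le_one_right (bI _).1 (mul_le_one₀ (bE _).2 (bO _).1 (bO _).2)
          _ ≤ 1 - M (σ u) (σ v) := by rw [e1]; linarith [hη (σ u) (σ v)]
      · have e1 : kO (u, v) = 1 - M (σ u) (σ v) := by simp [hkO, hu, hv]
        calc k (u, v) * k (v, u) ≤ kO (u, v) * 1 := by
              refine mul_le_mul ?_ (b1 _) (b0 _) (bO _).1
              exact (mul_le_of_le_one_left (mul_nonneg (bE _).1 (bO _).1) (bI _).2).trans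
                (mul_le_of_le_one_left (bO _).1 (bE _).2)
          _ = 1 - M (σ u) (σ v) := by rw [e1, mul_one]
      · have e1 : kO (v, u) = 1 - M (σ u) (σ v) := by simp [hkO, hu, hv, hMs]
        calc k (u, v) * k (v, u) ≤ 1 * kO (v, u) := by
              refine mul_le_mul (b1 _) ?_ (b0 _) zero_le_one
              exact (mul_le_of_le_one_left (mul_nonneg (bE _).1 (bO _).1) (bI _).2).trans
                (mul_le_of_le_one_left (bO _).1 (bE _).2)
          _ = 1 - M (σ u) (σ v) := by rw [e1, one_mul]
    · simp only [hN, hE, not_false_iff, if_true]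
      rw [add_sub_cancel]
      exact mul_le_one₀ (b1 _) (b0 _) (b1 _)

open Classical in
/-- The product of the observation factors. -/
lemma prod_revealed {r : ℕ} {t : LTree (Fin n) r} (hn : (verts r t).Nodup) (σ : Fin n → Fin 2) :
    ∏ i, ((if ∀ o, (i, o) ∈ leaves r t → o = some (σ i) then q else 0) +
      (if ∀ o, (i, o) ∈ leaves r t → o = none then 1 - q else 0)) =
    ((leaves r t).map fun e => obs q (σ e.1) e.2).prod := by
  rw [← List.prod_toFinset _ (nodup_leaves hn)]
  have hinj : Set.InjOn Prod.fst ((leaves r t).toFinset : Set (Fin n × Option (Fin 2))) := by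
    rintro ⟨x, o⟩ hx ⟨y, o'⟩ hy (rfl : x = y)
    exact congrArg _ (leaves_unique hn (by simpa using hx) (by simpa using hy))
  rw [← Finset.prod_subset (Finset.subset_univ ((leaves r t).toFinset.image Prod.fst)),
    Finset.prod_image hinj]
  · refine Finset.prod_congr rfl ?_
    rintro ⟨x, o⟩ hx
    have hx' : (x, o) ∈ leaves r t := by simpa using hx
    have hall : ∀ (o' : Option (Fin 2)), (∀ o, (x, o) ∈ leaves r t → o = o') ↔ o = o' := by
      intro o'
      constructor
      · intro hh; exact hh o hx'
      · rintro rfl o'' ho''; exact leaves_unique hn ho'' hx'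
    simp only [hall]
    cases o with
    | none => simp [obs]
    | some y => simp [obs]
  · intro i _ hi
    have : ∀ o, (i, o) ∉ leaves r t := by
      intro o ho
      exact hi (Finset.mem_image.2 ⟨(i, o), by simpa using ho, rfl⟩)
    simp [this]

/-- A union bound: it makes the bound for an outside vertex linear in the connection probabilities,
so that averaging its label uses only the common row average `δ`. -/
lemma one_sub_sum_le_prod_one_sub {ι : Type*} (s : Finset ι) (f : ι → ℝ) (h0 : ∀ i ∈ s, 0 ≤ f i)
    (h1 : ∀ i ∈ s, f i ≤ 1) : 1 - ∑ i ∈ s, f i ≤ ∏ i ∈ s, (1 - f i) := by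
  classical
  induction s using Finset.induction_on with
  | empty => simp
  | insert a s ha ih =>
    rw [Finset.sum_insert ha, Finset.prod_insert ha]
    have h2 := ih (fun i hi => h0 i (Finset.mem_insert_of_mem hi))
      (fun i hi => h1 i (Finset.mem_insert_of_mem hi))
    have h3 : ∏ i ∈ s, (1 - f i) ≤ 1 := Finset.prod_le_one
      (fun i hi => sub_nonneg.2 (h1 i (Finset.mem_insert_of_mem hi)))
      (fun i hi => by linarith [h0 i (Finset.mem_insert_of_mem hi)])
    nlinarith [h0 a (Finset.mem_insert_self a s)]

/-- Lower bound for the probability that a given labelled tree is the neighbourhood of its root. -/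
lemma law_real_realizes_ge (h : Params M p q) {r : ℕ} {t : LTree (Fin n) r}
    (hn : (verts r t).Nodup) {η δ : ℝ} (hη : ∀ x y, M x y ≤ η) (hη1 : η ≤ 1)
    (hrow : ∀ x, ∑ y, prior p y * M x y = δ) (hδ : δ * (shape r t).ic r ≤ 1) (x : Fin 2) :
    prior p x * ((1 - η) ^ ((shape r t).ec r + 1) ^ 2 * (1 - δ * (shape r t).ic r) ^ n *
      lik p q M r x (shape r t)) ≤
    (law M p q n).real {ω | ω.label (root r t) = x ∧ Realizes r t ω} := by
  classical
  have hp0 := h.p_pos.le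
  have hp1 := h.p_lt.le
  have hδ0 : 0 ≤ δ := by
    rw [← hrow 0]
    exact Finset.sum_nonneg fun y _ => mul_nonneg (prior_nonneg hp0 hp1 y) (h.nonneg _ _)
  set i := root r t
  -- the event contains a product event
  have step1 : ∑ σ : Fin n → Fin 2, ((∏ v, prior p (σ v)) * (if σ i = x then 1 else 0)) *
      (∏ e ∈ pairs n, ((if ¬ NonEdge r t e.1 e.2 then M (σ e.1) (σ e.2) else 0) +
        (if ¬ ((e.1, e.2) ∈ edges r t ∨ (e.2, e.1) ∈ edges r t) then 1 - M (σ e.1) (σ e.2)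
        else 0))) *
      ∏ i, ((if ∀ o, (i, o) ∈ leaves r t → o = some (σ i) then q else 0) +
        (if ∀ o, (i, o) ∈ leaves r t → o = none then 1 - q else 0)) ≤
      (law M p q n).real {ω | ω.label i = x ∧ Realizes r t ω} := by
    rw [law_real h, ← sum_sample (fun σ => (∏ v, prior p (σ v)) * (if σ i = x then 1 else 0))
      (fun σ e => if ¬ NonEdge r t e.1 e.2 then M (σ e.1) (σ e.2) else 0)
      (fun σ e => if ¬ ((e.1, e.2) ∈ edges r t ∨ (e.2, e.1) ∈ edges r t)
        then 1 - M (σ e.1) (σ e.2) else 0)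
      (fun σ i => if ∀ o, (i, o) ∈ leaves r t → o = some (σ i) then q else 0)
      (fun σ i => if ∀ o, (i, o) ∈ leaves r t → o = none then 1 - q else 0) _ (fun ω => rfl)]
    refine Finset.sum_le_sum fun ω _ => ?_
    by_cases hev : ω ∈ {ω : Sample n | ω.label i = x ∧ Realizes r t ω}
    · rw [if_pos hev]
      have hx : ω.label i = x := hev.1
      rw [if_pos hx, mul_one, realWeight]
      have hA : 0 ≤ ∏ v, prior p (ω.label v) := Finset.prod_nonneg fun _ _ => prior_nonneg hp0 hp1 _
      have hB : ∀ e : Fin n × Fin n, 0 ≤ (if ω.graph.Adj e.1 e.2 then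
          (if ¬ NonEdge r t e.1 e.2 then M (ω.label e.1) (ω.label e.2) else 0)
          else (if ¬ ((e.1, e.2) ∈ edges r t ∨ (e.2, e.1) ∈ edges r t)
          then 1 - M (ω.label e.1) (ω.label e.2) else 0)) := by
        intro e
        split_ifs
        · exact le_rfl
        · exact h.nonneg _ _
        · exact le_rfl
        · exact sub_nonneg.2 (h.le_one _ _)
      have hC : ∀ j : Fin n, 0 ≤ (if j ∈ ω.revealed then
          (if ∀ o, (j, o) ∈ leaves r t → o = some (ω.label j) then q else 0)
          else (if ∀ o, (j, o) ∈ leaves r t → o = none then 1 - q else 0)) := by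
        intro j
        split_ifs
        · exact h.q_nonneg
        · exact le_rfl
        · exact sub_nonneg.2 h.q_le
        · exact le_rfl
      refine mul_le_mul (mul_le_mul_of_nonneg_left ?_ hA) ?_ (Finset.prod_nonneg fun j _ => hC j) ?_
      · refine Finset.prod_le_prod (fun e _ => hB e) fun e _ => ?_
        split_ifs
        · exact h.nonneg _ _
        · exact le_rfl
        · exact sub_nonneg.2 (h.le_one _ _)
        · exact le_rfl
      · refine Finset.prod_le_prod (fun e _ => hC e) fun e _ => ?_
        split_ifs
        · exact le_rfl
        · exact h.q_nonneg
        · exact le_rfl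
        · exact sub_nonneg.2 h.q_le
      · refine mul_nonneg hA (Finset.prod_nonneg fun e _ => ?_)
        split_ifs
        · exact h.nonneg _ _
        · exact sub_nonneg.2 (h.le_one _ _)
    · rw [if_neg hev]
      by_cases hx : ω.label i = x
      -- A nonzero constrained weight would satisfy every pair and vertex constraint, hence
      -- `Realizes`.
      · have hnr : ¬ Realizes r t ω := fun hr => hev ⟨hx, hr⟩
        by_contra hcon
        have hne : (∏ v, prior p (ω.label v)) * (if ω.label i = x then 1 else 0) *
          (∏ e ∈ pairs n, if ω.graph.Adj e.1 e.2 then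
          (if ¬ NonEdge r t e.1 e.2 then M (ω.label e.1) (ω.label e.2) else 0)
          else (if ¬ ((e.1, e.2) ∈ edges r t ∨ (e.2, e.1) ∈ edges r t)
          then 1 - M (ω.label e.1) (ω.label e.2) else 0)) *
          (∏ j, if j ∈ ω.revealed then
          (if ∀ o, (j, o) ∈ leaves r t → o = some (ω.label j) then q else 0)
          else (if ∀ o, (j, o) ∈ leaves r t → o = none then 1 - q else 0)) ≠ 0 :=
          fun h0 => hcon h0.le
        have hne1 := Finset.prod_ne_zero_iff.1 (mul_ne_zero_iff.1 (mul_ne_zero_iff.1 hne).1).2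
        have hne2 := Finset.prod_ne_zero_iff.1 (mul_ne_zero_iff.1 hne).2
        refine hnr (realizes_of_pairs hn (fun e he hadj => ?_) (fun e he hadj => ?_)
          fun v o hvo => ?_)
        · intro hN
          have := hne1 e he
          rw [if_pos hadj, if_neg (not_not.2 hN)] at this
          exact this rfl
        · intro hN
          have := hne1 e he
          rw [if_neg hadj, if_neg (not_not.2 hN)] at this
          exact this rfl
        · have := hne2 v (Finset.mem_univ v)
          by_cases hv : v ∈ ω.revealed
          · rw [if_pos hv] at this
            right
            refine ⟨?_, hv⟩
            by_contra hno
            rw [if_neg fun hall => hno (hall o hvo)] at this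
            exact this rfl
          · rw [if_neg hv] at this
            left
            refine ⟨?_, hv⟩
            by_contra hno
            rw [if_neg fun hall => hno (hall o hvo)] at this
            exact this rfl
      · rw [if_neg hx]
        simp
  refine le_trans ?_ step1
  set O : Finset (Fin n) := Finset.univ.filter (fun v => v ∉ verts r t) with hO
  set F : (Fin n → Fin 2) → ℝ := fun σ => (if σ i = x then 1 else 0) * rootedLik q M σ r x t with hF
  set H : (Fin n → Fin 2) → Fin 2 → ℝ := fun σ y => ∏ u ∈ (inner r t).toFinset, (1 - M (σ u) y)
    with hH
  have hη1' : 0 ≤ 1 - η := by linarith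
  have hθ0 : 0 ≤ 1 - δ * (shape r t).ic r := by linarith
  have hrl : ∀ σ : Fin n → Fin 2, 0 ≤ rootedLik q M σ r x t := by
    intro σ
    cases r with
    | zero => exact obs_nonneg h.q_nonneg h.q_le _ _
    | succ r =>
      refine List.prod_nonneg fun a ha => ?_
      obtain ⟨c, -, rfl⟩ := List.mem_map.1 ha
      exact mul_nonneg (h.nonneg _ _) (labelledLik_nonneg h.q_nonneg h.q_le h.nonneg _ _ _ _)
  have hF0 : ∀ σ, 0 ≤ F σ := fun σ => mul_nonneg (by split_ifs <;> norm_num) (hrl σ)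
  have hH0 : ∀ σ y, 0 ≤ H σ y := fun σ y =>
    Finset.prod_nonneg fun u _ => sub_nonneg.2 (h.le_one _ _)
  have hmemO : ∀ v, v ∈ verts r t → v ∉ O := fun v hv => by simp [hO, hv]
  -- Each outside vertex, once its label is averaged, avoids all inner vertices with probability at
  -- least `1 - δ * ic`, whatever the classes of the inner vertices.
  have step2 : (1 - δ * (shape r t).ic r) ^ O.card * labelExp p F ≤
      labelExp p (fun σ => F σ * ∏ v ∈ O, H σ (σ v)) := by
    refine labelExp_prod_ge hp0 hp1 O hF0 (fun σ τ hst => ?_) hH0 (fun y σ τ hst => ?_) hθ0 fun σ => ?_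
    · simp only [hF]
      rw [hst i (hmemO _ (root_mem_verts r t)), rootedLik_congr hn fun v hv _ => hst v (hmemO v hv)]
    · refine Finset.prod_congr rfl fun u hu => ?_
      rw [hst u (hmemO u (inner_subset (List.mem_toFinset.1 hu)))]
    · calc 1 - δ * (shape r t).ic r ≤ 1 - δ * (inner r t).toFinset.card := by
            have h1 : (inner r t).toFinset.card ≤ (shape r t).ic r := by
              rw [← length_inner]; exact List.toFinset_card_le _
            have h2 : ((inner r t).toFinset.card : ℝ) ≤ (shape r t).ic r := by exact_mod_cast h1
            have := mul_le_mul_of_nonneg_left h2 hδ0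
            linarith
        _ = ∑ y, prior p y * (1 - ∑ u ∈ (inner r t).toFinset, M (σ u) y) := by
            simp only [mul_sub, mul_one, Finset.sum_sub_distrib, sum_prior, Finset.mul_sum]
            rw [Finset.sum_comm]
            simp only [hrow, Finset.sum_const, nsmul_eq_mul]
            ring
        _ ≤ ∑ y, prior p y * H σ y := by
            refine Finset.sum_le_sum fun y _ => mul_le_mul_of_nonneg_left ?_
              (prior_nonneg hp0 hp1 y)
            exact one_sub_sum_le_prod_one_sub _ _ (fun u _ => h.nonneg _ _)
              (fun u _ => h.le_one _ _)
  have hFexp : labelExp p F = prior p x * lik p q M r x (shape r t) := by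
    -- `rootedLik` does not read the label of the root, so it is independent of the event fixing
    -- that label.
    rw [hF, labelExp_mul {v | v ≠ i} (F := fun σ => if σ i = x then 1 else 0)
      (G := fun σ => rootedLik q M σ r x t)]
    · rw [labelExp_ite_eq, labelExp_rootedLik r x t hn]
    · intro σ τ hst
      rw [hst i (by simp)]
    · intro σ τ hst
      exact rootedLik_congr hn fun v _ hv => hst v hv
  have hcard : (1 - δ * (shape r t).ic r) ^ n ≤ (1 - δ * (shape r t).ic r) ^ O.card := by
    refine pow_le_pow_of_le_one hθ0 ?_ ?_
    · have : 0 ≤ δ * (shape r t).ic r := mul_nonneg hδ0 (Nat.cast_nonneg _)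
      linarith
    · simpa using Finset.card_le_univ O
  have hFn : 0 ≤ labelExp p F := by
    rw [hFexp]
    exact mul_nonneg (prior_nonneg hp0 hp1 x)
      (lik_nonneg hp0 hp1 h.q_nonneg h.q_le h.nonneg _ _ _)
  calc prior p x * ((1 - η) ^ ((shape r t).ec r + 1) ^ 2 * (1 - δ * (shape r t).ic r) ^ n *
        lik p q M r x (shape r t))
      = (1 - η) ^ ((shape r t).ec r + 1) ^ 2 *
        ((1 - δ * (shape r t).ic r) ^ n * labelExp p F) := by rw [hFexp]; ring
    _ ≤ (1 - η) ^ ((shape r t).ec r + 1) ^ 2 *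
        labelExp p (fun σ => F σ * ∏ v ∈ O, H σ (σ v)) := by
        refine mul_le_mul_of_nonneg_left ?_ (pow_nonneg hη1' _)
        exact (mul_le_mul_of_nonneg_right hcard hFn).trans step2
    _ = labelExp p (fun σ => (1 - η) ^ ((shape r t).ec r + 1) ^ 2 *
        (F σ * ∏ v ∈ O, H σ (σ v))) := (labelExp_const_mul _ _).symm
    _ ≤ _ := by
        refine Finset.sum_le_sum fun σ _ => ?_
        rw [prod_revealed hn, mul_assoc, mul_assoc]
        beta_reduce
        refine mul_le_mul_of_nonneg_left ?_ (Finset.prod_nonneg fun _ _ => prior_nonneg hp0 hp1 _)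
        by_cases hx : σ i = x
        · have e1 : F σ = ((edges r t).map fun e => M (σ e.1) (σ e.2)).prod *
              ((leaves r t).map fun e => obs q (σ e.1) e.2).prod := by
            rw [prod_edges_mul_prod_leaves, ← rootedLik_root]
            simp only [hF]
            rw [if_pos hx, one_mul, show root r t = i from rfl, hx]
          rw [e1, if_pos hx, one_mul]
          have hl : 0 ≤ ((leaves r t).map fun e => obs q (σ e.1) e.2).prod := by
            refine List.prod_nonneg fun a ha => ?_
            obtain ⟨c, -, rfl⟩ := List.mem_map.1 ha
            exact obs_nonneg h.q_nonneg h.q_le _ _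
          refine le_trans (le_of_eq ?_) (mul_le_mul_of_nonneg_right
            (prod_pairs_ge h hn hη hη1 σ) hl)
          rw [length_edges]
          ring
        · simp only [hF, if_neg hx, zero_mul, mul_zero, le_refl]

end RealizesProb

/-! ### The local test as a likelihood ratio test. -/

open LTree

section Test

variable {n : ℕ} {M : Matrix (Fin 2) (Fin 2) ℝ} {p q : ℝ}

/-- A view as a triple. -/
def viewEquiv (n : ℕ) : View n ≃ Set (Fin n) × SimpleGraph (Fin n) × (Fin n → Option (Fin 2)) where
  toFun V := (V.verts, V.edges, V.labels)
  invFun x := ⟨x.1, x.2.1, x.2.2⟩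
  left_inv _ := rfl
  right_inv _ := rfl

noncomputable instance : Fintype (View n) := by
  classical exact Fintype.ofEquiv _ (viewEquiv n).symm

/-- The law of the depth-`r` view from `i` given the class of `i`. -/
noncomputable def viewLaw (M : Matrix (Fin 2) (Fin 2) ℝ) (p q : ℝ) (i : Fin n) (r : ℕ) (x : Fin 2)
    (V : View n) : ℝ :=
  (law M p q n).real {ω | ω.label i = x ∧ view i r ω = V} / prior p x

lemma prior_pos (h : Params M p q) (x : Fin 2) : 0 < prior p x := by
  have h0 := h.p_pos
  have h1 := h.p_lt
  fin_cases x
  · exact h0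
  · exact sub_pos.2 h1

lemma viewLaw_nonneg (h : Params M p q) (i : Fin n) (r : ℕ) (x : Fin 2) (V : View n) :
    0 ≤ viewLaw M p q i r x V :=
  div_nonneg measureReal_nonneg (prior_pos h x).le

lemma real_eq_sum_views (P : Measure (Sample n)) [IsFiniteMeasure P] (i : Fin n) (r : ℕ)
    (S : Set (Sample n)) : P.real S = ∑ V, P.real (S ∩ {ω | view i r ω = V}) := by
  have h := sum_measureReal_preimage_singleton (μ := P.restrict S) (f := view i r) Finset.univ
    (fun _ _ => MeasurableSet.of_discrete)
  rw [Finset.coe_univ, Set.preimage_univ, measureReal_restrict_apply MeasurableSet.of_discrete,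
    Set.univ_inter] at h
  rw [← h]
  refine Finset.sum_congr rfl fun V _ => ?_
  rw [measureReal_restrict_apply MeasurableSet.of_discrete, Set.inter_comm]
  rfl

lemma sum_viewLaw (h : Params M p q) (i : Fin n) (r : ℕ) (x : Fin 2) :
    ∑ V, viewLaw M p q i r x V = 1 := by
  have := isProbabilityMeasure_law (n := n) h
  have h1 := real_eq_sum_views (law M p q n) i r {ω | ω.label i = x}
  rw [law_real_label h] at h1
  simp only [viewLaw]
  rw [← Finset.sum_div, div_eq_one_iff_eq (prior_pos h x).ne', h1]
  rfl

/-- Dividing the posterior odds by the prior odds gives the likelihood ratio, so the threshold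
selects the class under which the view is more likely. Excluding `0 / 0` keeps the equivalence valid
at infinite log-ratios. -/
lemma log_le_log_div_iff (hp0 : 0 < p) (hp1 : p < 1) {c₀ c₁ : ENNReal} (h0 : c₀ ≠ ⊤) (h1 : c₁ ≠ ⊤)
    (h : c₁ ≠ 0 ∨ c₀ ≠ 0) :
    ((Real.log (p / (1 - p)) : ℝ) : EReal) ≤ ENNReal.log (c₀ / c₁) ↔
      c₁.toReal / (1 - p) ≤ c₀.toReal / p := by
  have hp1' : 0 < 1 - p := sub_pos.2 hp1
  rw [← ENNReal.log_ofReal_of_pos (div_pos hp0 hp1'), ENNReal.log_le_log_iff,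
    ENNReal.le_div_iff_mul_le h (Or.inl h1), ← ENNReal.toReal_le_toReal
    (ENNReal.mul_ne_top ENNReal.ofReal_ne_top h1) h0, ENNReal.toReal_mul,
    ENNReal.toReal_ofReal (div_pos hp0 hp1').le, div_le_div_iff₀ hp1' hp0, div_mul_eq_mul_div,
    div_le_iff₀ hp1', mul_comm p]

lemma real_cond (P : Measure (Sample n)) [IsFiniteMeasure P] (S T : Set (Sample n)) :
    (cond P S).real T = P.real (S ∩ T) / P.real S := by
  rw [Measure.real, cond_apply MeasurableSet.of_discrete, ENNReal.toReal_mul, ENNReal.toReal_inv,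
    inv_mul_eq_div]
  rfl

open Classical in
/-- The decision of the local test, as a function of the view. -/
noncomputable def decision (M : Matrix (Fin 2) (Fin 2) ℝ) (p q : ℝ) (i : Fin n) (r : ℕ)
    (V : View n) : Fin 2 :=
  if ((Real.log (p / (1 - p)) : ℝ) : EReal) ≤
    ENNReal.log (cond (law M p q n) {ω | view i r ω = V} {ω | ω.label i = 0} /
      cond (law M p q n) {ω | view i r ω = V} {ω | ω.label i = 1}) then 0 else 1

lemma localTest_eq (M : Matrix (Fin 2) (Fin 2) ℝ) (p q : ℝ) (i : Fin n) (r : ℕ) (ω : Sample n) :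
    localTest (law M p q n) p r i ω = decision M p q i r (view i r ω) := rfl

lemma decision_spec (h : Params M p q) (i : Fin n) (r : ℕ) (V : View n) :
    (decision M p q i r V = 0 ∧ viewLaw M p q i r 1 V ≤ viewLaw M p q i r 0 V) ∨
      (decision M p q i r V = 1 ∧ viewLaw M p q i r 0 V ≤ viewLaw M p q i r 1 V) := by
  have := isProbabilityMeasure_law (n := n) h
  set P := law M p q n with hP
  set A : Set (Sample n) := {ω | view i r ω = V} with hA
  have e : ∀ x, P.real {ω | ω.label i = x ∧ view i r ω = V} = P.real (A ∩ {ω | ω.label i = x}) := by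
    intro x
    congr 1
    ext ω
    exact and_comm
  have hx : ∀ x, viewLaw M p q i r x V = P.real (A ∩ {ω | ω.label i = x}) / prior p x := by
    intro x
    rw [viewLaw, ← hP, e]
  have hxc : ∀ x, viewLaw M p q i r x V = P.real A * ((cond P A {ω | ω.label i = x}).toReal / prior p x) := by
    intro x
    have hc := real_cond P A {ω | ω.label i = x}
    rw [Measure.real] at hc
    rw [hc, hx]
    by_cases h0 : P.real A = 0
    · have : P.real (A ∩ {ω | ω.label i = x}) = 0 :=
        le_antisymm (h0 ▸ measureReal_mono Set.inter_subset_left) measureReal_nonneg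
      rw [this, h0]; simp
    · field_simp
  -- On a view of probability zero both likelihoods vanish and either decision is optimal.
  by_cases h0 : P A = 0
  · have h00 : P.real A = 0 := by rw [Measure.real, h0]; rfl
    have hz : ∀ x, viewLaw M p q i r x V = 0 := fun x => by rw [hxc, h00, zero_mul]
    rw [hz, hz]
    unfold decision
    split_ifs
    · exact Or.inl ⟨rfl, le_rfl⟩
    · exact Or.inr ⟨rfl, le_rfl⟩
  · have := cond_isProbabilityMeasure h0
    have hne : cond P A {ω | ω.label i = 1} ≠ 0 ∨ cond P A {ω | ω.label i = 0} ≠ 0 := by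
      by_contra hcon
      push Not at hcon
      have hu : (Set.univ : Set (Sample n)) ⊆ {ω | ω.label i = 1} ∪ {ω | ω.label i = 0} := by
        intro ω _
        rcases Fin.exists_fin_two.1 ⟨ω.label i, rfl⟩ with h | h
        · exact Or.inr h
        · exact Or.inl h
      have := (measure_mono hu).trans (measure_union_le (μ := cond P A) _ _)
      rw [hcon.1, hcon.2, measure_univ] at this
      simp at this
    have key := log_le_log_div_iff h.p_pos h.p_lt (measure_ne_top _ _) (measure_ne_top _ _) hne
    rw [hxc, hxc]
    unfold decision
    split_ifs with hd
    · exact Or.inl ⟨rfl, mul_le_mul_of_nonneg_left (key.1 hd) measureReal_nonneg⟩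
    · refine Or.inr ⟨rfl, mul_le_mul_of_nonneg_left ?_ measureReal_nonneg⟩
      exact (not_le.1 fun hle => hd (key.2 hle)).le

lemma cond_localTest (h : Params M p q) (i : Fin n) (r : ℕ) (x y : Fin 2) :
    (cond (law M p q n) {ω | ω.label i = x}).real {ω | localTest (law M p q n) p r i ω = y} =
      ∑ V, if decision M p q i r V = y then viewLaw M p q i r x V else 0 := by
  have := isProbabilityMeasure_law (n := n) h
  rw [real_cond, law_real_label h, real_eq_sum_views _ i r, Finset.sum_div]
  refine Finset.sum_congr rfl fun V _ => ?_
  split_ifs with hd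
  · rw [viewLaw]
    congr 2
    ext ω
    simp only [Set.mem_inter_iff, Set.mem_ofPred_eq, localTest_eq]
    constructor
    · rintro ⟨⟨h1, -⟩, h2⟩; exact ⟨h1, h2⟩
    · rintro ⟨h1, h2⟩; exact ⟨⟨h1, h2 ▸ hd⟩, h2⟩
  · have : {ω : Sample n | ω.label i = x} ∩ {ω | localTest (law M p q n) p r i ω = y} ∩
        {ω | view i r ω = V} = ∅ := by
      ext ω
      simp only [Set.mem_inter_iff, Set.mem_ofPred_eq, localTest_eq, Set.mem_empty_iff_false, iff_false]
      rintro ⟨⟨-, h1⟩, h2⟩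
      exact hd (h2 ▸ h1)
    rw [this, measureReal_empty, zero_div]

/-- The local test is the likelihood ratio test, with total variation success. -/
lemma success_term (h : Params M p q) (i : Fin n) (r : ℕ) :
    (cond (law M p q n) {ω | ω.label i = 0}).real {ω | localTest (law M p q n) p r i ω = 0} +
      (cond (law M p q n) {ω | ω.label i = 1}).real {ω | localTest (law M p q n) p r i ω = 1} - 1 =
      ∑ V, max (viewLaw M p q i r 0 V) (viewLaw M p q i r 1 V) - 1 := by
  rw [cond_localTest h, cond_localTest h, ← Finset.sum_add_distrib]
  congr 1
  refine Finset.sum_congr rfl fun V _ => ?_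
  rcases decision_spec h i r V with ⟨hd, hle⟩ | ⟨hd, hle⟩
  · simp [hd, hle]
  · simp [hd, hle]

/-- Through this identity a lower bound for the minima is an upper bound for the maxima. -/
lemma sum_max_add_sum_min (h : Params M p q) (i : Fin n) (r : ℕ) :
    ∑ V, max (viewLaw M p q i r 0 V) (viewLaw M p q i r 1 V) +
      ∑ V, min (viewLaw M p q i r 0 V) (viewLaw M p q i r 1 V) = 2 := by
  rw [← Finset.sum_add_distrib]
  simp only [max_add_min]
  rw [Finset.sum_add_distrib, sum_viewLaw h, sum_viewLaw h]
  norm_num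

end Test

/-! ### Comparison of views with shapes. -/

section Compare

variable {n : ℕ} {M : Matrix (Fin 2) (Fin 2) ℝ} {p q : ℝ}

/-- Lower bound for the probability of a tree of shape `l` around a vertex of class `x`, summed over
the trees of shape `l`. -/
noncomputable def shapeMass (M : Matrix (Fin 2) (Fin 2) ℝ) (p q η δ : ℝ) (n r : ℕ) (x : Fin 2)
    (l : Shape r) : ℝ :=
  ((n - 1).descFactorial (l.ec r) : ℝ) / l.fact r *
    ((1 - η) ^ (l.ec r + 1) ^ 2 * (1 - δ * l.ic r) ^ n * lik p q M r x l)

lemma le_viewLaw (h : Params M p q) {r : ℕ} {t : LTree (Fin n) r}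
    (hn : (verts r t).Nodup) {η δ : ℝ} (hη : ∀ x y, M x y ≤ η) (hη1 : η ≤ 1)
    (hrow : ∀ x, ∑ y, prior p y * M x y = δ) (hδ : δ * (shape r t).ic r ≤ 1) (x : Fin 2) :
    (1 - η) ^ ((shape r t).ec r + 1) ^ 2 * (1 - δ * (shape r t).ic r) ^ n *
      lik p q M r x (shape r t) ≤ viewLaw M p q (root r t) r x (treeView r t) := by
  have := isProbabilityMeasure_law (n := n) h
  rw [viewLaw, le_div_iff₀ (prior_pos h x), mul_comm]
  refine (law_real_realizes_ge h hn hη hη1 hrow hδ x).trans (measureReal_mono ?_)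
  rintro ω ⟨h1, h2⟩
  exact ⟨h1, view_eq_treeView hn h2⟩

-- Every labelled tree with view `V` explores the graph of `V` from `i`, so the exploration count
-- applies.
open Classical in
lemma sum_inv_fact_le_one {r : ℕ} (i : Fin n) (T : Finset (LTree (Fin n) r))
    (hT : ∀ t ∈ T, root r t = i ∧ (verts r t).Nodup) (V : View n) :
    ∑ t ∈ T with treeView r t = V, (((shape r t).fact r : ℕ) : ℝ)⁻¹ ≤ 1 := by
  have h1 := (ENNReal.sum_le_tsum (T.filter fun t => treeView r t = V)).trans
    (tsum_inv_fact_le_one V.edges V.labels r none i)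
  replace h1 : ∑ t ∈ T with treeView r t = V, (((shape r t).fact r : ℕ) : ENNReal)⁻¹ ≤ 1 := by
    refine le_trans (Finset.sum_le_sum fun t ht => ?_) h1
    obtain ⟨ht1, rfl⟩ := Finset.mem_filter.1 ht
    rw [if_pos (hT t ht1).1, if_pos (expl_treeView (hT t ht1).2)]
  have h3 := ENNReal.toReal_mono ENNReal.one_ne_top h1
  rw [ENNReal.toReal_sum] at h3
  · simpa using h3
  · intro t _
    simp [(fact_pos r (shape r t)).ne']

/-- Comparison of the views with the shapes, for a monotone homogeneous function. -/
lemma sum_shapeMass_le (h : Params M p q) {η δ : ℝ} (hη : ∀ x y, M x y ≤ η) (hη1 : η ≤ 1)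
    (hrow : ∀ x, ∑ y, prior p y * M x y = δ) (i : Fin n) (r : ℕ) (f : ℝ → ℝ → ℝ)
    (hmono : ∀ {a a' b b'}, a ≤ a' → b ≤ b' → f a b ≤ f a' b')
    (hsmul : ∀ {c a b}, 0 ≤ c → f (c * a) (c * b) = c * f a b)
    (hnonneg : ∀ {a b}, 0 ≤ a → 0 ≤ b → 0 ≤ f a b)
    (LL : Finset (Shape r)) (hδ : ∀ l ∈ LL, δ * l.ic r ≤ 1) :
    ∑ l ∈ LL, f (shapeMass M p q η δ n r 0 l) (shapeMass M p q η δ n r 1 l) ≤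
      ∑ V, f (viewLaw M p q i r 0 V) (viewLaw M p q i r 1 V) := by
  classical
  choose S hcard hS using exists_finset_nodup n r i
  set g : View n → ℝ := fun V => f (viewLaw M p q i r 0 V) (viewLaw M p q i r 1 V) with hg
  have hg0 : ∀ V, 0 ≤ g V := fun V => hnonneg (viewLaw_nonneg h _ _ _ _) (viewLaw_nonneg h _ _ _ _)
  set T := LL.biUnion S with hT
  -- A labelled tree determines its shape, so different shapes use different trees.
  have hdisj : (LL : Set (Shape r)).PairwiseDisjoint S := by
    intro l _ l' _ hll'
    refine Finset.disjoint_left.2 fun t ht ht' => hll' ?_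
    rw [← (hS l t ht).1, (hS l' t ht').1]
  calc ∑ l ∈ LL, f (shapeMass M p q η δ n r 0 l) (shapeMass M p q η δ n r 1 l)
      ≤ ∑ l ∈ LL, ∑ t ∈ S l, (((shape r t).fact r : ℕ) : ℝ)⁻¹ * g (treeView r t) := by
        refine Finset.sum_le_sum fun l hl => ?_
        simp only [shapeMass]
        rw [hsmul (by positivity), ← hcard l, div_eq_mul_inv, mul_assoc, ← nsmul_eq_mul]
        refine Finset.card_nsmul_le_sum _ _ _ fun t ht => ?_
        obtain ⟨h1, h2, h3⟩ := hS l t ht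
        rw [h1]
        refine mul_le_mul_of_nonneg_left ?_ (by positivity)
        have hle := le_viewLaw h h3 hη hη1 hrow (by rw [h1]; exact hδ l hl)
        rw [h1, h2] at hle
        exact hmono (hle 0) (hle 1)
    _ = ∑ t ∈ T, (((shape r t).fact r : ℕ) : ℝ)⁻¹ * g (treeView r t) :=
        (Finset.sum_biUnion hdisj).symm
    _ = ∑ V, ∑ t ∈ T with treeView r t = V,
          (((shape r t).fact r : ℕ) : ℝ)⁻¹ * g (treeView r t) := (Finset.sum_fiberwise _ _ _).symm
    _ = ∑ V, (∑ t ∈ T with treeView r t = V, (((shape r t).fact r : ℕ) : ℝ)⁻¹) * g V := by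
        refine Finset.sum_congr rfl fun V _ => ?_
        rw [Finset.sum_mul]
        exact Finset.sum_congr rfl fun t ht => by rw [(Finset.mem_filter.1 ht).2]
    _ ≤ ∑ V, g V := by
        refine Finset.sum_le_sum fun V _ => mul_le_of_le_one_left (hg0 V) ?_
        refine sum_inv_fact_le_one i T (fun t ht => ?_) V
        obtain ⟨l, -, ht⟩ := Finset.mem_biUnion.1 ht
        exact (hS l t ht).2

end Compare

/-! ### The limit in the number of vertices. -/

section Limit

variable {p q d : ℝ} {K : Matrix (Fin 2) (Fin 2) ℝ}

lemma tendsto_descFactorial_div_pow (k : ℕ) :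
    Tendsto (fun n : ℕ => ((n - 1).descFactorial k : ℝ) * (1 / (n : ℝ)) ^ k) atTop (𝓝 1) := by
  have h1 : ∀ i ∈ Finset.range k,
      Tendsto (fun n : ℕ => ((n - 1 - i : ℕ) : ℝ) * (1 / (n : ℝ))) atTop (𝓝 1) := by
    intro i _
    have h2 : Tendsto (fun n : ℕ => 1 - (1 + i : ℝ) / n) atTop (𝓝 (1 - 0)) :=
      tendsto_const_nhds.sub (tendsto_const_div_atTop_nhds_zero_nat _)
    rw [sub_zero] at h2
    refine h2.congr' ?_
    filter_upwards [eventually_ge_atTop (1 + i)] with n hn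
    have hn0 : (n : ℝ) ≠ 0 := by
      have : 0 < n := by omega
      positivity
    rw [Nat.sub_sub, Nat.cast_sub hn]
    push_cast
    field_simp
  have h3 := tendsto_finsetProd _ h1
  rw [Finset.prod_const_one] at h3
  refine h3.congr fun n => ?_
  rw [Finset.prod_mul_distrib, Finset.prod_const, Finset.card_range, Nat.descFactorial_eq_prod_range]
  push_cast
  rfl

/-- The number of labellings cancels the power of `1 / n` from the edges, the non-edges inside the
tree are finitely many and cost nothing in the limit, and the non-edges to the outside give `exp
(-(d * ic))`. -/
lemma tendsto_shapeMass (C : ℝ) (r : ℕ) (x : Fin 2) (l : Shape r) :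
    Tendsto (fun n : ℕ => shapeMass ((1 / (n : ℝ)) • K) p q (C / n) (d / n) n r x l) atTop
      (𝓝 (treeLaw p q d K r x l)) := by
  have hf : (l.fact r : ℝ) ≠ 0 := by exact_mod_cast (fact_pos r l).ne'
  have e : treeLaw p q d K r x l =
      1 / l.fact r * ((1 - 0) ^ (l.ec r + 1) ^ 2 * Real.exp (-(d * l.ic r)) * lik p q K r x l) := by
    rw [sub_zero, one_pow, one_mul, ← fact_mul_treeLaw]
    field_simp
  have h1 : Tendsto (fun n : ℕ => 1 - C / n) atTop (𝓝 (1 - 0)) :=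
    tendsto_const_nhds.sub (tendsto_const_div_atTop_nhds_zero_nat _)
  have h2 := Real.tendsto_one_add_div_pow_exp (-(d * l.ic r))
  rw [e]
  have := ((tendsto_descFactorial_div_pow (l.ec r)).div_const (l.fact r : ℝ)).mul
    (((h1.pow ((l.ec r + 1) ^ 2)).mul h2).mul_const (lik p q K r x l))
  refine this.congr fun n => ?_
  rw [shapeMass, lik_smul, show 1 + -(d * (l.ic r : ℝ)) / n = 1 - d / n * l.ic r by ring]
  ring

/-- The limiting sums of maxima and minima again add up to 2, so lower bounds for both leave no room
in the limit. -/
lemma gap_eq_tsum_max {τ : Type*} {P : Fin 2 → τ → ℝ} (h0 : ∀ x t, 0 ≤ P x t)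
    (hs : ∀ x, HasSum (P x) 1) :
    HasSum (fun t => max (P 0 t) (P 1 t)) (1 + gap P) ∧
      HasSum (fun t => min (P 0 t) (P 1 t)) (1 - gap P) := by
  have h1 : HasSum (fun t => max (P 0 t - P 1 t) 0) (gap P) := by
    refine Summable.hasSum (Summable.of_nonneg_of_le (fun t => le_max_right _ _) (fun t => ?_)
      (hs 0).summable)
    exact max_le (sub_le_self _ (h0 1 t)) (h0 0 t)
  constructor
  · refine ((hs 1).add h1).congr_fun fun t => ?_
    rcases le_total (P 0 t) (P 1 t) with h | h
    · rw [max_eq_right h, max_eq_right (sub_nonpos.2 h), add_zero]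
    · rw [max_eq_left h, max_eq_left (sub_nonneg.2 h), add_sub_cancel]
  · refine ((hs 0).sub h1).congr_fun fun t => ?_
    rcases le_total (P 0 t) (P 1 t) with h | h
    · rw [min_eq_left h, max_eq_right (sub_nonpos.2 h), sub_zero]
    · rw [min_eq_right h, max_eq_left (sub_nonneg.2 h), sub_sub_cancel]

/-- The success probability of the local test converges to the total variation distance between
the tree laws. -/
lemma tendsto_successProb (hp0 : 0 < p) (hp1 : p < 1) (hq0 : 0 ≤ q) (hq1 : q ≤ 1)
    (hK : ∀ x y, 0 ≤ K x y) (hsymm : ∀ x y, K x y = K y x)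
    (hrow : ∀ x, ∑ y, prior p y * K x y = d) (r : ℕ) :
    Tendsto (fun n : ℕ => successProb (law ((1 / (n : ℝ)) • K) p q n)
      (localTest (law ((1 / (n : ℝ)) • K) p q n) p r)) atTop (𝓝 (gap (treeLaw p q d K r))) := by
  set C : ℝ := ∑ x, ∑ y, K x y with hC
  have hKC : ∀ x y, K x y ≤ C := fun x y =>
    (Finset.single_le_sum (fun y _ => hK x y) (Finset.mem_univ y)).trans
      (Finset.single_le_sum (f := fun x => ∑ y, K x y)
        (fun x _ => Finset.sum_nonneg fun y _ => hK x y) (Finset.mem_univ x))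
  have hlarge : ∀ B : ℝ, ∀ᶠ n : ℕ in atTop, B / n ≤ 1 := by
    intro B
    filter_upwards [eventually_ge_atTop ⌈B⌉₊, eventually_gt_atTop 0] with n hn hn0
    rw [div_le_one (by exact_mod_cast hn0)]
    exact (Nat.le_ceil B).trans (by exact_mod_cast hn)
  -- The bounds are the same for every root `i`, so they survive the average over vertices.
  -- Restricting to finitely many shapes makes the conditions on `n` uniform.
  have hbounds : ∀ LL : Finset (Shape r), ∀ᶠ n : ℕ in atTop,
      ∑ l ∈ LL, max (shapeMass ((1 / (n : ℝ)) • K) p q (C / n) (d / n) n r 0 l)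
        (shapeMass ((1 / (n : ℝ)) • K) p q (C / n) (d / n) n r 1 l) - 1 ≤
        successProb (law ((1 / (n : ℝ)) • K) p q n) (localTest (law ((1 / (n : ℝ)) • K) p q n) p r) ∧
      successProb (law ((1 / (n : ℝ)) • K) p q n) (localTest (law ((1 / (n : ℝ)) • K) p q n) p r) ≤
        1 - ∑ l ∈ LL, min (shapeMass ((1 / (n : ℝ)) • K) p q (C / n) (d / n) n r 0 l)
        (shapeMass ((1 / (n : ℝ)) • K) p q (C / n) (d / n) n r 1 l) := by
    intro LL
    have hic : ∀ᶠ n : ℕ in atTop, ∀ l ∈ LL, d / n * l.ic r ≤ 1 := by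
      rw [Filter.eventually_all_finset]
      intro l _
      filter_upwards [hlarge (d * l.ic r)] with n hn
      rwa [div_mul_eq_mul_div]
    filter_upwards [hic, hlarge C, eventually_gt_atTop 0] with n hic hCn hn0
    set M := (1 / (n : ℝ)) • K with hM
    have hn0' : (0 : ℝ) < n := by exact_mod_cast hn0
    have hMe : ∀ x y, M x y = K x y / n := fun x y => by
      rw [hM, Matrix.smul_apply, smul_eq_mul]; ring
    have hη : ∀ x y, M x y ≤ C / n := fun x y => by
      rw [hMe]; exact div_le_div_of_nonneg_right (hKC x y) hn0'.le
    have h : Params M p q := ⟨hp0, hp1, hq0, hq1, fun x y => by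
      rw [hMe]; exact div_nonneg (hK x y) hn0'.le, fun x y => (hη x y).trans hCn, fun x y => by
      rw [hMe, hMe, hsymm]⟩
    have hrow' : ∀ x, ∑ y, prior p y * M x y = d / n := fun x => by
      rw [← hrow x, Finset.sum_div]
      exact Finset.sum_congr rfl fun y _ => by rw [hMe]; ring
    have hmax := fun i : Fin n => sum_shapeMass_le h hη hCn hrow' i r max max_le_max
      (fun hc => (mul_max_of_nonneg _ _ hc).symm) (fun ha _ => le_max_of_le_left ha) LL hic
    have hmin := fun i : Fin n => sum_shapeMass_le h hη hCn hrow' i r min min_le_min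
      (fun hc => (mul_min_of_nonneg _ _ hc).symm) (fun ha hb => le_min ha hb) LL hic
    rw [successProb]
    simp only [success_term h]
    rw [one_div, inv_mul_eq_div, le_div_iff₀ hn0', div_le_iff₀ hn0']
    constructor
    · rw [mul_comm, ← nsmul_eq_mul]
      convert Finset.card_nsmul_le_sum Finset.univ _ _ fun i _ => sub_le_sub_right (hmax i) 1 using 2
      simp
    · refine (Finset.sum_le_card_nsmul Finset.univ _ (1 - ∑ l ∈ LL,
        min (shapeMass M p q (C / n) (d / n) n r 0 l) (shapeMass M p q (C / n) (d / n) n r 1 l))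
        fun i _ => ?_).trans_eq ?_
      · linarith [hmin i, sum_max_add_sum_min h i r]
      · rw [Finset.card_univ, Fintype.card_fin, nsmul_eq_mul, mul_comm]
  obtain ⟨smax, smin⟩ := gap_eq_tsum_max
    (fun x t => treeLaw_nonneg hp0.le hp1.le hq0 hq1 hK r x t)
    (fun x => hasSum_treeLaw hp0.le hp1.le hq0 hq1 hK hrow r x)
  rw [tendsto_order]
  constructor
  · intro u hu
    -- Finitely many shapes already carry enough of the sum; for these the limit in `n` is taken
    -- term by term.
    obtain ⟨LL, hLL⟩ := (smax.eventually_const_lt (show 1 + u < _ by linarith)).exists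
    have hl := tendsto_finsetSum LL fun l _ =>
      (tendsto_shapeMass (p := p) (q := q) (d := d) (K := K) C r 0 l).max
        (tendsto_shapeMass (p := p) (q := q) (d := d) (K := K) C r 1 l)
    filter_upwards [hbounds LL, hl.eventually_const_lt hLL] with n hn1 hn2
    linarith [hn1.1]
  · intro u hu
    obtain ⟨LL, hLL⟩ := (smin.eventually_const_lt (show 1 - u < _ by linarith)).exists
    have hl := tendsto_finsetSum LL fun l _ =>
      (tendsto_shapeMass (p := p) (q := q) (d := d) (K := K) C r 0 l).min
        (tendsto_shapeMass (p := p) (q := q) (d := d) (K := K) C r 1 l)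
    filter_upwards [hbounds LL, hl.eventually_const_lt hLL] with n hn1 hn2
    linarith [hn1.2]

end Limit

end SBM

theorem mainTheorem6
    (p lam q : ℝ) (hp0 : 0 < p) (hp : p ≤ 1 / 2) (hlam : 0 ≤ lam) (hq0 : 0 ≤ q) (hq1 : q ≤ 1)
    (a b c : ℝ → ℝ)
    (hdeg1 : ∀ d : ℝ, 0 < d → p * a d + (1 - p) * b d = 1)
    (hdeg2 : ∀ d : ℝ, 0 < d → p * b d + (1 - p) * c d = 1)
    (hsnr : ∀ d : ℝ, 0 < d → d * (1 - b d) ^ 2 = lam) :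
    ∃ μinf : ℝ, Tendsto (SBM.muSeq p lam q) atTop (𝓝 μinf) ∧
      ∃ (L : ℕ → ℝ → ℝ) (ℓ : ℕ → ℝ),
        (∀ (r : ℕ) (d : ℝ), 0 < d → 0 ≤ a d → 0 ≤ b d → 0 ≤ c d →
          Tendsto
            (fun n : ℕ =>
              SBM.successProb (SBM.law (SBM.connectivity (a d) (b d) (c d) d n) p q n)
                (SBM.localTest (SBM.law (SBM.connectivity (a d) (b d) (c d) d n) p q n) p r))
            atTop (𝓝 (L r d))) ∧
        (∀ r : ℕ, Tendsto (L r) atTop (𝓝 (ℓ r))) ∧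
        Tendsto ℓ atTop (𝓝 (2 * SBM.gaussPos μinf - 1)) := by
  obtain ⟨μinf, hμ⟩ := SBM.exists_tendsto_muSeq hp0 hp hlam hq0
  have hμ0 := SBM.muSeq_nonneg hp0 hp hlam hq0
  refine ⟨μinf, hμ, fun r d => SBM.gap (SBM.treeLaw p q d (d • !![a d, b d; b d, c d]) r),
    SBM.gapLim p lam q, fun r d hd ha hb hc => ?_, fun r => ?_, ?_⟩
  · have hconn : ∀ n : ℕ, SBM.connectivity (a d) (b d) (c d) d n =
        (1 / (n : ℝ)) • (d • !![a d, b d; b d, c d]) := by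
      intro n
      rw [SBM.connectivity, smul_smul, one_div_mul_eq_div]
    simp only [hconn]
    refine SBM.tendsto_successProb hp0 (by linarith) hq0 hq1 (fun x y => ?_) (fun x y => ?_)
      (fun x => ?_) r
    · fin_cases x <;> fin_cases y <;> simp <;> positivity
    · fin_cases x <;> fin_cases y <;> simp
    · have h1 := hdeg1 d hd
      have h2 := hdeg2 d hd
      fin_cases x
      · simp [SBM.prior]
        linear_combination d * h1
      · simp [SBM.prior]
        linear_combination d * h2
  · exact SBM.tendsto_gap_treeLaw hp0 hp hlam hq0 hq1 a b c hdeg1 hdeg2 hsnr r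
  -- At depth `r + 1` the limit is `gaussGap (muSeq p lam q r)`; depth 0, where the value is `q`, is
  -- dropped.
  · rw [← tendsto_add_atTop_iff_nat 1, ← SBM.gaussGap_eq μinf
      (ge_of_tendsto' hμ hμ0)]
    exact SBM.tendsto_gaussGap hμ0 hμ
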